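/- **Truncated quadrangulations.** A truncated quadrangulation is a finite rooted planar map (loops and multiple edges allowed, considered up to root-preserving, orientation-preserving homeomorphism) whose external face, the face on the right of the root edge, has a simple boundary of some length $p\ge 1$ (the perimeter), such that every edge incident to the external face is also incident to another face, which has degree 3, these triangular faces being distinct, and such that all other faces have degree 4. For $p\ge1$ let $Z(p)=\sum_Q 12^{-n(Q)}$, where the sum is over all truncated quadrangulations $Q$ with perimeter $p$ and $n(Q)$ is the number of faces of $Q$ other than the external one; let $\Gamma_p$ be the probability measure with $\Gamma_p(Q)=12^{-n(Q)}/Z(p)$ on the set of these $Q$, and let $\theta(c)=6\cdot 2^{c}Z(c+1)$ for $c\ge 0$, which is a critical offspring distribution. **The lower half-plane quadrangulation (LHPQ).** Let $(\tau_i)_{i\in\mathbb Z}$ be i.i.d. Bienaymé–Galton–Watson plane trees with offspring distribution $\theta$. For every $r\ge0$, embed the individuals of generation $r$ of this forest bijectively on $\{(j+\tfrac12,-r):j\in\mathbb Z\}$, respecting their order from left to right and so that those of the trees $\tau_i$ with $i\ge0$ are exactly those with $j\ge0$ (this is a.s. possible). Identify the individual at $(j+\frac12,-r)$ with the horizontal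 segment $e=((j,-r),(j+1,-r))$; let $c_e$ be its number of children. Given the forest, let $(S_e)_e$ be independent, $S_e$ with law $\Gamma_{c_e+1}$. With every $e=((j,-r),(j+1,-r))$ a slot is associated, with top vertex $(j,-r)$; its lower boundary on $\mathbb Z\times\{-r-1\}$ is made of the $c_e$ children of $e$ (if $c_e=0$, it is reduced to the right end of the last child of the first $e'$ on the left of $e$ that has a child). The slot is filled in by $S_e$: the third vertex of the triangle of $S_e$ incident to its root edge is glued to $(j,-r)$, the root edge goes from the right end to the left end of the lower boundary, the $c_e$ other edges of the external boundary of $S_e$ are glued, in order, to the $c_e$ children of $e$, and then all $c_e+1$ edges of the external boundary of $S_e$ are removed. The LHPQ $\mathcal L$ is the infinite map obtained in this way, together with the boundary edges $((j,0),(j+1,0))$, $j\in\mathbb Z$. Its vertices are the points of $\mathbb Z\times\{0,-1,-2,\dots\}$ and the vertices inside the slots. Write $\rho=(0,0)$ for the root vertex and $\partial_{-r}\mathcal L=\mathbb Z\times\{-r\}$, viewed as a set of vertices, and let $\widetilde{\mathcal L}$ be $\mathcal L$ with all the horizontal boundary edges $((j,0),(j+1,0))$ removed. **Proposition.** Let $\nu$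 be a probability measure on $\mathbb R$ supported on $[1,\kappa]$. Given $\widetilde{\mathcal L}$, assign i.i.d. weights with law $\nu$ to the edges of $\widetilde{\mathcal L}$, and let $d_{\mathrm{fpp}}^{\widetilde{\mathcal L}}$ be the associated first-passage percolation distance: $d_{\mathrm{fpp}}^{\widetilde{\mathcal L}}(x,y)$ is the infimum, over the paths of $\widetilde{\mathcal L}$ from $x$ to $y$, of the sum of the weights of their edges, and $d_{\mathrm{fpp}}^{\widetilde{\mathcal L}}(x,A)=\inf_{y\in A}d_{\mathrm{fpp}}^{\widetilde{\mathcal L}}(x,y)$. Then there is a constant $\mathbf c_p\in[1,\kappa]$, which depends only on $\nu$, such that $$r^{-1}\,d_{\mathrm{fpp}}^{\widetilde{\mathcal L}}(\rho,\partial_{-r}\mathcal L)\xrightarrow[r\to\infty]{}\mathbf c_p\qquad\text{almost surely.}$$ -/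

import Mathlib

open MeasureTheory ProbabilityTheory Filter Topology
open scoped ENNReal

universe u

/-! ### Finite rooted maps and truncated quadrangulations -/

/-- A finite rooted map on an oriented surface, as a rotation system. The edges are numbered by
`Fin numEdges`, every edge `e` has the two oriented versions (darts) `(e, false)` and `(e, true)`,
and `rot` sends a dart to the next dart, in counterclockwise order, with the same tail.
The cycles of `rot` are the vertices; loops and multiple edges are allowed. -/
structure RootedMap where
  numEdges : ℕ
  rot : Equiv.Perm (Fin numEdges × Bool)
  root : Fin numEdges × Bool

namespace RootedMap

/-- Oriented edges. -/
abbrev Dart (M : RootedMap) : Type := Fin M.numEdges × Bool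

/-- Reversal of oriented edges. -/
def opp (M : RootedMap) : Equiv.Perm M.Dart := Equiv.prodCongr (Equiv.refl _) Equiv.boolNot

/-- The next dart along the boundary of the face on the right of a dart: at the head of `d`, take
the dart which follows the reversed dart in counterclockwise order.
The cycles of `face` are the faces. -/
def face (M : RootedMap) : Equiv.Perm M.Dart := M.opp.trans M.rot

def Vertex (M : RootedMap) : Type := Quotient (Equiv.Perm.SameCycle.setoid M.rot)

def Face (M : RootedMap) : Type := Quotient (Equiv.Perm.SameCycle.setoid M.face)

/-- The tail of a dart. -/
def tail (M : RootedMap) (d : M.Dart) : M.Vertex :=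
  Quotient.mk (Equiv.Perm.SameCycle.setoid M.rot) d

/-- The face on the right of a dart. -/
def rightFace (M : RootedMap) (d : M.Dart) : M.Face :=
  Quotient.mk (Equiv.Perm.SameCycle.setoid M.face) d

/-- The degree of a face: the number of darts that have this face on their right. -/
noncomputable def degree (M : RootedMap) (f : M.Face) : ℕ := Nat.card {d : M.Dart // M.rightFace d = f}

def Connected (M : RootedMap) : Prop :=
  ∀ d d' : M.Dart, ∃ g ∈ Subgroup.closure ({M.rot, M.opp} : Set (Equiv.Perm M.Dart)), g d = d'

/-- Connected and of genus zero, by Euler's formula: a map on the sphere. -/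
def Planar (M : RootedMap) : Prop :=
  M.Connected ∧ Nat.card M.Vertex + Nat.card M.Face = M.numEdges + 2

/-- The external face, on the right of the root edge. -/
def extFace (M : RootedMap) : M.Face := M.rightFace M.root

/-- The length of the external boundary. -/
noncomputable def perimeter (M : RootedMap) : ℕ := M.degree M.extFace

/-- The number of faces other than the external face. -/
noncomputable def numInner (M : RootedMap) : ℕ := Nat.card {f : M.Face // f ≠ M.extFace}

/-- Truncated quadrangulations: rooted planar maps whose external face has a simple boundary, such
that every edge incident to the external face is also incident to another face, which is a
triangle, these triangles being distinct, and such that all the other faces are quadrangles. -/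
structure IsTruncQuad (M : RootedMap) : Prop where
  planar : M.Planar
  simple : ∀ d d', M.rightFace d = M.extFace → M.rightFace d' = M.extFace →
    M.tail d = M.tail d' → d = d'
  not_ext : ∀ d, M.rightFace d = M.extFace → M.rightFace (M.opp d) ≠ M.extFace
  triangle : ∀ d, M.rightFace d = M.extFace → M.degree (M.rightFace (M.opp d)) = 3
  triangles_distinct : ∀ d d', M.rightFace d = M.extFace → M.rightFace d' = M.extFace →
    M.rightFace (M.opp d) = M.rightFace (M.opp d') → d = d'
  quadrangle : ∀ f : M.Face, f ≠ M.extFace →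
    (∀ d, M.rightFace d = M.extFace → f ≠ M.rightFace (M.opp d)) → M.degree f = 4

/-- Two rooted maps are the same up to a root-preserving, orientation-preserving homeomorphism. -/
def Iso (M M' : RootedMap) : Prop :=
  ∃ f : M.Dart ≃ M'.Dart, (∀ d, f (M.opp d) = M'.opp (f d)) ∧ (∀ d, f (M.rot d) = M'.rot (f d)) ∧
    f M.root = M'.root

/-- The `i`-th vertex of the external boundary, where the boundary is followed with the external
face on the right, starting from the head of the root edge (which is the vertex `0`). -/
def bdry (M : RootedMap) (i : ℕ) : M.Vertex := M.tail ((M.face ^ (i + 1)) M.root)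

/-- The third vertex of the triangle incident to the root edge. -/
def apex (M : RootedMap) : M.Vertex := M.tail (M.face (M.face (M.opp M.root)))

/-- Edges that are not on the external boundary. -/
def InnerEdge (M : RootedMap) : Type :=
  {e : Fin M.numEdges // ∀ b : Bool, M.rightFace (e, b) ≠ M.extFace}

end RootedMap

/-- Isomorphism as an equivalence relation on truncated quadrangulations. -/
instance truncQuadSetoid : Setoid {M : RootedMap // M.IsTruncQuad} where
  r M M' := M.1.Iso M'.1
  iseqv :=
    { refl := fun _ => ⟨Equiv.refl _, fun _ => rfl, fun _ => rfl, rfl⟩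
      symm := by
        rintro M M' ⟨f, h1, h2, h3⟩
        refine ⟨f.symm, fun d => ?_, fun d => ?_, ?_⟩
        · apply f.injective; rw [h1]; simp
        · apply f.injective; rw [h2]; simp
        · rw [← h3]; simp
      trans := by
        rintro M M' M'' ⟨f, h1, h2, h3⟩ ⟨g, k1, k2, k3⟩
        exact ⟨f.trans g, fun d => by simp [h1, k1], fun d => by simp [h2, k2], by simp [h3, k3]⟩ }

/-- The countable set of all truncated quadrangulations (up to isomorphism). -/
def TruncQuad : Type := Quotient truncQuadSetoid

instance : MeasurableSpace TruncQuad := ⊤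

namespace TruncQuad

/-- A representative of the isomorphism class. -/
noncomputable def map (Q : TruncQuad) : RootedMap := (Quotient.out Q).1

noncomputable def perimeter (Q : TruncQuad) : ℕ := Q.map.perimeter

noncomputable def numInner (Q : TruncQuad) : ℕ := Q.map.numInner

end TruncQuad

/-- `Z(p)`, the sum of `12^{-n}` over all truncated quadrangulations with perimeter `p`, where `n` is
the number of inner faces. -/
noncomputable def partitionZ (p : ℕ) : ℝ≥0∞ :=
  ∑' Q : {Q : TruncQuad // Q.perimeter = p}, (12 : ℝ≥0∞)⁻¹ ^ Q.1.numInner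

open Classical in
/-- The Boltzmann weight `Γ_p(Q) = 12^{-n} / Z(p)`, supported on perimeter `p`. -/
noncomputable def boltzmann (p : ℕ) (Q : TruncQuad) : ℝ≥0∞ :=
  if Q.perimeter = p then (12 : ℝ≥0∞)⁻¹ ^ Q.numInner / partitionZ p else 0

/-- The offspring distribution `θ(c) = 6 · 2^c · Z(c+1)`. -/
noncomputable def theta (c : ℕ) : ℝ≥0∞ := 6 * 2 ^ c * partitionZ (c + 1)

/-- The joint law of an offspring number `c` with law `θ` and of a truncated quadrangulation which,
given `c`, has law `Γ_{c+1}`. -/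
noncomputable def markLaw : Measure (ℕ × TruncQuad) :=
  Measure.sum fun x : ℕ × TruncQuad => (theta x.1 * boltzmann (x.1 + 1) x.2) • Measure.dirac x

/-! ### Skeleton: a forest of plane trees indexed by the integers, embedded in the lattice -/

/-- `(i, u)` is the individual with Ulam-Harris label `u` in the `i`-th tree of the forest:
`(i, [])` is the root of this tree and the children of `(i, u)` are `(i, u ++ [k])`,
`k = 0, 1, …`, from left to right. -/
abbrev Individual : Type := ℤ × List ℕ

/-- If the individuals of a generation are indexed by `ℤ` from left to right, with offspring numbers
`c i`, and their children are indexed by `ℤ` as well, those of the individuals `i ≥ 0` being indexed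
by `0, 1, …` and those of the individuals `i < 0` by `…, -2, -1`, then the children of the
individual `j` have the indices `k` with `leftEnd c j ≤ k < leftEnd c (j + 1)`. -/
noncomputable def leftEnd (c : ℤ → ℕ) (j : ℤ) : ℤ :=
  (∑ i ∈ Finset.Ico 0 j, (c i : ℤ)) - ∑ i ∈ Finset.Ico j 0, (c i : ℤ)

open Classical in
/-- `individual N r j` is the individual of generation `r` that is embedded at `(j + 1/2, -r)`, when
the individual `v` has `N v` children. The embedding respects the order of the individuals, and
exactly the trees with nonnegative index are on the right of `0`. (The last case does not occur if
every generation has infinitely many individuals in the trees of positive and in the trees of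
negative index.) -/
noncomputable def individual (N : Individual → ℕ) : ℕ → ℤ → Individual
  | 0 => fun j => (j, [])
  | r + 1 => fun j =>
    if h : ∃ i : ℤ, leftEnd (fun i => N (individual N r i)) i ≤ j ∧
        j < leftEnd (fun i => N (individual N r i)) (i + 1) then
      ((individual N r h.choose).1, (individual N r h.choose).2 ++
        [(j - leftEnd (fun i => N (individual N r i)) h.choose).toNat])
    else (j, [])

/-! ### Multigraphs and first-passage percolation distances -/

/-- A graph with vertex set `V` and edge set `E`; loops and multiple edges are allowed. The order of
the two ends of an edge carries no meaning. -/
structure Multigraph (V E : Type) where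
  fst : E → V
  snd : E → V

namespace Multigraph

variable {V E : Type}

/-- The graph with only the edges indexed by `E'`. -/
def comap {E' : Type} (G : Multigraph V E) (f : E' → E) : Multigraph V E' :=
  ⟨fun e => G.fst (f e), fun e => G.snd (f e)⟩

/-- Paths, which may follow the edges in both directions. -/
inductive Walk (G : Multigraph V E) : V → V → Type
  | nil (x : V) : Walk G x x
  | forward (e : E) {y : V} (γ : Walk G (G.snd e) y) : Walk G (G.fst e) y
  | backward (e : E) {y : V} (γ : Walk G (G.fst e) y) : Walk G (G.snd e) y

/-- The sum of the weights of the edges of a path. -/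
noncomputable def Walk.weight {G : Multigraph V E} (w : E → ℝ≥0∞) :
    {x y : V} → G.Walk x y → ℝ≥0∞
  | _, _, .nil _ => 0
  | _, _, .forward e γ => w e + γ.weight w
  | _, _, .backward e γ => w e + γ.weight w

/-- First-passage percolation distance between two vertices. -/
noncomputable def fpp (G : Multigraph V E) (w : E → ℝ≥0∞) (x y : V) : ℝ≥0∞ :=
  ⨅ γ : G.Walk x y, γ.weight w

/-- First-passage percolation distance between a vertex and a set of vertices. -/
noncomputable def fppSet (G : Multigraph V E) (w : E → ℝ≥0∞) (x : V) (A : Set V) : ℝ≥0∞ :=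
  ⨅ y ∈ A, G.fpp w x y

end Multigraph

/-! ### The lower half-plane quadrangulation -/

namespace LHPQ

/-- The pair `(j, r)` stands for the lattice point `(j, -r)`, and also for the horizontal edge from
`(j, -r)` to `(j + 1, -r)`, which is identified with an individual of generation `r`. -/
abbrev Site : Type := ℤ × ℕ

/-- A realization of the randomness of the map: for every individual its offspring number and the
truncated quadrangulation that fills the associated slot. -/
abbrev Marks : Type := Individual → ℕ × TruncQuad

/-- The individual embedded in the middle of a horizontal edge. -/
noncomputable def ind (x : Marks) (p : Site) : Individual := individual (fun v => (x v).1) p.2 p.1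

/-- The offspring number of a horizontal edge. -/
noncomputable def offspring (x : Marks) (p : Site) : ℕ := (x (ind x p)).1

/-- The truncated quadrangulation that fills the slot associated with a horizontal edge. -/
noncomputable def filling (x : Marks) (p : Site) : RootedMap := (x (ind x p)).2.map

/-- The first coordinate of the left end of the lower boundary of the slot associated with the
horizontal edge `(j, r)`. This slot has the top vertex `(j, -r)`, and its lower boundary goes from
`(slotLeft x (j, r), -(r + 1))` to `(slotLeft x (j + 1, r), -(r + 1))`. These are the bottom vertices
of the downward triangles with top edges `(j - 1, r)` and `(j, r)`. -/
noncomputable def slotLeft (x : Marks) (p : Site) : ℤ := leftEnd (fun i => offspring x (i, p.2)) p.1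

/-- `v` is on the external boundary of the filling (which has `offspring x p + 1` vertices). -/
def OnBoundary (x : Marks) (p : Site) (v : (filling x p).Vertex) : Prop :=
  ∃ i : ℕ, i ≤ offspring x p ∧ v = (filling x p).bdry i

/-- The vertices: the lattice points, and the vertices in the interior of a slot. -/
def Vertex (x : Marks) : Type :=
  Site ⊕ (Σ p : Site, {v : (filling x p).Vertex // ¬ v = (filling x p).apex ∧ ¬ OnBoundary x p v})

open Classical in
/-- The gluing of the truncated quadrangulation which fills the slot associated with `p = (j, r)`.
Its root edge lies over the top vertex of the slot: the third vertex of the triangle incident to the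
root edge is glued to `(j, -r)`, the root edge goes from the right end to the left end of the lower
boundary of the slot, and the other external edges are glued, from left to right, to the edges of
this lower boundary, which are the offspring of `p`. -/
noncomputable def place (x : Marks) (p : Site) (v : (filling x p).Vertex) : Vertex x :=
  if h₁ : v = (filling x p).apex then Sum.inl p
  else if h₂ : OnBoundary x p v then Sum.inl (slotLeft x p + (Nat.find h₂ : ℕ), p.2 + 1)
  else Sum.inr ⟨p, v, h₁, h₂⟩

/-- The edges inside the slots (including the sides of the downward triangles): all edges of the
fillings, except those of their external boundaries, which are removed. -/
def SlotEdge (x : Marks) : Type := Σ p : Site, (filling x p).InnerEdge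

/-- The lower half-plane quadrangulation: the horizontal edges from `(j, 0)` to `(j + 1, 0)` for
`j : ℤ`, and the edges inside the slots. -/
noncomputable def graph (x : Marks) : Multigraph (Vertex x) (ℤ ⊕ SlotEdge x) where
  fst := Sum.elim (fun j => Sum.inl (j, 0))
    (fun e => place x e.1 ((filling x e.1).tail (e.2.1, false)))
  snd := Sum.elim (fun j => Sum.inl (j + 1, 0))
    (fun e => place x e.1 ((filling x e.1).tail (e.2.1, true)))

/-- The same map with the horizontal boundary edges removed. -/
noncomputable def tildeGraph (x : Marks) : Multigraph (Vertex x) (SlotEdge x) :=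
  (graph x).comap Sum.inr

/-- The root vertex `(0, 0)`. -/
def rootVertex (x : Marks) : Vertex x := Sum.inl (0, 0)

/-- The set of all lattice points `(j, -r)`, for fixed `r`. -/
def line (x : Marks) (r : ℕ) : Set (Vertex x) := {v | ∃ j : ℤ, v = Sum.inl (j, r)}

/-- The first-passage percolation distance, in the map without horizontal boundary edges, between
the root vertex and the line at height `-r`, when `t p k` is the weight of the edge with number `k`
in the slot `p`. -/
noncomputable def fppToLine (x : Marks) (t : Site → ℕ → ℝ) (r : ℕ) : ℝ≥0∞ :=
  (tildeGraph x).fppSet (fun e => ENNReal.ofReal (t e.1 e.2.1.val)) (rootVertex x) (line x r)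

/-- `X` and `T` are random variables that generate the lower half-plane quadrangulation and its edge
weights: the offspring numbers are independent with law `θ` (so that the trees of the skeleton are
independent Bienaymé-Galton-Watson trees), given these numbers the fillings are independent, that
of an individual with `c` children having law `Γ_{c+1}`, and, given the map, the weights of the edges
are independent with law `ν`. -/
structure IsModel {Ω : Type u} [MeasurableSpace Ω] (P : Measure Ω) (ν : Measure ℝ)
    (X : Ω → Marks) (T : Ω → Site → ℕ → ℝ) : Prop where
  measurable_marks : ∀ v : Individual, Measurable fun ω => X ω v
  measurable_weights : ∀ (p : Site) (k : ℕ), Measurable fun ω => T ω p k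
  law_marks : ∀ v : Individual, P.map (fun ω => X ω v) = markLaw
  law_weights : ∀ (p : Site) (k : ℕ), P.map (fun ω => T ω p k) = ν
  indep_marks : iIndepFun (fun (v : Individual) (ω : Ω) => X ω v) P
  indep_weights : iIndepFun (fun (e : Site × ℕ) (ω : Ω) => T ω e.1 e.2) P
  indep_marks_weights : IndepFun X T P

end LHPQ

/-!
The map is generated by independent slots. Let the environment be the family, indexed by the
horizontal edges, of the offspring number, the filling and the edge weights of the slot below each
edge; the percolation distances are functions of it (`LHPQ.fppToLine_eq`). The edge at a given place
is an individual that is determined by the previous generations, and distinct places at the same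
height carry distinct individuals, so reading an i.i.d. family at these random labels gives an i.i.d.
family (`measure_inter_relabel`). Hence the environment is i.i.d. with an explicit law
(`LHPQ.IsModel.map_toEnv`), provided that every place of every generation is occupied. This holds
because individuals have a positive probability to have children (`markLaw_fst_ne_zero`). The value
of `Z` is not needed for that: an injection that preserves the number of inner faces shows that
`Z(2) ≤ Z(1)` (`partitionZ_two_le`), so if the law of the offspring number were concentrated on `0`,
then `Z(1)`, hence `Z(2)`, would be finite, and one child would have positive probability after all.

The distance `D n` from the root vertex to the line at height `-n` only involves the slots above
this line (`LHPQ.lineDist_eq`), and lies between `n` and `κ n`: all edges join vertices whose levels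
differ by at most one, and following the left sides of downward triangles gives a path with one edge
for each level. For the latter one has to know that these sides are edges of the map which do lead
downwards, i.e. that the third vertex of the triangle is not a vertex of the root edge; this is so
because the vertices of a truncated quadrangulation have a two-colouring for which exactly the
external edges are monochromatic (`RootedMap.IsTruncQuad.exists_coloring`), by planarity.

Let `x` be an almost closest point of the line at height `-m`, chosen as a function of the slots
above this line. The map below the line, seen from `x`, has the law of the whole map and is
independent of the slots above (`LHPQ.envLaw_inter_shift`), and
`D (m + n) ≤ D m + ε + D n ∘ Φ m`, where `Φ m` is the change of the origin to `x`
(`LHPQ.isAlmostSubadditive_lineDist`).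
As the maps `Φ m` are not the powers of one transformation, and there is an error `ε`, Kingman's
theorem is replaced by a direct argument (`IsAlmostSubadditive.tendsto_div`). The expectations are
subadditive, so `E[D n] / n` has a limit `c`. The law of large numbers on blocks of length `k` gives
`limsup D n / n ≤ (E[D k] + 1) / k`. For the lower bound, the event that `liminf D n / n < c'` has
probability `0` or `1` (`IsAlmostSubadditive.measure_lowSet`), and in the second case one can cut the
time into blocks along which the process grows at rate at most `c'`, so that `c ≤ c'`
(`IsAlmostSubadditive.lim_le_of_lowSet`).
-/

/-! ### First-passage percolation distances on a multigraph -/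

namespace Multigraph

variable {V E V' E' : Type}

/-- Concatenation of paths. -/
def Walk.append {G : Multigraph V E} : {x y z : V} → G.Walk x y → G.Walk y z → G.Walk x z
  | _, _, _, .nil _, δ => δ
  | _, _, _, .forward e γ, δ => .forward e (γ.append δ)
  | _, _, _, .backward e γ, δ => .backward e (γ.append δ)

theorem Walk.weight_append {G : Multigraph V E} (w : E → ℝ≥0∞) {x y z : V} (γ : G.Walk x y)
    (δ : G.Walk y z) : (γ.append δ).weight w = γ.weight w + δ.weight w := by
  induction γ with
  | nil => simp [append, weight]
  | forward e γ ih => simp [append, weight, ih, add_assoc]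
  | backward e γ ih => simp [append, weight, ih, add_assoc]

theorem fpp_self (G : Multigraph V E) (w : E → ℝ≥0∞) (x : V) : G.fpp w x x = 0 :=
  le_antisymm (iInf_le_of_le (.nil x) le_rfl) zero_le

theorem fpp_triangle (G : Multigraph V E) (w : E → ℝ≥0∞) (x y z : V) :
    G.fpp w x z ≤ G.fpp w x y + G.fpp w y z := by
  rw [fpp, fpp, fpp, ENNReal.iInf_add]
  refine le_iInf fun γ => ?_
  rw [ENNReal.add_iInf]
  refine le_iInf fun δ => ?_
  exact iInf_le_of_le (γ.append δ) (Walk.weight_append w γ δ).le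

theorem fpp_fst_snd (G : Multigraph V E) (w : E → ℝ≥0∞) (e : E) :
    G.fpp w (G.fst e) (G.snd e) ≤ w e :=
  iInf_le_of_le (.forward e (.nil _)) (by simp [Walk.weight])

theorem fpp_snd_fst (G : Multigraph V E) (w : E → ℝ≥0∞) (e : E) :
    G.fpp w (G.snd e) (G.fst e) ≤ w e :=
  iInf_le_of_le (.backward e (.nil _)) (by simp [Walk.weight])

/-- The distance from `x` is the largest function that vanishes at `x` and does not vary by more
than the weight along any edge. -/
theorem le_fpp_of_potential (G : Multigraph V E) (w : E → ℝ≥0∞) (φ : V → ℝ≥0∞) {x : V}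
    (h0 : φ x = 0) (h1 : ∀ e, φ (G.snd e) ≤ φ (G.fst e) + w e)
    (h2 : ∀ e, φ (G.fst e) ≤ φ (G.snd e) + w e) (y : V) : φ y ≤ G.fpp w x y := by
  have key : ∀ {a b : V} (γ : G.Walk a b), φ b ≤ φ a + γ.weight w := by
    intro a b γ
    induction γ with
    | nil => simp [Walk.weight]
    | forward e γ ih =>
      refine ih.trans ?_
      rw [Walk.weight, ← add_assoc]
      gcongr
      exact h1 e
    | backward e γ ih =>
      refine ih.trans ?_
      rw [Walk.weight, ← add_assoc]
      gcongr
      exact h2 e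
  refine le_iInf fun γ => ?_
  simpa [h0] using key γ

theorem fpp_mono (G : Multigraph V E) {w w' : E → ℝ≥0∞} (h : ∀ e, w e ≤ w' e) (x y : V) :
    G.fpp w x y ≤ G.fpp w' x y :=
  le_fpp_of_potential G w' (G.fpp w x) (fpp_self G w x)
    (fun e => (fpp_triangle G w _ _ _).trans (by gcongr; exact (fpp_fst_snd G w e).trans (h e)))
    (fun e => (fpp_triangle G w _ _ _).trans (by gcongr; exact (fpp_snd_fst G w e).trans (h e))) y

/-- An embedding of weighted multigraphs preserves distances if the edges that are not in its image
have infinite weight. -/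
theorem fpp_map (G : Multigraph V E) (G' : Multigraph V' E') (w : E → ℝ≥0∞) (w' : E' → ℝ≥0∞)
    (f : V → V') (g : E → E') (hf : Function.Injective f)
    (hfst : ∀ e, G'.fst (g e) = f (G.fst e)) (hsnd : ∀ e, G'.snd (g e) = f (G.snd e))
    (hw : ∀ e, w' (g e) = w e) (hw' : ∀ e', w' e' ≠ ⊤ → e' ∈ Set.range g) (x y : V) :
    G'.fpp w' (f x) (f y) = G.fpp w x y := by
  apply le_antisymm
  · refine le_fpp_of_potential G w (fun y => G'.fpp w' (f x) (f y)) (fpp_self _ _ _) ?_ ?_ y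
    · intro e
      refine (fpp_triangle G' w' _ (f (G.fst e)) _).trans ?_
      gcongr
      rw [← hfst, ← hsnd, ← hw]
      exact fpp_fst_snd _ _ _
    · intro e
      refine (fpp_triangle G' w' _ (f (G.snd e)) _).trans ?_
      gcongr
      rw [← hfst, ← hsnd, ← hw]
      exact fpp_snd_fst _ _ _
  · have hval : ∀ z, (⨅ (z' : V) (_ : f z' = f z), G.fpp w x z') = G.fpp w x z := fun z =>
      le_antisymm (iInf_le_of_le z (iInf_le _ rfl)) (le_iInf₂ fun z' hz' => (by rw [hf hz']))
    have := le_fpp_of_potential G' w' (fun v => ⨅ (z : V) (_ : f z = v), G.fpp w x z) (x := f x)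
      (by rw [hval, fpp_self]) ?_ ?_ (f y)
    · rwa [hval] at this
    all_goals
      intro e'
      by_cases he : w' e' = ⊤
      · simp [he]
      obtain ⟨e, rfl⟩ := hw' e' he
      rw [hfst, hsnd, hval, hval, hw]
      refine (fpp_triangle G w _ _ _).trans (add_le_add_right ?_ _)
    · exact fpp_fst_snd _ _ _
    · exact fpp_snd_fst _ _ _

/-- Minimal weight of paths with at most `n` edges. -/
noncomputable def fppSteps (G : Multigraph V E) (w : E → ℝ≥0∞) (x : V) : ℕ → V → ℝ≥0∞
  | 0, y => ⨅ _ : x = y, 0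
  | n + 1, y => fppSteps G w x n y ⊓ ⨅ (z : V) (e : E),
      (fppSteps G w x n z + ((⨅ (_ : G.fst e = z) (_ : G.snd e = y), w e) ⊓
        ⨅ (_ : G.fst e = y) (_ : G.snd e = z), w e))

theorem iInf_fppSteps (G : Multigraph V E) (w : E → ℝ≥0∞) (x y : V) :
    ⨅ n, G.fppSteps w x n y = G.fpp w x y := by
  apply le_antisymm
  · refine le_fpp_of_potential G w (fun y => ⨅ n, G.fppSteps w x n y) ?_ ?_ ?_ y
    · exact le_antisymm (iInf_le_of_le 0 (by simp [fppSteps])) zero_le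
    · intro e
      simp only [ENNReal.iInf_add]
      refine le_iInf fun n => iInf_le_of_le (n + 1) ?_
      rw [fppSteps]
      refine inf_le_right.trans (iInf₂_le_of_le (G.fst e) e ?_)
      gcongr
      exact inf_le_left.trans (by simp)
    · intro e
      simp only [ENNReal.iInf_add]
      refine le_iInf fun n => iInf_le_of_le (n + 1) ?_
      rw [fppSteps]
      refine inf_le_right.trans (iInf₂_le_of_le (G.snd e) e ?_)
      gcongr
      exact inf_le_right.trans (by simp)
  · refine le_iInf fun n => ?_
    induction n generalizing y with
    | zero =>
      refine le_iInf fun h => ?_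
      subst h
      exact (fpp_self _ _ _).le
    | succ n ih =>
      rw [fppSteps]
      refine le_inf (ih y) (le_iInf₂ fun z e => (fpp_triangle G w x z y).trans ?_)
      refine add_le_add (ih z) (le_inf (le_iInf₂ ?_) (le_iInf₂ ?_))
      · rintro rfl rfl; exact fpp_fst_snd _ _ _
      · rintro rfl rfl; exact fpp_snd_fst _ _ _

/-- In a random weighted multigraph, distances are random variables as soon as the weight of
an edge is one on the event that the edge has given ends. -/
theorem measurable_fpp {Ω : Type*} [MeasurableSpace Ω] [Countable V] [Countable E]
    (G : Ω → Multigraph V E) (w : Ω → E → ℝ≥0∞)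
    (h : ∀ e a b, Measurable fun ω => ⨅ (_ : (G ω).fst e = a) (_ : (G ω).snd e = b), w ω e)
    (x y : V) : Measurable fun ω => (G ω).fpp (w ω) x y := by
  simp_rw [← iInf_fppSteps]
  refine Measurable.iInf fun n => ?_
  induction n generalizing y with
  | zero => simp only [fppSteps]; exact measurable_const
  | succ n ih =>
    simp only [fppSteps]
    exact (ih y).inf (Measurable.iInf fun z => Measurable.iInf fun e =>
      (ih z).add ((h e z y).inf (h e y z)))

end Multigraph

/-! ### Planar rooted maps -/

namespace RootedMap

variable (M : RootedMap)

instance : Finite M.Vertex := Quotient.finite _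

instance : Finite M.Face := Quotient.finite _

@[simp] theorem opp_opp (d : M.Dart) : M.opp (M.opp d) = d := by
  rcases d with ⟨e, b⟩
  simp [opp]

theorem face_apply (d : M.Dart) : M.face d = M.rot (M.opp d) := rfl

theorem rot_apply (d : M.Dart) : M.rot d = M.face (M.opp d) := by simp [face_apply]

theorem rightFace_eq_iff {d d' : M.Dart} :
    M.rightFace d = M.rightFace d' ↔ M.face.SameCycle d d' := Quotient.eq

theorem tail_eq_iff {d d' : M.Dart} : M.tail d = M.tail d' ↔ M.rot.SameCycle d d' := Quotient.eq

@[simp] theorem rightFace_face (d : M.Dart) : M.rightFace (M.face d) = M.rightFace d :=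
  M.rightFace_eq_iff.2 (Equiv.Perm.sameCycle_apply_left.2 (Equiv.Perm.SameCycle.refl _ _))

@[simp] theorem tail_rot (d : M.Dart) : M.tail (M.rot d) = M.tail d :=
  M.tail_eq_iff.2 (Equiv.Perm.sameCycle_apply_left.2 (Equiv.Perm.SameCycle.refl _ _))

@[simp] theorem tail_face (d : M.Dart) : M.tail (M.face d) = M.tail (M.opp d) := by
  simp [face_apply]

theorem rightFace_surjective : Function.Surjective M.rightFace := Quotient.mk_surjective

theorem tail_surjective : Function.Surjective M.tail := Quotient.mk_surjective

variable {M}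

theorem sameCycle_lift {α β : Type*} {σ : Equiv.Perm α} {g : α → β} (hg : ∀ a, g (σ a) = g a) {a b : α}
    (h : σ.SameCycle a b) : g a = g b := by
  obtain ⟨i, rfl⟩ := h
  have hz : ∀ i : ℤ, ∀ a, g ((σ ^ i) a) = g a := by
    intro i
    induction i with
    | zero => simp
    | succ n ih => intro a; rw [zpow_add_one, Equiv.Perm.mul_apply, ih, hg]
    | pred n ih =>
      intro a
      rw [zpow_sub_one, Equiv.Perm.mul_apply, ih, ← hg, ← Equiv.Perm.mul_apply, mul_inv_cancel,
        Equiv.Perm.one_apply]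
  exact (hz i a).symm

theorem Connected.eq_of_invariant (h : M.Connected) {β : Type*} (g : M.Dart → β)
    (hrot : ∀ d, g (M.rot d) = g d) (hopp : ∀ d, g (M.opp d) = g d) (d d' : M.Dart) :
    g d = g d' := by
  obtain ⟨σ, hσ, rfl⟩ := h d d'
  have key : ∀ d, g (σ d) = g d := by
    induction hσ using Subgroup.closure_induction with
    | mem x hx =>
      rcases hx with rfl | rfl
      · exact hrot
      · exact hopp
    | one => simp
    | mul x y _ _ hx hy => intro d; rw [Equiv.Perm.mul_apply, hx, hy]
    | inv x _ hx => intro d; rw [← hx (x⁻¹ d), ← Equiv.Perm.mul_apply, mul_inv_cancel, Equiv.Perm.one_apply]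
  exact (key d).symm

theorem connected_of_invariant
    (h : ∀ P : M.Dart → Prop, (∀ d, P (M.face d) ↔ P d) → (∀ d, P (M.opp d) ↔ P d) →
      P M.root → ∀ d, P d) : M.Connected := by
  have hmem : M.rot ∈ Subgroup.closure ({M.rot, M.opp} : Set (Equiv.Perm M.Dart)) :=
    Subgroup.subset_closure (by simp)
  have hmem' : M.opp ∈ Subgroup.closure ({M.rot, M.opp} : Set (Equiv.Perm M.Dart)) :=
    Subgroup.subset_closure (by simp)
  have hopp : ∀ d, (∃ g ∈ Subgroup.closure ({M.rot, M.opp} : Set (Equiv.Perm M.Dart)),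
      g M.root = M.opp d) ↔ ∃ g ∈ Subgroup.closure ({M.rot, M.opp} : Set (Equiv.Perm M.Dart)),
      g M.root = d := by
    intro d
    constructor
    · rintro ⟨g, hg, h⟩
      exact ⟨M.opp * g, mul_mem hmem' hg, by simp [h]⟩
    · rintro ⟨g, hg, h⟩
      exact ⟨M.opp * g, mul_mem hmem' hg, by simp [h]⟩
  have key := h (fun d => ∃ g ∈ Subgroup.closure ({M.rot, M.opp} : Set (Equiv.Perm M.Dart)),
    g M.root = d) ?_ hopp ⟨1, one_mem _, rfl⟩
  · intro d d'
    obtain ⟨g, hg, rfl⟩ := key d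
    obtain ⟨g', hg', rfl⟩ := key d'
    exact ⟨g' * g⁻¹, mul_mem hg' (inv_mem hg), by simp⟩
  · intro d
    rw [← hopp d]
    constructor
    · rintro ⟨g, hg, h⟩
      exact ⟨M.rot⁻¹ * g, mul_mem (inv_mem hmem) hg, by simp [h, face_apply]⟩
    · rintro ⟨g, hg, h⟩
      exact ⟨M.rot * g, mul_mem hmem hg, by simp [h, face_apply]⟩

section Homology

/-- The sum of the values of a function at the two ends of an edge. -/
def vertexDiff (M : RootedMap) (f : M.Vertex → ZMod 2) (e : Fin M.numEdges) : ZMod 2 :=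
  f (M.tail (e, false)) + f (M.tail (e, true))

/-- The sum of the values of a function at the two faces incident to an edge. -/
def faceDiff (M : RootedMap) (g : M.Face → ZMod 2) (e : Fin M.numEdges) : ZMod 2 :=
  g (M.rightFace (e, false)) + g (M.rightFace (e, true))

theorem sum_edges {β : Type*} [AddCommMonoid β] (M : RootedMap) (h : M.Dart → β) :
    ∑ e, (h (e, false) + h (e, true)) = ∑ d, h d := by
  rw [Fintype.sum_prod_type]
  exact Finset.sum_congr rfl fun e _ => by simp [add_comm]

/-- Vertices and faces are orthogonal modulo 2: the boundary of a face passes through every vertex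
an even number of times. -/
theorem sum_vertexDiff_mul_faceDiff (f : M.Vertex → ZMod 2) (g : M.Face → ZMod 2) :
    ∑ e, M.vertexDiff f e * M.faceDiff g e = 0 := by
  have h1 : ∀ e, M.vertexDiff f e * M.faceDiff g e =
      (fun d : M.Dart => f (M.tail d) * g (M.rightFace d) +
        f (M.tail d) * g (M.rightFace (M.opp d))) (e, false) +
      (fun d : M.Dart => f (M.tail d) * g (M.rightFace d) +
        f (M.tail d) * g (M.rightFace (M.opp d))) (e, true) := by
    intro e
    have e1 : M.opp (e, false) = (e, true) := rfl
    have e2 : M.opp (e, true) = (e, false) := rfl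
    simp only [vertexDiff, faceDiff, e1, e2]
    ring
  rw [(Finset.sum_congr rfl fun e _ => h1 e).trans (sum_edges M fun d =>
    f (M.tail d) * g (M.rightFace d) + f (M.tail d) * g (M.rightFace (M.opp d))),
    Finset.sum_add_distrib]
  have h2 : ∑ d, f (M.tail d) * g (M.rightFace (M.opp d)) =
      ∑ d, f (M.tail d) * g (M.rightFace d) := by
    rw [← Equiv.sum_comp M.rot (fun d => f (M.tail d) * g (M.rightFace d))]
    refine Finset.sum_congr rfl fun d _ => ?_
    rw [tail_rot, rot_apply, rightFace_face]
  rw [h2]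
  exact CharTwo.add_self_eq_zero _

open Classical in
/-- For a connected map, Euler's inequality holds; in genus zero, moreover, a set of edges that has
an even number of edges along every face is the set of edges between the two parts of a partition
of the vertices. -/
theorem Connected.euler (hM : M.Connected) :
    Nat.card M.Vertex + Nat.card M.Face ≤ M.numEdges + 2 ∧
    (Nat.card M.Vertex + Nat.card M.Face = M.numEdges + 2 → ∀ α : Fin M.numEdges → ZMod 2,
      (∀ g, ∑ e, α e * M.faceDiff g e = 0) → ∃ f, ∀ e, M.vertexDiff f e = α e) := by
  let := Fintype.ofFinite M.Vertex
  let := Fintype.ofFinite M.Face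
  let A : Matrix (Fin M.numEdges) M.Vertex (ZMod 2) := Matrix.of fun e v =>
    (if M.tail (e, false) = v then 1 else 0) + if M.tail (e, true) = v then 1 else 0
  let B : Matrix (Fin M.numEdges) M.Face (ZMod 2) := Matrix.of fun e v =>
    (if M.rightFace (e, false) = v then 1 else 0) + if M.rightFace (e, true) = v then 1 else 0
  have hA : ∀ f, A.mulVec f = M.vertexDiff f := by
    intro f; ext e
    simp [A, Matrix.mulVec, dotProduct, vertexDiff, add_mul, Finset.sum_add_distrib]
  have hB : ∀ f, B.mulVec f = M.faceDiff f := by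
    intro f; ext e
    simp [B, Matrix.mulVec, dotProduct, faceDiff, add_mul, Finset.sum_add_distrib]
  have hBt : ∀ α : Fin M.numEdges → ZMod 2,
      B.transpose.mulVec α = 0 ↔ ∀ g, ∑ e, α e * M.faceDiff g e = 0 := by
    intro α
    have : ∀ g, g ⬝ᵥ B.transpose.mulVec α = ∑ e, α e * M.faceDiff g e := by
      intro g
      rw [Matrix.dotProduct_mulVec, Matrix.vecMul_transpose, hB, dotProduct_comm]
      rfl
    simp_rw [← this]
    constructor
    · intro h g; rw [h, dotProduct_zero]
    · intro h
      exact dotProduct_eq_zero _ fun g => by rw [dotProduct_comm]; exact h g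
  have hle : LinearMap.range A.mulVecLin ≤ LinearMap.ker B.transpose.mulVecLin := by
    rintro _ ⟨f, rfl⟩
    rw [LinearMap.mem_ker, Matrix.mulVecLin_apply, Matrix.mulVecLin_apply, hA, hBt]
    exact sum_vertexDiff_mul_faceDiff f
  have hkerA : Module.finrank (ZMod 2) (LinearMap.ker A.mulVecLin) = 1 := by
    have h1 : (fun _ => 1) ∈ LinearMap.ker A.mulVecLin := by
      rw [LinearMap.mem_ker, Matrix.mulVecLin_apply, hA]
      ext e; exact CharTwo.add_self_eq_zero _
    refine (finrank_eq_one_iff_of_nonzero' ⟨_, h1⟩ ?_).2 ?_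
    · intro h
      exact one_ne_zero (congrFun (congrArg Subtype.val h) (M.tail M.root))
    · rintro ⟨f, hf⟩
      refine ⟨f (M.tail M.root), Subtype.ext (funext fun v => ?_)⟩
      obtain ⟨d, rfl⟩ := M.tail_surjective v
      rw [LinearMap.mem_ker, Matrix.mulVecLin_apply, hA] at hf
      have := hM.eq_of_invariant (fun d => f (M.tail d)) (by simp) (fun d => ?_) M.root d
      · simpa using this
      · rcases d with ⟨e, b⟩
        have := CharTwo.add_eq_zero.1 (congrFun hf e)
        cases b <;> simp [opp, this]
  have hkerB : Module.finrank (ZMod 2) (LinearMap.ker B.mulVecLin) = 1 := by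
    have h1 : (fun _ => 1) ∈ LinearMap.ker B.mulVecLin := by
      rw [LinearMap.mem_ker, Matrix.mulVecLin_apply, hB]
      ext e; exact CharTwo.add_self_eq_zero _
    refine (finrank_eq_one_iff_of_nonzero' ⟨_, h1⟩ ?_).2 ?_
    · intro h
      exact one_ne_zero (congrFun (congrArg Subtype.val h) (M.rightFace M.root))
    · rintro ⟨f, hf⟩
      refine ⟨f (M.rightFace M.root), Subtype.ext (funext fun v => ?_)⟩
      obtain ⟨d, rfl⟩ := M.rightFace_surjective v
      rw [LinearMap.mem_ker, Matrix.mulVecLin_apply, hB] at hf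
      have hopp : ∀ d, f (M.rightFace (M.opp d)) = f (M.rightFace d) := by
        rintro ⟨e, b⟩
        have := CharTwo.add_eq_zero.1 (congrFun hf e)
        cases b <;> simp [opp, this]
      have := hM.eq_of_invariant (fun d => f (M.rightFace d)) (fun d => ?_) hopp M.root d
      · simpa using this
      · simp only [rot_apply, rightFace_face, hopp]
  have rA := LinearMap.finrank_range_add_finrank_ker A.mulVecLin
  have rB := LinearMap.finrank_range_add_finrank_ker B.mulVecLin
  have rBt := LinearMap.finrank_range_add_finrank_ker B.transpose.mulVecLin
  have hr : Module.finrank (ZMod 2) (LinearMap.range B.transpose.mulVecLin) =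
      Module.finrank (ZMod 2) (LinearMap.range B.mulVecLin) := B.rank_transpose
  have hfin := Submodule.finrank_mono hle
  simp only [Module.finrank_fintype_fun_eq_card, Fintype.card_fin] at rA rB rBt
  rw [Nat.card_eq_fintype_card, Nat.card_eq_fintype_card]
  refine ⟨by omega, fun heq α hα => ?_⟩
  have := Submodule.eq_of_le_of_finrank_eq hle (by omega)
  have hmem : α ∈ LinearMap.range A.mulVecLin := by
    rw [this, LinearMap.mem_ker, Matrix.mulVecLin_apply, hBt]
    exact hα
  obtain ⟨f, hf⟩ := hmem
  exact ⟨f, fun e => by rw [← hA, ← hf]; rfl⟩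

end Homology

/-- A way to certify that a connected map is planar and to identify its vertices and faces: labels
that are constant along vertices and along faces are injective on vertices and faces as soon as
there are enough of them for Euler's formula. -/
theorem Connected.planar_of_labels (hM : M.Connected) {LV LF : Type*} [Finite LV] [Finite LF]
    (lv : M.Dart → LV) (lf : M.Dart → LF) (hv : ∀ d, lv (M.rot d) = lv d)
    (hf : ∀ d, lf (M.face d) = lf d) (sv : Function.Surjective lv) (sf : Function.Surjective lf)
    (hcard : M.numEdges + 2 ≤ Nat.card LV + Nat.card LF) :
    M.Planar ∧ (∀ d d', M.tail d = M.tail d' ↔ lv d = lv d') ∧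
      (∀ d d', M.rightFace d = M.rightFace d' ↔ lf d = lf d') ∧
      Nat.card M.Face = Nat.card LF := by
  let pv : M.Vertex → LV := Quotient.lift lv fun a b h => sameCycle_lift hv h
  let pf : M.Face → LF := Quotient.lift lf fun a b h => sameCycle_lift hf h
  have spv : Function.Surjective pv := fun v => (sv v).imp' M.tail fun d hd => hd
  have spf : Function.Surjective pf := fun v => (sf v).imp' M.rightFace fun d hd => hd
  have h1 := Nat.card_le_card_of_surjective pv spv
  have h2 := Nat.card_le_card_of_surjective pf spf
  have h3 := hM.euler.1
  have b1 := (Function.Surjective.bijective_of_nat_card_le spv (by omega)).1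
  have b2 := (Function.Surjective.bijective_of_nat_card_le spf (by omega)).1
  exact ⟨⟨hM, by omega⟩, fun d d' => (b1.eq_iff (a := M.tail d) (b := M.tail d')).symm,
    fun d d' => (b2.eq_iff (a := M.rightFace d) (b := M.rightFace d')).symm, by omega⟩

/-! ### The two-colouring of a truncated quadrangulation -/

theorem card_sameCycle {α : Type*} (σ : Equiv.Perm α) (x : α) :
    Nat.card {y // σ.SameCycle y x} = Function.minimalPeriod σ x := by
  have e := MulAction.orbitZPowersEquiv σ x
  rw [← Nat.card_zmod (Function.minimalPeriod σ x)]
  refine Nat.card_congr (Equiv.trans (Equiv.subtypeEquivRight fun y => ?_) e)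
  rw [Equiv.Perm.sameCycle_comm, MulAction.mem_orbit_iff]
  constructor
  · rintro ⟨i, hi⟩
    exact ⟨⟨σ ^ i, i, rfl⟩, hi⟩
  · rintro ⟨⟨_, i, rfl⟩, hi⟩
    exact ⟨i, hi⟩

theorem degree_rightFace (x : M.Dart) :
    M.degree (M.rightFace x) = Function.minimalPeriod M.face x := by
  rw [← card_sameCycle]
  exact Nat.card_congr (Equiv.subtypeEquivRight fun y => M.rightFace_eq_iff)

theorem rightFace_eq_iff_exists_lt {x y : M.Dart} :
    M.rightFace y = M.rightFace x ↔ ∃ i < M.degree (M.rightFace x), (M.face ^ i) x = y := by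
  rw [eq_comm, rightFace_eq_iff, degree_rightFace]
  constructor
  · intro h
    obtain ⟨i, rfl⟩ := h.exists_nat_pow_eq
    refine ⟨i % Function.minimalPeriod M.face x, Nat.mod_lt _ ?_, ?_⟩
    · exact Function.minimalPeriod_pos_of_mem_periodicPts
        (Function.Injective.mem_periodicPts M.face.injective x)
    · rw [← Equiv.Perm.iterate_eq_pow, ← Equiv.Perm.iterate_eq_pow]
      exact Function.iterate_mod_minimalPeriod_eq
  · rintro ⟨i, -, rfl⟩
    exact Equiv.Perm.sameCycle_pow_right.2 (Equiv.Perm.SameCycle.refl _ _)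

theorem face_of_degree_two {x : M.Dart} (h : M.degree (M.rightFace x) = 2) :
    M.face (M.face x) = x ∧ M.face x ≠ x ∧
      ∀ d, M.rightFace d = M.rightFace x ↔ d = x ∨ d = M.face x := by
  have h' := degree_rightFace x
  rw [h] at h'
  refine ⟨?_, ?_, fun d => ?_⟩
  · have := Function.iterate_minimalPeriod (f := M.face) (x := x)
    rwa [← h'] at this
  · intro e
    have := Function.IsPeriodicPt.minimalPeriod_le (f := M.face) (x := x) one_pos e
    omega
  · rw [rightFace_eq_iff_exists_lt, h]
    constructor
    · rintro ⟨i, hi, rfl⟩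
      interval_cases i <;> simp
    · rintro (rfl | rfl)
      · exact ⟨0, by simp⟩
      · exact ⟨1, by simp⟩

theorem face_of_degree_three {x : M.Dart} (h : M.degree (M.rightFace x) = 3) :
    M.face (M.face (M.face x)) = x ∧ M.face x ≠ x ∧ M.face (M.face x) ≠ x ∧
      M.face (M.face x) ≠ M.face x ∧
      ∀ d, M.rightFace d = M.rightFace x ↔ d = x ∨ d = M.face x ∨ d = M.face (M.face x) := by
  have h' := degree_rightFace x
  rw [h] at h'
  have h1 : M.face x ≠ x := by
    intro e
    have := Function.IsPeriodicPt.minimalPeriod_le (f := M.face) (x := x) one_pos e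
    omega
  refine ⟨?_, h1, ?_, fun e => h1 (M.face.injective e), fun d => ?_⟩
  · have := Function.iterate_minimalPeriod (f := M.face) (x := x)
    rwa [← h'] at this
  · intro e
    have := Function.IsPeriodicPt.minimalPeriod_le (f := M.face) (x := x) (n := 2) two_pos e
    omega
  · rw [rightFace_eq_iff_exists_lt, h]
    constructor
    · rintro ⟨i, hi, rfl⟩
      interval_cases i <;> simp [pow_succ]
    · rintro (rfl | rfl | rfl)
      · exact ⟨0, by simp⟩
      · exact ⟨1, by simp⟩
      · exact ⟨2, by simp [pow_succ]⟩

namespace IsTruncQuad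

theorem ext_iff_of_triangle (hM : M.IsTruncQuad) {d x : M.Dart} (hd : M.rightFace d = M.extFace)
    (hx : M.rightFace x = M.rightFace (M.opp d)) :
    M.rightFace x ≠ M.extFace ∧ (M.rightFace (M.opp x) = M.extFace ↔ x = M.opp d) := by
  refine ⟨fun h => hM.not_ext d hd (hx.symm.trans h), fun h => ?_, ?_⟩
  · have := hM.triangles_distinct (M.opp x) d h hd (by rw [opp_opp, hx])
    rw [← this, opp_opp]
  · rintro rfl
    rwa [opp_opp]

open Classical in
/-- The vertices of a truncated quadrangulation have a two-colouring for which the external edges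
are monochromatic and all the other edges are not: without the external edges, all faces have
even degree. -/
theorem exists_coloring (hM : M.IsTruncQuad) : ∃ f : M.Vertex → ZMod 2, ∀ d,
    f (M.tail d) + f (M.tail (M.opp d)) =
      if M.rightFace d = M.extFace ∨ M.rightFace (M.opp d) = M.extFace then 0 else 1 := by
  let := Fintype.ofFinite M.Face
  let a : M.Dart → ZMod 2 := fun d =>
    if M.rightFace d = M.extFace ∨ M.rightFace (M.opp d) = M.extFace then 0 else 1
  have ha : ∀ e, a (e, true) = a (e, false) := fun e => by
    have e1 : M.opp (e, false) = (e, true) := rfl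
    have e2 : M.opp (e, true) = (e, false) := rfl
    simp only [a, e1, e2, or_comm]
  have hface : ∀ F : M.Face, ∑ d : M.Dart with M.rightFace d = F, a d = 0 := by
    intro F
    have hdeg : ∀ k, M.degree F = k →
        ∑ d : M.Dart with M.rightFace d = F, (1 : ZMod 2) = k := by
      rintro k rfl
      rw [degree, Nat.card_eq_fintype_card, Fintype.card_subtype]
      simp
    by_cases h1 : F = M.extFace
    · refine Finset.sum_eq_zero fun d hd => if_pos (Or.inl ?_)
      rw [(Finset.mem_filter.1 hd).2, h1]
    by_cases h2 : ∃ d, M.rightFace d = M.extFace ∧ F = M.rightFace (M.opp d)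
    · obtain ⟨d, hd, rfl⟩ := h2
      have h3 : ∀ x ∈ Finset.univ.filter fun x => M.rightFace x = M.rightFace (M.opp d),
          a x = 1 - if x = M.opp d then 1 else 0 := by
        intro x hx
        obtain ⟨h4, h5⟩ := hM.ext_iff_of_triangle hd (Finset.mem_filter.1 hx).2
        simp only [a, h4, h5, false_or]
        split_ifs <;> simp
      rw [Finset.sum_congr rfl h3, Finset.sum_sub_distrib, hdeg 3 (hM.triangle d hd),
        Finset.sum_ite_eq', if_pos (by simp)]
      decide
    · push Not at h2
      have h3 : ∀ x ∈ Finset.univ.filter fun x => M.rightFace x = F, a x = 1 := by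
        intro x hx
        have hx := (Finset.mem_filter.1 hx).2
        refine if_neg (not_or.2 ⟨by rwa [hx], fun h => ?_⟩)
        exact h2 _ h (by rw [opp_opp, hx])
      rw [Finset.sum_congr rfl h3, hdeg 4 (hM.quadrangle F h1 h2)]
      decide
  obtain ⟨f, hf⟩ := hM.planar.1.euler.2 hM.planar.2 (fun e => a (e, false)) fun g => by
    have : ∀ e, a (e, false) * M.faceDiff g e =
        (fun d => a d * g (M.rightFace d)) (e, false) +
        (fun d => a d * g (M.rightFace d)) (e, true) := by
      intro e
      simp only [faceDiff, ha]
      ring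
    rw [(Finset.sum_congr rfl fun e _ => this e).trans
      (sum_edges M fun d => a d * g (M.rightFace d)),
      ← Finset.sum_fiberwise _ M.rightFace]
    refine Finset.sum_eq_zero fun F _ => ?_
    have h : ∀ d ∈ Finset.univ.filter fun d => M.rightFace d = F,
        a d * g (M.rightFace d) = a d * g F := by
      intro d hd
      rw [(Finset.mem_filter.1 hd).2]
    rw [Finset.sum_congr rfl h, ← Finset.sum_mul, hface, zero_mul]
  refine ⟨f, ?_⟩
  rintro ⟨e, b⟩
  cases b
  · exact hf e
  · exact (add_comm _ _).trans ((hf e).trans (ha e).symm)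

/-- The dart from the third vertex of the triangle incident to the root edge to the head of the
root edge. -/
def spoke (M : RootedMap) : M.Dart := M.face (M.face (M.opp M.root))

theorem tail_opp_spoke (hM : M.IsTruncQuad) : M.tail (M.opp (spoke M)) = M.bdry 0 := by
  have := (face_of_degree_three (hM.triangle M.root rfl)).1
  rw [← tail_face, spoke, this, bdry]
  simp

theorem spoke_inner (hM : M.IsTruncQuad) :
    M.rightFace (spoke M) ≠ M.extFace ∧ M.rightFace (M.opp (spoke M)) ≠ M.extFace := by
  have h3 := face_of_degree_three (hM.triangle M.root rfl)
  have := hM.ext_iff_of_triangle (d := M.root) (x := spoke M) rfl (by simp [spoke])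
  exact ⟨this.1, fun h => h3.2.2.1 (this.2.1 h)⟩

/-- The third vertex of the triangle incident to the root edge is not the head of the root edge:
they have different colours. -/
theorem bdry_zero_ne_apex (hM : M.IsTruncQuad) : M.bdry 0 ≠ M.apex := by
  obtain ⟨f, hf⟩ := hM.exists_coloring
  have h := hf (spoke M)
  rw [if_neg (not_or.2 hM.spoke_inner), hM.tail_opp_spoke] at h
  intro e
  rw [e] at h
  exact one_ne_zero (h.symm.trans (CharTwo.add_self_eq_zero (f M.apex)))

end IsTruncQuad

end RootedMap

/-! ### Closing the external face: the weights of truncated quadrangulations -/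

namespace RootedMap

variable {M M' : RootedMap}

theorem card_ne {α : Type*} [Finite α] (a : α) : Nat.card {b // b ≠ a} = Nat.card α - 1 := by
  classical
  let := Fintype.ofFinite α
  rw [Nat.card_eq_fintype_card, Nat.card_eq_fintype_card, Fintype.card_subtype_compl,
    Fintype.card_subtype_eq]

theorem rightFace_eq_iff_of_iso {f : M.Dart ≃ M'.Dart} (h1 : ∀ d, f (M.opp d) = M'.opp (f d))
    (h2 : ∀ d, f (M.rot d) = M'.rot (f d)) (d d' : M.Dart) :
    M.rightFace d = M.rightFace d' ↔ M'.rightFace (f d) = M'.rightFace (f d') := by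
  constructor
  · intro h
    exact sameCycle_lift (g := fun d => M'.rightFace (f d))
      (fun d => by rw [face_apply, h2, h1, ← face_apply, rightFace_face]) (M.rightFace_eq_iff.1 h)
  · intro h
    have := sameCycle_lift (g := fun d => M.rightFace (f.symm d)) (fun d => ?_)
      (M'.rightFace_eq_iff.1 h)
    · simpa using this
    · have : f.symm (M'.face d) = M.face (f.symm d) := by
        rw [f.symm_apply_eq, face_apply, face_apply, h2, h1, f.apply_symm_apply]
      rw [this, rightFace_face]

theorem Iso.perimeter_eq (h : M.Iso M') : M.perimeter = M'.perimeter := by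
  obtain ⟨f, h1, h2, h3⟩ := h
  refine Nat.card_congr (f.subtypeEquiv fun d => ?_)
  rw [extFace, extFace, rightFace_eq_iff_of_iso h1 h2, h3]

theorem numInner_eq (M : RootedMap) : M.numInner = Nat.card M.Face - 1 := card_ne _

theorem Iso.numInner_eq (h : M.Iso M') : M.numInner = M'.numInner := by
  obtain ⟨f, h1, h2, -⟩ := h
  rw [RootedMap.numInner_eq, RootedMap.numInner_eq]
  congr 1
  refine Nat.card_congr (Quotient.congr f fun d d' => ?_)
  have := rightFace_eq_iff_of_iso h1 h2 d d'
  rw [rightFace_eq_iff, rightFace_eq_iff] at this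
  exact this

/-- The darts on the external face and on the two triangles of a truncated quadrangulation with
perimeter 2, in an order that describes the change of the faces in `closure`. -/
def bdryDarts (M : RootedMap) : List M.Dart :=
  let s := M.face M.root
  let d := M.face (M.opp M.root)
  [s, M.root, M.opp s, M.face d, M.face (M.face (M.opp s)), M.opp M.root, d]

/-- The map with the same darts and the same reversal as `M`, with another face permutation `σ` and
another root. -/
def withFace (M : RootedMap) (σ : Equiv.Perm M.Dart) (x : M.Dart) : RootedMap where
  numEdges := M.numEdges
  rot := M.opp.trans σ
  root := x

theorem withFace_face (σ : Equiv.Perm M.Dart) (x d : M.Dart) : (M.withFace σ x).face d = σ d := by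
  have : (M.withFace σ x).face d = σ (M.opp (M.opp d)) := rfl
  rw [this, opp_opp]

/-- A criterion for `withFace` to be a truncated quadrangulation, in terms of labels of the vertices
and of the faces. -/
theorem withFace_isTruncQuad {σ : Equiv.Perm M.Dart} {x : M.Dart}
    (hconn : ∀ P : M.Dart → Prop, (∀ d, P (σ d) ↔ P d) → (∀ d, P (M.opp d) ↔ P d) → P x →
      ∀ d, P d)
    {LV LF : Type*} [Finite LV] [Finite LF] {lv : M.Dart → LV} {lf : M.Dart → LF}
    (hlv : ∀ d, lv (σ d) = lv (M.opp d)) (hlf : ∀ d, lf (σ d) = lf d)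
    (sv : Function.Surjective lv) (sf : Function.Surjective lf)
    (hcard : M.numEdges + 2 ≤ Nat.card LV + Nat.card LF)
    (simple : ∀ d d', lf d = lf x → lf d' = lf x → lv d = lv d' → d = d')
    (not_ext : ∀ d, lf d = lf x → lf (M.opp d) ≠ lf x)
    (triangle : ∀ d, lf d = lf x → Nat.card {d' // lf d' = lf (M.opp d)} = 3)
    (distinct : ∀ d d', lf d = lf x → lf d' = lf x → lf (M.opp d) = lf (M.opp d') → d = d')
    (quadrangle : ∀ d, lf d ≠ lf x → (∀ d', lf d' = lf x → lf d ≠ lf (M.opp d')) →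
      Nat.card {d' // lf d' = lf d} = 4) :
    (M.withFace σ x).IsTruncQuad ∧ (M.withFace σ x).perimeter = Nat.card {d // lf d = lf x} ∧
      (M.withFace σ x).numInner = Nat.card LF - 1 := by
  have hface : ∀ d, (M.withFace σ x).face d = σ d := withFace_face σ x
  have hc : (M.withFace σ x).Connected := connected_of_invariant fun P hP hO h0 =>
    hconn P (fun d => (iff_of_eq (congrArg P (hface d).symm)).trans (hP d)) hO h0
  obtain ⟨hpl, htail, hright, hcf⟩ := hc.planar_of_labels lv lf
    (fun d => (hlv (M.opp d)).trans (congrArg lv (M.opp_opp d)))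
    (fun d => (congrArg lf (hface d)).trans (hlf d)) sv sf hcard
  have hext : ∀ d, (M.withFace σ x).rightFace d = (M.withFace σ x).extFace ↔ lf d = lf x :=
    fun d => hright d x
  have hdeg : ∀ d, (M.withFace σ x).degree ((M.withFace σ x).rightFace d) =
      Nat.card {d' // lf d' = lf d} :=
    fun d => Nat.card_congr (Equiv.subtypeEquivRight fun d' => hright d' d)
  refine ⟨⟨hpl, fun d d' h h' ht => simple d d' ((hext d).1 h) ((hext d').1 h') ((htail d d').1 ht),
    fun d h h' => not_ext d ((hext d).1 h) ((hext _).1 h'),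
    fun d h => (hdeg _).trans (triangle d ((hext d).1 h)),
    fun d d' h h' ht => distinct d d' ((hext d).1 h) ((hext d').1 h') ((hright _ _).1 ht),
    fun f hf hf' => ?_⟩, hdeg x, by rw [numInner_eq, hcf]⟩
  obtain ⟨d, rfl⟩ := rightFace_surjective _ f
  exact (hdeg d).trans (quadrangle d (fun h => hf ((hext d).2 h))
    fun d' h h' => hf' d' ((hext d').2 h) ((hright _ _).2 h'))

theorem card_eq_length {α : Type*} {p : α → Prop} {L : List α} (hL : L.Nodup)
    (h : ∀ d, p d ↔ d ∈ L) : Nat.card {d // p d} = L.length := by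
  classical
  rw [← List.toFinset_card_of_nodup hL, ← Nat.card_eq_finsetCard]
  exact Nat.card_congr (Equiv.subtypeEquivRight fun d => by rw [h, List.mem_toFinset])

/-- The face permutation of `closure`. -/
def closureFace (M : RootedMap) : Equiv.Perm M.Dart := M.bdryDarts.formPerm.trans M.face

theorem closureFace_apply (d : M.Dart) : M.closureFace d = M.face (M.bdryDarts.formPerm d) := rfl

/-- For a truncated quadrangulation with perimeter 2, the truncated quadrangulation with perimeter 1
obtained as follows: removing the two external edges leaves an external face of degree 4, which
becomes an inner face, and then the edge `IsTruncQuad.spoke` is opened to a 2-gon, in which a loop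
is drawn. On the same darts, if `r` is the root and `s` the other external dart, the cycles
`(r s) (r' d₁ d₂) (s' f₁ f₂)` of `face` are replaced by `(s) (s' r' d₂) (d₁ r f₁ f₂)`, where
`'` is the reversal. -/
def closure (M : RootedMap) : RootedMap := M.withFace M.closureFace (M.face M.root)

theorem formPerm_seven {α : Type*} [DecidableEq α] {a b c d e f g : α}
    (h : [a, b, c, d, e, f, g].Nodup) :
    [a, b, c, d, e, f, g].formPerm a = b ∧ [a, b, c, d, e, f, g].formPerm b = c ∧
    [a, b, c, d, e, f, g].formPerm c = d ∧ [a, b, c, d, e, f, g].formPerm d = e ∧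
    [a, b, c, d, e, f, g].formPerm e = f ∧ [a, b, c, d, e, f, g].formPerm f = g ∧
    [a, b, c, d, e, f, g].formPerm g = a := by
  have key := fun i hi => List.formPerm_apply_getElem [a, b, c, d, e, f, g] h i hi
  exact ⟨key 0 (by simp), key 1 (by simp), key 2 (by simp), key 3 (by simp), key 4 (by simp),
    key 5 (by simp), (key 6 (by simp)).trans (by simp)⟩

namespace IsTruncQuad

/-- The darts around the external face of a truncated quadrangulation with perimeter 2 and their
images under the modified face permutation. -/
theorem closure_facts (hM : M.IsTruncQuad) (hp : M.perimeter = 2) :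
    ∃ r s r' s' d₁ d₂ f₁ f₂ : M.Dart,
      (r = M.root ∧ s = M.face r ∧ r' = M.opp r ∧ s' = M.opp s) ∧
      (M.face s = r ∧ M.face r' = d₁ ∧ M.face d₁ = d₂ ∧ M.face d₂ = r' ∧ M.face s' = f₁ ∧
        M.face f₁ = f₂ ∧ M.face f₂ = s') ∧
      (M.rightFace r' ≠ M.extFace ∧ M.rightFace s' ≠ M.extFace ∧
        M.rightFace r' ≠ M.rightFace s') ∧
      (∀ d, M.rightFace d = M.extFace ↔ d = r ∨ d = s) ∧
      (∀ d, M.rightFace d = M.rightFace r' ↔ d = r' ∨ d = d₁ ∨ d = d₂) ∧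
      (∀ d, M.rightFace d = M.rightFace s' ↔ d = s' ∨ d = f₁ ∨ d = f₂) ∧
      [s, r, s', d₂, f₂, r', d₁, f₁].Nodup ∧
      (M.closureFace s = s ∧ M.closureFace s' = r' ∧ M.closureFace r' = d₂ ∧
        M.closureFace d₂ = s' ∧ M.closureFace d₁ = r ∧ M.closureFace r = f₁ ∧
        M.closureFace f₁ = f₂ ∧ M.closureFace f₂ = d₁) ∧
      (∀ d, d ∉ [s, r, s', d₂, f₂, r', d₁, f₁] → M.closureFace d = M.face d) ∧
      M.bdryDarts = [s, r, s', d₂, f₂, r', d₁] := by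
  obtain ⟨e1, e2, e3⟩ := face_of_degree_two (M := M) (x := M.root) hp
  have hs : M.rightFace (M.face M.root) = M.extFace := M.rightFace_face _
  obtain ⟨t1, t2, t3, t4, t5⟩ := face_of_degree_three (hM.triangle M.root rfl)
  obtain ⟨u1, u2, u3, u4, u5⟩ := face_of_degree_three (hM.triangle _ hs)
  have n1 := hM.not_ext M.root rfl
  have n2 := hM.not_ext _ hs
  have n3 : M.rightFace (M.opp M.root) ≠ M.rightFace (M.opp (M.face M.root)) :=
    fun h => e2 (hM.triangles_distinct _ _ rfl hs h).symm
  have hb : M.bdryDarts = [M.face M.root, M.root, M.opp (M.face M.root),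
    M.face (M.face (M.opp M.root)), M.face (M.face (M.opp (M.face M.root))), M.opp M.root,
    M.face (M.opp M.root)] := rfl
  generalize hr : M.root = r at *
  generalize hs' : M.face r = s at *
  generalize hr' : M.opp r = r' at *
  generalize hss : M.opp s = s' at *
  generalize hd1 : M.face r' = d₁ at *
  generalize hd2 : M.face d₁ = d₂ at *
  generalize hf1 : M.face s' = f₁ at *
  generalize hf2 : M.face f₁ = f₂ at *
  have e3' : ∀ d, M.rightFace d = M.extFace ↔ d = r ∨ d = s := by
    intro d; rw [← e3, extFace, hr]
  have hnd : [s, r, s', d₂, f₂, r', d₁, f₁].Nodup := by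
    have g1 := (e3' r).2 (by simp)
    have g2 := (e3' s).2 (by simp)
    have g3 := (t5 d₁).2 (by simp)
    have g4 := (t5 d₂).2 (by simp)
    have g5 := (u5 f₁).2 (by simp)
    have g6 := (u5 f₂).2 (by simp)
    clear e3 e3' t5 u5 hr hs' hr' hss hd1 hd2 hf1 hf2 hs hb t1 u1 e1
    simp only [List.nodup_cons, List.mem_cons, List.not_mem_nil, or_false, not_or,
      List.nodup_nil, and_true, not_false_eq_true]
    and_intros <;> grind
  have hnd' : [s, r, s', d₂, f₂, r', d₁].Nodup := by
    refine hnd.sublist ?_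
    exact (List.sublist_append_left [s, r, s', d₂, f₂, r', d₁] [f₁])
  obtain ⟨k1, k2, k3, k4, k5, k6, k7⟩ := formPerm_seven hnd'
  have hk : ∀ d, d ∉ [s, r, s', d₂, f₂, r', d₁] → M.closureFace d = M.face d := by
    intro d hd
    rw [closureFace_apply, hb, List.formPerm_apply_of_notMem hd]
  refine ⟨r, s, r', s', d₁, d₂, f₁, f₂, ⟨rfl, hs'.symm, hr'.symm, hss.symm⟩,
    ⟨e1, hd1, hd2, t1, hf1, hf2, u1⟩, ⟨n1, n2, n3⟩, e3', t5, u5, hnd, ⟨?_, ?_, ?_, ?_, ?_, ?_, ?_, ?_⟩,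
    ?_, hb⟩
  · rw [closureFace_apply, hb, k1, hs']
  · rw [closureFace_apply, hb, k3, t1]
  · rw [closureFace_apply, hb, k6, hd2]
  · rw [closureFace_apply, hb, k4, u1]
  · rw [closureFace_apply, hb, k7, e1]
  · rw [closureFace_apply, hb, k2, hf1]
  · rw [hk, hf2]
    intro h
    have : f₁ ∉ [s, r, s', d₂, f₂, r', d₁] := by
      have := List.nodup_append.1 (show ([s, r, s', d₂, f₂, r', d₁] ++ [f₁]).Nodup from hnd)
      intro h
      exact this.2.2 _ h _ (by simp) rfl
    exact this h
  · rw [closureFace_apply, hb, k5, hd1]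
  · intro d hd
    refine hk d fun h => hd ?_
    exact List.mem_append_left [f₁] h

open Classical in
/-- `closure` maps the truncated quadrangulations with perimeter 2 to truncated quadrangulations with
perimeter 1 and the same number of inner faces. The proof labels the vertices and the faces of the
new map by those of the old one: the darts `s'` and `r`, which change their tails, and the darts
`s'`, `d₁` and `r`, which change their faces, are relabelled. -/
theorem closure_aux (hM : M.IsTruncQuad) (hp : M.perimeter = 2) :
    M.closure.IsTruncQuad ∧ M.closure.perimeter = 1 ∧ M.closure.numInner = M.numInner := by
  obtain ⟨r, s, r', s', d₁, d₂, f₁, f₂, ⟨hr, hs, hr', hs'⟩, ⟨a1, a2, a3, a4, a5, a6, a7⟩,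
    ⟨n1, n2, n3⟩, E, T, U, hnd, ⟨c1, c2, c3, c4, c5, c6, c7, c8⟩, hout, -⟩ := hM.closure_facts hp
  rw [closure, ← hr, ← hs]
  generalize M.closureFace = σ at *
  simp only [List.nodup_cons, List.mem_cons, List.not_mem_nil, or_false, not_or,
      List.nodup_nil, and_true, not_false_eq_true] at hnd hout
  have hr'' : M.opp r' = r := by rw [hr', opp_opp]
  have hs'' : M.opp s' = s := by rw [hs', opp_opp]
  have hoi : ∀ x y, M.opp x = y → x = M.opp y := by rintro x y rfl; rw [opp_opp]
  -- the equations of `tail` around the external face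
  have v1 : M.tail d₁ = M.tail r := by rw [← a2, tail_face, hr'']
  have v2 : M.tail s = M.tail r' := by rw [hs, tail_face, hr']
  have v3 : M.tail s' = M.tail r := by rw [hs', ← tail_face, a1]
  have v4 : M.tail (M.opp d₂) = M.tail r' := by rw [← tail_face, a4]
  have v5 : M.tail (M.opp d₁) = M.tail d₂ := by rw [← tail_face, a3]
  have v6 : M.tail f₁ = M.tail s := by rw [← a5, tail_face, hs'']
  have v7 : M.tail (M.opp f₂) = M.tail r := by rw [← tail_face, a7, v3]
  have v8 : M.tail (M.opp f₁) = M.tail f₂ := by rw [← tail_face, a6]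
  let lv : M.Dart → M.Vertex := fun x =>
    if x = r then M.tail d₂ else if x = s' then M.tail s else M.tail x
  let lf : M.Dart → M.Face := fun x =>
    if x = s' then M.rightFace r' else if x = d₁ ∨ x = r then M.rightFace s' else M.rightFace x
  have hlv : ∀ x, lv (σ x) = lv (M.opp x) := by
    intro x
    by_cases hx : x = s ∨ x = r ∨ x = s' ∨ x = d₂ ∨ x = f₂ ∨ x = r' ∨ x = d₁ ∨ x = f₁
    · rcases hx with rfl | rfl | rfl | rfl | rfl | rfl | rfl | rfl <;> simp only [lv] <;> grind
    · simp only [not_or] at hx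
      have h1 : M.face x ≠ r := fun h => hx.1 (M.face.injective (h.trans a1.symm))
      have h2 : M.face x ≠ s' := fun h => hx.2.2.2.2.1 (M.face.injective (h.trans a7.symm))
      have h3 : M.opp x ≠ r := fun h => hx.2.2.2.2.2.1 (by rw [hoi _ _ h, hr'])
      have h4 : M.opp x ≠ s' := fun h => hx.1 (by rw [hoi _ _ h, hs''])
      rw [hout x hx]
      simp only [lv, if_neg h1, if_neg h2, if_neg h3, if_neg h4, tail_face]
  have e1 : M.rightFace r = M.extFace := (E r).2 (by simp)
  have e2 : M.rightFace s = M.extFace := (E s).2 (by simp)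
  have e3 : M.rightFace d₁ = M.rightFace r' := (T d₁).2 (by simp)
  have e4 : M.rightFace d₂ = M.rightFace r' := (T d₂).2 (by simp)
  have e5 : M.rightFace f₁ = M.rightFace s' := (U f₁).2 (by simp)
  have e6 : M.rightFace f₂ = M.rightFace s' := (U f₂).2 (by simp)
  have hlf : ∀ x, lf (σ x) = lf x := by
    intro x
    by_cases hx : x = s ∨ x = r ∨ x = s' ∨ x = d₂ ∨ x = f₂ ∨ x = r' ∨ x = d₁ ∨ x = f₁
    · rcases hx with rfl | rfl | rfl | rfl | rfl | rfl | rfl | rfl <;> simp only [lf] <;> grind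
    · simp only [not_or] at hx
      have h1 : M.face x ≠ r := fun h => hx.1 (M.face.injective (h.trans a1.symm))
      have h2 : M.face x ≠ s' := fun h => hx.2.2.2.2.1 (M.face.injective (h.trans a7.symm))
      have h3 : M.face x ≠ d₁ := fun h => hx.2.2.2.2.2.1 (M.face.injective (h.trans a2.symm))
      rw [hout x hx]
      simp only [lf, if_neg h2, if_neg hx.2.2.1, rightFace_face, or_self, h1, h3, hx.2.1,
        hx.2.2.2.2.2.2.1, if_false]
  have hconn : ∀ P : M.Dart → Prop, (∀ d, P (σ d) ↔ P d) → (∀ d, P (M.opp d) ↔ P d) → P s →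
      ∀ d, P d := by
    intro P hP hO h0 d
    have p1 : P s' := by rw [hs', hO]; exact h0
    have p2 : P r' := by rw [← c2, hP]; exact p1
    have p3 : P d₂ := by rw [← c3, hP]; exact p2
    have p4 : P r := by rw [← hr'', hO]; exact p2
    have p5 : P f₁ := by rw [← c6, hP]; exact p4
    have p6 : P f₂ := by rw [← c7, hP]; exact p5
    have p7 : P d₁ := by rw [← c8, hP]; exact p6
    have hF : ∀ x : M.Dart, P (M.face x) ↔ P x := by
      intro x
      by_cases hx : x = s ∨ x = r ∨ x = s' ∨ x = d₂ ∨ x = f₂ ∨ x = r' ∨ x = d₁ ∨ x = f₁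
      · have hx' : P x := by
          rcases hx with rfl | rfl | rfl | rfl | rfl | rfl | rfl | rfl <;> assumption
        have hx'' : P (M.face x) := by
          rcases hx with rfl | rfl | rfl | rfl | rfl | rfl | rfl | rfl
          · rwa [a1]
          · rwa [← hs]
          · rwa [a5]
          · rwa [a4]
          · rwa [a7]
          · rwa [a2]
          · rwa [a3]
          · rwa [a6]
        exact iff_of_true hx'' hx'
      · simp only [not_or] at hx
        rw [← hout x hx, hP]
    have := hM.planar.1.eq_of_invariant P (fun d => by rw [rot_apply]; simp [hF, hO])
      (fun d => by simp [hO]) s d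
    exact this ▸ h0
  have sv : Function.Surjective lv := by
    intro v
    obtain ⟨x, rfl⟩ := M.tail_surjective v
    by_cases h1 : x = r
    · exact ⟨d₁, by simp only [lv]; grind⟩
    by_cases h2 : x = s'
    · exact ⟨d₁, by simp only [lv]; grind⟩
    · exact ⟨x, by simp only [lv, if_neg h1, if_neg h2]⟩
  have sf : Function.Surjective lf := by
    intro v
    obtain ⟨x, rfl⟩ := M.rightFace_surjective v
    by_cases h1 : x = r
    · exact ⟨s, by simp only [lf]; grind⟩
    by_cases h2 : x = s'
    · exact ⟨f₁, by simp only [lf]; grind⟩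
    by_cases h3 : x = d₁
    · exact ⟨d₂, by simp only [lf]; grind⟩
    · exact ⟨x, by simp only [lf, h1, h2, h3, or_self, if_false]⟩
  have l1 : lf s = M.extFace := by simp only [lf]; grind
  have l2 : lf s' = M.rightFace r' := by simp [lf]
  have hext : ∀ d, lf d = lf s ↔ d = s := by
    intro d
    rw [l1]
    simp only [lf]
    grind
  obtain ⟨h1, h2, h3⟩ := withFace_isTruncQuad hconn hlv hlf sv sf hM.planar.2.ge
    (fun d d' h h' _ => ((hext d).1 h).trans ((hext d').1 h').symm)
    (fun d h => by rw [(hext d).1 h, ← hs', l1, l2]; exact n1)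
    (fun d h => by
      rw [(hext d).1 h, ← hs', l2]
      refine card_eq_length (L := [s', r', d₂]) (by simp; grind) fun d => ?_
      simp only [lf, List.mem_cons, List.not_mem_nil, or_false]
      grind)
    (fun d d' h h' _ => ((hext d).1 h).trans ((hext d').1 h').symm)
    (fun x g1 hx => by
      have g2 : lf x ≠ M.rightFace r' := by
        rw [← l2, hs']
        exact hx s rfl
      by_cases g3 : lf x = M.rightFace s'
      · rw [g3]
        refine card_eq_length (L := [d₁, r, f₁, f₂]) (by simp; grind) fun d => ?_
        simp only [lf, List.mem_cons, List.not_mem_nil, or_false]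
        grind
      · have g4 : lf x = M.rightFace x := by
          simp only [lf] at g2 g3 ⊢
          grind
        rw [l1] at g1
        rw [g4] at g1 g2 g3 ⊢
        rw [← hM.quadrangle (M.rightFace x) g1]
        · refine Nat.card_congr (Equiv.subtypeEquivRight fun d => ?_)
          simp only [lf]
          grind
        · intro d hd
          rcases (E d).1 hd with rfl | rfl
          · rwa [← hr']
          · rwa [← hs'])
  refine ⟨h1, h2.trans ?_, h3.trans M.numInner_eq.symm⟩
  exact card_eq_length (L := [s]) (by simp) fun d => by rw [hext, List.mem_singleton]

end IsTruncQuad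
end RootedMap

namespace RootedMap

variable {M M' : RootedMap}

theorem formPerm_map_apply {α β : Type*} [DecidableEq α] [DecidableEq β] (g : α ≃ β) (L : List α)
    (a : α) : (L.map g).formPerm (g a) = g (L.formPerm a) := by
  induction L generalizing a with
  | nil => simp
  | cons x L ih =>
    cases L with
    | nil => simp
    | cons y L =>
      rw [List.map_cons, List.map_cons, List.formPerm_cons_cons, List.formPerm_cons_cons,
        Equiv.Perm.mul_apply, Equiv.Perm.mul_apply, ← List.map_cons, ih, g.injective.swap_apply]

theorem exists_of_withFace_iso {σ : Equiv.Perm M.Dart} {σ' : Equiv.Perm M'.Dart} {x : M.Dart}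
    {x' : M'.Dart} (h : (M.withFace σ x).Iso (M'.withFace σ' x')) :
    ∃ g : M.Dart ≃ M'.Dart, (∀ d, g (M.opp d) = M'.opp (g d)) ∧ (∀ d, g (σ d) = σ' (g d)) ∧
      g x = x' := by
  obtain ⟨f, h1, h2, h3⟩ := h
  refine ⟨f, h1, fun d => ?_, h3⟩
  have e1 : (M.withFace σ x).rot (M.opp d) = σ d := congrArg σ (M.opp_opp d)
  have e2 : (M'.withFace σ' x').rot (f (M.opp d)) = σ' (f d) :=
    congrArg σ' ((congrArg M'.opp (h1 d)).trans (M'.opp_opp (f d)))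
  exact (congrArg f e1).symm.trans ((h2 _).trans e2)

/-- A truncated quadrangulation with perimeter 2 can be recovered from its closure. -/
theorem IsTruncQuad.iso_of_closure (hM : M.IsTruncQuad) (hM' : M'.IsTruncQuad)
    (hp : M.perimeter = 2) (hp' : M'.perimeter = 2) (h : M.closure.Iso M'.closure) :
    M.Iso M' := by
  obtain ⟨r, s, r', s', d₁, d₂, f₁, f₂, ⟨hr, hs, hr', hs'⟩, -, -, -, -, -, -,
    ⟨c1, c2, c3, c4, c5, c6, c7, c8⟩, -, hb⟩ := hM.closure_facts hp
  obtain ⟨R, S, R', S', D₁, D₂, F₁, F₂, ⟨hR, hS, hR', hS'⟩, -, -, -, -, -, -,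
    ⟨C1, C2, C3, C4, C5, C6, C7, C8⟩, -, hB⟩ := hM'.closure_facts hp'
  obtain ⟨g, g1, g2, h3⟩ := exists_of_withFace_iso h
  have g3 : g s = S := by rw [hs, hS, hr, hR]; exact h3
  have k1 : g s' = S' := by rw [hs', g1, g3, hS']
  have k2 : g r' = R' := by rw [← c2, g2, k1, C2]
  have k3 : g d₂ = D₂ := by rw [← c3, g2, k2, C3]
  have k4 : g r = R := by
    have e : r = M.opp r' := by rw [hr', opp_opp]
    rw [e, g1, k2, hR', opp_opp]
  have k5 : g f₁ = F₁ := by rw [← c6, g2, k4, C6]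
  have k6 : g f₂ = F₂ := by rw [← c7, g2, k5, C7]
  have k7 : g d₁ = D₁ := by rw [← c8, g2, k6, C8]
  have hL : M'.bdryDarts = M.bdryDarts.map g := by
    rw [hb, hB]
    simp [g3, k1, k2, k3, k4, k6, k7]
  have hface : ∀ d, g (M.face d) = M'.face (g d) := by
    intro d
    have := g2 (M.bdryDarts.formPerm.symm d)
    rw [closureFace_apply, closureFace_apply, hL, formPerm_map_apply,
      Equiv.apply_symm_apply] at this
    exact this
  refine ⟨g, g1, fun d => ?_, by rw [← hr, ← hR, k4]⟩
  rw [rot_apply, rot_apply, hface, g1]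

/-- The face permutation of `wheel`: an external face of degree 2 and two triangles. -/
def wheelFace : Equiv.Perm (Fin 4 × Bool) :=
  [((0 : Fin 4), false), (1, false)].formPerm *
    ([((0 : Fin 4), true), (2, false), (3, true)].formPerm *
      [((1 : Fin 4), true), (3, false), (2, true)].formPerm)

/-- The truncated quadrangulation with perimeter 2 that consists of two triangles: the edges `0` and
`1` are external, and the edges `2` and `3` connect their ends to a vertex in the middle. -/
def wheel : RootedMap := RootedMap.withFace ⟨4, 1, (0, false)⟩ wheelFace (0, false)

theorem wheel_isTruncQuad : wheel.IsTruncQuad ∧ wheel.perimeter = 2 := by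
  let lv : Fin 4 × Bool → Fin 3 := fun d =>
    if d ∈ [((0 : Fin 4), false), (1, true), (2, false)] then 0
    else if d ∈ [((0 : Fin 4), true), (1, false), (3, false)] then 1 else 2
  let lf : Fin 4 × Bool → Fin 3 := fun d =>
    if d ∈ [((0 : Fin 4), false), (1, false)] then 0
    else if d ∈ [((0 : Fin 4), true), (2, false), (3, true)] then 1 else 2
  have hopp : ∀ d : Fin 4 × Bool, RootedMap.opp ⟨4, 1, (0, false)⟩ d = (d.1, !d.2) := fun d => rfl
  have := withFace_isTruncQuad (M := ⟨4, 1, (0, false)⟩) (σ := wheelFace) (x := (0, false))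
    (lv := lv) (lf := lf) ?_ (by decide) (by decide) (by decide) (by decide) (by simp)
    (by decide) (by decide) ?_ (by decide) ?_
  · refine ⟨this.1, this.2.1.trans ?_⟩
    rw [Nat.card_eq_fintype_card]
    decide
  · intro P hP hO h0 d
    have p1 := (hO _).2 h0
    have p2 := (hP _).2 h0
    have p3 := (hO _).2 p2
    have p4 := (hP _).2 p1
    have p5 := (hP _).2 p4
    have p6 := (hP _).2 p3
    have p7 := (hP _).2 p6
    have e1 : wheelFace (0, false) = (1, false) := by decide
    have e2 : wheelFace (0, true) = (2, false) := by decide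
    have e3 : wheelFace (2, false) = (3, true) := by decide
    have e4 : wheelFace (1, true) = (3, false) := by decide
    have e5 : wheelFace (3, false) = (2, true) := by decide
    simp only [hopp, e1, e2, e3, e4, e5, Bool.not_false] at h0 p1 p2 p3 p4 p5 p6 p7
    rcases d with ⟨e, b⟩
    fin_cases e <;> cases b <;> assumption
  · simp only [Nat.card_eq_fintype_card]
    decide
  · simp only [Nat.card_eq_fintype_card]
    decide

end RootedMap

namespace TruncQuad

open RootedMap

theorem isTruncQuad_map (Q : TruncQuad) : Q.map.IsTruncQuad := (Quotient.out Q).2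

/-- The isomorphism class of a truncated quadrangulation. -/
def mk (M : RootedMap) (hM : M.IsTruncQuad) : TruncQuad := Quotient.mk _ ⟨M, hM⟩

theorem map_mk (M : RootedMap) (hM : M.IsTruncQuad) : (mk M hM).map.Iso M :=
  Quotient.exact (s := truncQuadSetoid) (Quotient.out_eq (s := truncQuadSetoid) _)

theorem eq_of_iso {Q Q' : TruncQuad} (h : Q.map.Iso Q'.map) : Q = Q' :=
  (Quotient.out_equiv_out (s := truncQuadSetoid)).1 h

theorem eq_of_mk_eq {M M' : RootedMap} {hM : M.IsTruncQuad} {hM' : M'.IsTruncQuad}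
    (h : mk M hM = mk M' hM') : M.Iso M' := Quotient.exact (s := truncQuadSetoid) h

end TruncQuad

instance : Countable RootedMap := by
  let f : RootedMap → Σ n : ℕ, Equiv.Perm (Fin n × Bool) × (Fin n × Bool) :=
    fun M => ⟨M.numEdges, M.rot, M.root⟩
  have hf : Function.Injective f := by
    rintro ⟨n, σ, x⟩ ⟨n', σ', x'⟩ h
    simp only [f, Sigma.mk.injEq] at h
    obtain ⟨rfl, h⟩ := h
    simpa using h
  exact hf.countable

instance : Countable TruncQuad := inferInstanceAs (Countable (Quotient truncQuadSetoid))

open TruncQuad RootedMap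

theorem partitionZ_two_ne_zero : partitionZ 2 ≠ 0 := by
  have hw := wheel_isTruncQuad
  intro h
  rw [partitionZ, ENNReal.tsum_eq_zero] at h
  have := h ⟨mk wheel hw.1, (map_mk _ hw.1).perimeter_eq.trans hw.2⟩
  exact pow_ne_zero _ (by simp) this

/-- `Z(2) ≤ Z(1)`, by the injection `closure`, which preserves the weights. -/
theorem partitionZ_two_le : partitionZ 2 ≤ partitionZ 1 := by
  have h := fun Q : {Q : TruncQuad // Q.perimeter = 2} => (isTruncQuad_map Q.1).closure_aux Q.2
  let F : {Q : TruncQuad // Q.perimeter = 2} → {Q : TruncQuad // Q.perimeter = 1} := fun Q =>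
    ⟨mk Q.1.map.closure (h Q).1, (map_mk _ (h Q).1).perimeter_eq.trans (h Q).2.1⟩
  have hF : Function.Injective F := by
    intro Q Q' hQ
    refine Subtype.ext (eq_of_iso ((isTruncQuad_map Q.1).iso_of_closure (isTruncQuad_map Q'.1)
      Q.2 Q'.2 (eq_of_mk_eq (congrArg Subtype.val hQ))))
  have hval : ∀ Q, (F Q).1.numInner = Q.1.numInner := fun Q =>
    (map_mk _ (h Q).1).numInner_eq.trans (h Q).2.2
  calc partitionZ 2 = ∑' Q, (12 : ℝ≥0∞)⁻¹ ^ (F Q).1.numInner := by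
        rw [partitionZ]; simp only [hval]
    _ ≤ partitionZ 1 := ENNReal.tsum_comp_le_tsum_of_injective hF
        fun Q : {Q : TruncQuad // Q.perimeter = 1} => (12 : ℝ≥0∞)⁻¹ ^ Q.1.numInner

theorem markLaw_singleton (x : ℕ × TruncQuad) :
    markLaw {x} = theta x.1 * boltzmann (x.1 + 1) x.2 := by
  classical
  rw [markLaw, Measure.sum_apply _ (measurableSet_singleton x), tsum_eq_single x]
  · simp
  · intro y hy
    simp [hy]

/-- Individuals have a positive probability to have at least one child: otherwise `Z(1)` would be
finite, hence `Z(2) ≤ Z(1)` as well, and then exactly one child has positive probability. -/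
theorem markLaw_fst_ne_zero [IsProbabilityMeasure markLaw] : markLaw {x | x.1 ≠ 0} ≠ 0 := by
  intro h0
  have hnull : ∀ x : ℕ × TruncQuad, x.1 ≠ 0 → theta x.1 * boltzmann (x.1 + 1) x.2 = 0 :=
    fun x hx => by
      rw [← markLaw_singleton]
      exact measure_mono_null (by simpa using hx) h0
  have h1 : partitionZ 1 ≠ ⊤ := by
    intro h1
    have : markLaw Set.univ = 0 := by
      rw [← MeasureTheory.Measure.tsum_indicator_apply_singleton markLaw _ MeasurableSet.univ]
      simp only [Set.indicator_univ, ENNReal.tsum_eq_zero, markLaw_singleton]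
      intro x
      by_cases hx : x.1 = 0
      · rw [hx, boltzmann]
        simp [h1]
      · exact hnull x hx
    simp at this
  have h2 : partitionZ 2 ≠ ⊤ := ne_top_of_le_ne_top h1 partitionZ_two_le
  have hw := wheel_isTruncQuad
  have := hnull (1, mk wheel hw.1) one_ne_zero
  have hp : (mk wheel hw.1).perimeter = 2 := (map_mk _ hw.1).perimeter_eq.trans hw.2
  rw [boltzmann, if_pos hp, mul_eq_zero] at this
  rcases this with h | h
  · simp [theta, partitionZ_two_ne_zero] at h
  · rw [ENNReal.div_eq_zero_iff] at h
    rcases h with h | h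
    · exact pow_ne_zero _ (by simp) h
    · exact h2 h

/-! ### The first-passage percolation distance as a function of an environment -/

theorem leftEnd_zero (c : ℤ → ℕ) : leftEnd c 0 = 0 := by simp [leftEnd]

theorem leftEnd_add_one (c : ℤ → ℕ) (j : ℤ) : leftEnd c (j + 1) = leftEnd c j + c j := by
  rw [leftEnd, leftEnd]
  rcases le_or_gt 0 j with h | h
  · rw [Finset.Ico_eq_empty (a := j) (by omega), Finset.Ico_eq_empty (a := j + 1) (by omega),
      ← Finset.insert_Ico_right_eq_Ico_add_one h,
      Finset.sum_insert (by simp)]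
    simp [add_comm]
  · rw [Finset.Ico_eq_empty (b := j) (by omega), Finset.Ico_eq_empty (b := j + 1) (by omega),
      ← Finset.insert_Ico_add_one_left_eq_Ico h,
      Finset.sum_insert (by simp)]
    simp

theorem leftEnd_shift (c : ℤ → ℕ) (k j : ℤ) :
    leftEnd (fun i => c (i + k)) j = leftEnd c (j + k) - leftEnd c k := by
  induction j with
  | zero => simp [leftEnd_zero]
  | succ n ih =>
    rw [leftEnd_add_one, ih, show ((n : ℤ) + 1 + k) = (n + k) + 1 by ring, leftEnd_add_one]
    ring
  | pred n ih =>
    have h1 := leftEnd_add_one (fun i => c (i + k)) (-(n : ℤ) - 1)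
    have h2 := leftEnd_add_one c (-(n : ℤ) - 1 + k)
    rw [show -(n : ℤ) - 1 + 1 = -n by ring, ih] at h1
    rw [show -(n : ℤ) - 1 + k + 1 = -n + k by ring] at h2
    linarith

theorem leftEnd_mono (c : ℤ → ℕ) : Monotone (leftEnd c) :=
  monotone_int_of_le_succ fun j => by rw [leftEnd_add_one]; omega

namespace LHPQ

/-- An offspring number together with a truncated quadrangulation. -/
abbrev Mark : Type := ℕ × TruncQuad

/-- An environment: for every horizontal edge, its mark, and the weights of the edges in its slot. -/
abbrev Env : Type := Site → Mark × (ℕ → ℝ)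

/-- A countable set that contains the vertices of all possible maps: lattice points, and interior
vertices of slots, each represented by a dart. -/
abbrev EnvVertex : Type := Site ⊕ (Site × (ℕ × Bool))

/-- The role that a vertex of a filling plays in the gluing: the top vertex of the slot, a vertex
of its lower boundary with its index from the left, or an interior vertex. -/
abbrev Role : Type := Unit ⊕ (ℕ ⊕ (ℕ × Bool))

open Classical in
/-- The role of a vertex of a filling, in a slot with `c` lower boundary edges. -/
noncomputable def role (M : RootedMap) (c : ℕ) (v : M.Vertex) : Role :=
  if v = M.apex then Sum.inl ()
  else if h : ∃ i : ℕ, i ≤ c ∧ v = M.bdry i then Sum.inr (Sum.inl (Nat.find h))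
  else Sum.inr (Sum.inr ((Quotient.out v).1, (Quotient.out v).2))

/-- The vertex with a given role in the slot `p`, when `l` is the first coordinate of the left end of
the lower boundary of the slot. -/
def position (p : Site) (l : ℤ) : Role → EnvVertex
  | Sum.inl _ => Sum.inl p
  | Sum.inr (Sum.inl i) => Sum.inl (l + i, p.2 + 1)
  | Sum.inr (Sum.inr d) => Sum.inr (p, d)

/-- The role of the tail of the dart `(k, b)`, or an arbitrary role if there is no edge `k`. -/
noncomputable def dartRole (m : Mark) (k : ℕ) (b : Bool) : Role :=
  if h : k < m.2.map.numEdges then role m.2.map m.1 (m.2.map.tail (⟨k, h⟩, b)) else Sum.inl ()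

/-- The filling has an inner edge with number `k`. -/
def IsEdge (m : Mark) (k : ℕ) : Prop :=
  ∃ h : k < m.2.map.numEdges, ∀ b : Bool, m.2.map.rightFace (⟨k, h⟩, b) ≠ m.2.map.extFace

/-- The first coordinate of the left end of the lower boundary of the slot `p`. -/
noncomputable def childLeft (W : Env) (p : Site) : ℤ := leftEnd (fun i => (W (i, p.2)).1.1) p.1

/-- The map generated by an environment, on fixed sets of vertices and edges. The edges that do not
exist in the map have arbitrary ends; `envWeight` gives them infinite weight. -/
noncomputable def envGraph (W : Env) : Multigraph EnvVertex (Site × ℕ) where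
  fst := fun e => position e.1 (childLeft W e.1) (dartRole (W e.1).1 e.2 false)
  snd := fun e => position e.1 (childLeft W e.1) (dartRole (W e.1).1 e.2 true)

open Classical in
/-- The weights of the edges in the slots at the levels in `S`. All other edges, including those that
do not exist in the map, have infinite weight. -/
noncomputable def envWeight (S : Set ℕ) (W : Env) (e : Site × ℕ) : ℝ≥0∞ :=
  if e.1.2 ∈ S ∧ IsEdge (W e.1).1 e.2 then ENNReal.ofReal ((W e.1).2 e.2) else ⊤

/-- The distance between the lattice points `(i, -m)` and `(j, -n)`, along the paths that use only
the slots at the levels in `S`. -/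
noncomputable def siteDist (S : Set ℕ) (W : Env) (p q : Site) : ℝ≥0∞ :=
  (envGraph W).fpp (envWeight S W) (Sum.inl p) (Sum.inl q)

/-- The distance between the root vertex and the line at height `-n`. -/
noncomputable def lineDist (n : ℕ) (W : Env) : ℝ≥0∞ := ⨅ j : ℤ, siteDist Set.univ W (0, 0) (j, n)

/-- The environment generated by a realization of the marks of all individuals. -/
noncomputable def toEnv (x : Marks) (t : Site → ℕ → ℝ) : Env := fun p => (x (ind x p), t p)

/-- The representation of a vertex as an element of `EnvVertex`. -/
noncomputable def vertexCode (x : Marks) : Vertex x → EnvVertex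
  | Sum.inl p => Sum.inl p
  | Sum.inr v => Sum.inr (v.1, ((Quotient.out v.2.1).1, (Quotient.out v.2.1).2))

theorem vertexCode_injective (x : Marks) : Function.Injective (vertexCode x) := by
  rintro (p | ⟨p, v, hv⟩) (q | ⟨q, w, hw⟩) h
  · exact congrArg Sum.inl (by simpa [vertexCode] using h)
  · simp [vertexCode] at h
  · simp [vertexCode] at h
  · simp only [vertexCode, Sum.inr.injEq, Prod.mk.injEq] at h
    obtain ⟨rfl, h1, h2⟩ := h
    have : v = w := Quotient.out_injective (Prod.ext (Fin.ext h1) h2)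
    subst this
    rfl

theorem vertexCode_place (x : Marks) (t : Site → ℕ → ℝ) (p : Site) (v : (filling x p).Vertex) :
    vertexCode x (place x p v) =
      position p (childLeft (toEnv x t) p) (role (filling x p) (offspring x p) v) := by
  by_cases h1 : v = (filling x p).apex
  · have e1 : place x p v = Sum.inl p := dif_pos h1
    have e2 : role (filling x p) (offspring x p) v = Sum.inl () := if_pos h1
    rw [e1, e2]
    rfl
  by_cases h2 : OnBoundary x p v
  · have h2' : ∃ i : ℕ, i ≤ offspring x p ∧ v = (filling x p).bdry i := h2
    have e1 : place x p v = _ := (dif_neg h1).trans (dif_pos h2)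
    have e2 : role (filling x p) (offspring x p) v = _ := (if_neg h1).trans (dif_pos h2')
    rw [e1, e2]
    rfl
  · have h2' : ¬ ∃ i : ℕ, i ≤ offspring x p ∧ v = (filling x p).bdry i := h2
    have e1 : place x p v = _ := (dif_neg h1).trans (dif_neg h2)
    have e2 : role (filling x p) (offspring x p) v = _ := (if_neg h1).trans (dif_neg h2')
    rw [e1, e2]
    rfl

theorem dartRole_of_lt {m : Mark} {k : ℕ} (h : k < m.2.map.numEdges) (b : Bool) :
    dartRole m k b = role m.2.map m.1 (m.2.map.tail (⟨k, h⟩, b)) := dif_pos h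

/-- The percolation distance of the model is a function of the environment. -/
theorem fppToLine_eq (x : Marks) (t : Site → ℕ → ℝ) (r : ℕ) :
    fppToLine x t r = lineDist r (toEnv x t) := by
  have key : ∀ v, (envGraph (toEnv x t)).fpp (envWeight Set.univ (toEnv x t))
      (vertexCode x (rootVertex x)) (vertexCode x v) = (tildeGraph x).fpp
        (fun e => ENNReal.ofReal (t e.1 e.2.1.val)) (rootVertex x) v := by
    intro v
    refine Multigraph.fpp_map _ _ _ _ (vertexCode x) (fun e : SlotEdge x => (e.1, e.2.1.val))
      (vertexCode_injective x) ?_ ?_ ?_ ?_ _ _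
    · rintro ⟨p, e, he⟩
      exact (congrArg _ (dartRole_of_lt (m := x (ind x p)) e.2 false)).trans
        (vertexCode_place x t p _).symm
    · rintro ⟨p, e, he⟩
      exact (congrArg _ (dartRole_of_lt (m := x (ind x p)) e.2 true)).trans
        (vertexCode_place x t p _).symm
    · rintro ⟨p, e, he⟩
      exact if_pos ⟨trivial, e.2, he⟩
    · rintro ⟨p, k⟩ h
      by_cases hk : IsEdge (toEnv x t p).1 k
      · obtain ⟨h1, h2⟩ := hk
        exact ⟨⟨p, ⟨k, h1⟩, h2⟩, rfl⟩
      · exact absurd (if_neg fun h' => hk h'.2) h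
  rw [fppToLine, Multigraph.fppSet, lineDist]
  apply le_antisymm
  · refine le_iInf fun j => iInf₂_le_of_le (Sum.inl (j, r)) ⟨j, rfl⟩ ?_
    exact (key (Sum.inl (j, r))).ge
  · refine le_iInf₂ ?_
    rintro _ ⟨j, rfl⟩
    exact iInf_le_of_le j (key (Sum.inl (j, r))).le

/-- The number `r` such that a vertex is on the line at height `-r` or inside a slot at level `r`. -/
def vertexLevel : EnvVertex → ℕ
  | Sum.inl p => p.2
  | Sum.inr v => v.1.2

theorem position_level (p : Site) (l : ℤ) (a : Role) :
    vertexLevel (position p l a) = p.2 ∨ ∃ j, position p l a = Sum.inl (j, p.2 + 1) := by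
  rcases a with _ | i | d
  · exact Or.inl rfl
  · exact Or.inr ⟨_, rfl⟩
  · exact Or.inl rfl

theorem siteDist_mono {S S' : Set ℕ} (h : S ⊆ S') (W : Env) (p q : Site) :
    siteDist S' W p q ≤ siteDist S W p q := by
  refine Multigraph.fpp_mono _ (fun e => ?_) _ _
  unfold envWeight
  split_ifs with h1 h2 h2
  · exact le_rfl
  · exact le_top
  · exact absurd ⟨h h2.1, h2.2⟩ h1
  · exact le_rfl

theorem siteDist_triangle (S : Set ℕ) (W : Env) (p q r : Site) :
    siteDist S W p r ≤ siteDist S W p q + siteDist S W q r := Multigraph.fpp_triangle _ _ _ _ _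

theorem siteDist_self (S : Set ℕ) (W : Env) (p : Site) : siteDist S W p p = 0 :=
  Multigraph.fpp_self _ _ _

/-- The distance to the line at height `-n` only depends on the slots above this line. -/
theorem lineDist_eq (n : ℕ) (W : Env) :
    lineDist n W = ⨅ j : ℤ, siteDist (Set.Iio n) W (0, 0) (j, n) := by
  classical
  apply le_antisymm
  · exact le_iInf fun j => iInf_le_of_le j (siteDist_mono (Set.subset_univ _) W _ _)
  set L := ⨅ j : ℤ, siteDist (Set.Iio n) W (0, 0) (j, n) with hL
  let d : EnvVertex → ℝ≥0∞ := (envGraph W).fpp (envWeight (Set.Iio n) W) (Sum.inl (0, 0))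
  -- above the line at height `-n`, the distance capped by `L`; from this line on, the constant `L`
  let φ : EnvVertex → ℝ≥0∞ := fun v => if vertexLevel v < n then d v ⊓ L else L
  have h0 : d (Sum.inl (0, 0)) = 0 := Multigraph.fpp_self _ _ _
  have hline : ∀ j, L ≤ d (Sum.inl (j, n)) := fun j => iInf_le _ j
  have hin : ∀ p l a, p.2 < n → φ (position p l a) = d (position p l a) ⊓ L := by
    intro p l a hp
    by_cases h : vertexLevel (position p l a) < n
    · exact if_pos h
    · rw [show φ (position p l a) = L from if_neg h]
      rcases position_level p l a with h' | ⟨j, h'⟩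
      · omega
      · rw [h'] at h ⊢
        have : p.2 + 1 = n := by simp only [vertexLevel] at h; omega
        rw [this, inf_eq_right.2 (hline j)]
  have hout : ∀ p l a, ¬ p.2 < n → φ (position p l a) = L := by
    intro p l a hp
    refine if_neg ?_
    rcases position_level p l a with h' | ⟨j, h'⟩
    · omega
    · rw [h']; simp only [vertexLevel]; omega
  have hw : ∀ e : Site × ℕ, e.1.2 < n → envWeight Set.univ W e = envWeight (Set.Iio n) W e := by
    intro e he
    simp [envWeight, he]
  refine le_iInf fun j => ?_
  have := Multigraph.le_fpp_of_potential (envGraph W) (envWeight Set.univ W) φ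
    (x := Sum.inl (0, 0)) ?_ ?_ ?_ (Sum.inl (j, n))
  · rwa [show φ (Sum.inl (j, n)) = L from if_neg (lt_irrefl n)] at this
  · by_cases hn : vertexLevel (Sum.inl (0, 0)) < n
    · rw [show φ (Sum.inl (0, 0)) = d (Sum.inl (0, 0)) ⊓ L from if_pos hn, h0]
      exact inf_eq_left.2 zero_le
    · rw [show φ (Sum.inl (0, 0)) = L from if_neg hn]
      have : n = 0 := by simp only [vertexLevel] at hn; omega
      subst this
      exact le_antisymm ((hline 0).trans h0.le) zero_le
  · intro e
    by_cases he : e.1.2 < n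
    · have h1 : φ ((envGraph W).fst e) = _ := hin _ _ _ he
      have h2 : φ ((envGraph W).snd e) = _ := hin _ _ _ he
      rw [h1, h2, min_add, hw e he]
      refine inf_le_inf ?_ le_self_add
      exact (Multigraph.fpp_triangle _ _ _ _ _).trans (by gcongr; exact Multigraph.fpp_fst_snd _ _ e)
    · have h1 : φ ((envGraph W).fst e) = L := hout _ _ _ he
      have h2 : φ ((envGraph W).snd e) = L := hout _ _ _ he
      rw [h1, h2]
      exact le_self_add
  · intro e
    by_cases he : e.1.2 < n
    · have h1 : φ ((envGraph W).fst e) = _ := hin _ _ _ he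
      have h2 : φ ((envGraph W).snd e) = _ := hin _ _ _ he
      rw [h1, h2, min_add, hw e he]
      refine inf_le_inf ?_ le_self_add
      exact (Multigraph.fpp_triangle _ _ _ _ _).trans (by gcongr; exact Multigraph.fpp_snd_fst _ _ e)
    · have h1 : φ ((envGraph W).fst e) = L := hout _ _ _ he
      have h2 : φ ((envGraph W).snd e) = L := hout _ _ _ he
      rw [h1, h2]
      exact le_self_add

/-- An edge joins vertices whose levels differ by at most one, so the level is a potential. -/
theorem le_lineDist (n : ℕ) (W : Env) (hW : ∀ p k, 1 ≤ (W p).2 k) : (n : ℝ≥0∞) ≤ lineDist n W := by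
  classical
  refine le_iInf fun j => ?_
  have hw : ∀ e, 1 ≤ envWeight Set.univ W e := by
    intro e
    unfold envWeight
    split_ifs
    · exact ENNReal.one_le_ofReal.2 (hW _ _)
    · exact le_top
  have hpos : ∀ p l a, p.2 ≤ vertexLevel (position p l a) ∧
      vertexLevel (position p l a) ≤ p.2 + 1 := by
    intro p l a
    rcases position_level p l a with h | ⟨j, h⟩
    · omega
    · rw [h]; simp [vertexLevel]
  have hpos' : ∀ p l a l' a', (vertexLevel (position p l a) : ℝ≥0∞) ≤
      (vertexLevel (position p l' a') : ℝ≥0∞) + 1 := by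
    intro p l a l' a'
    exact_mod_cast (hpos p l a).2.trans (by have := (hpos p l' a').1; omega)
  exact Multigraph.le_fpp_of_potential (envGraph W) (envWeight Set.univ W)
    (fun v => (vertexLevel v : ℝ≥0∞)) (x := Sum.inl (0, 0)) (by simp [vertexLevel])
    (fun e => (hpos' e.1 _ _ _ _).trans (add_le_add le_rfl (hw e)))
    (fun e => (hpos' e.1 _ _ _ _).trans (add_le_add le_rfl (hw e))) (Sum.inl (j, n))

theorem role_apex (M : RootedMap) (c : ℕ) : role M c M.apex = Sum.inl () := if_pos rfl

theorem role_bdry_zero {M : RootedMap} (hM : M.IsTruncQuad) (c : ℕ) :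
    role M c (M.bdry 0) = Sum.inr (Sum.inl 0) := by
  classical
  have h : ∃ i : ℕ, i ≤ c ∧ M.bdry 0 = M.bdry i := ⟨0, Nat.zero_le _, rfl⟩
  unfold role
  rw [if_neg hM.bdry_zero_ne_apex, dif_pos h]
  congr 2
  exact (Nat.find_eq_zero h).2 ⟨Nat.zero_le _, rfl⟩

/-- The left side of the downward triangle on the left of a slot is an edge of the map. -/
theorem siteDist_child_le {κ : ℝ} (W : Env) (hW : ∀ p k, (W p).2 k ≤ κ) (p : Site) :
    siteDist Set.univ W p (childLeft W p, p.2 + 1) ≤ ENNReal.ofReal κ := by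
  have hM := TruncQuad.isTruncQuad_map (W p).1.2
  obtain ⟨s1, s2⟩ := hM.spoke_inner
  have s3 := hM.tail_opp_spoke
  have s4 : (W p).1.2.map.tail (RootedMap.IsTruncQuad.spoke (W p).1.2.map) =
    (W p).1.2.map.apex := rfl
  generalize RootedMap.IsTruncQuad.spoke (W p).1.2.map = s at *
  obtain ⟨⟨k, hk⟩, b⟩ := s
  have hb : ∀ b' : Bool, (W p).1.2.map.rightFace (⟨k, hk⟩, b') ≠ (W p).1.2.map.extFace := by
    intro b'
    cases b <;> cases b' <;> assumption
  have hw : envWeight Set.univ W (p, k) ≤ ENNReal.ofReal κ := by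
    have : envWeight Set.univ W (p, k) = ENNReal.ofReal ((W p).2 k) := if_pos ⟨trivial, hk, hb⟩
    rw [this]
    exact ENNReal.ofReal_le_ofReal (hW p k)
  have r1 : dartRole (W p).1 k b = Sum.inl () := by
    rw [dartRole_of_lt hk, s4, role_apex]
  have r2 : dartRole (W p).1 k (!b) = Sum.inr (Sum.inl 0) := by
    rw [dartRole_of_lt hk]
    exact (congrArg (role _ _) s3).trans (role_bdry_zero hM _)
  have e1 : position p (childLeft W p) (Sum.inl ()) = Sum.inl p := rfl
  have e2 : position p (childLeft W p) (Sum.inr (Sum.inl 0)) =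
      Sum.inl (childLeft W p, p.2 + 1) := by simp [position]
  cases b
  · have h := Multigraph.fpp_fst_snd (envGraph W) (envWeight Set.univ W) (p, k)
    simp only [envGraph, Bool.not_false] at h r1 r2
    rw [r1, r2, e1, e2] at h
    exact h.trans hw
  · have h := Multigraph.fpp_snd_fst (envGraph W) (envWeight Set.univ W) (p, k)
    simp only [envGraph, Bool.not_true] at h r1 r2
    rw [r1, r2, e1, e2] at h
    exact h.trans hw

/-- Follow the left sides of downward triangles: one edge for every level. -/
theorem lineDist_le {κ : ℝ} (n : ℕ) (W : Env) (hW : ∀ p k, (W p).2 k ≤ κ) :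
    lineDist n W ≤ n * ENNReal.ofReal κ := by
  have : ∃ j : ℤ, siteDist Set.univ W (0, 0) (j, n) ≤ n * ENNReal.ofReal κ := by
    induction n with
    | zero => exact ⟨0, by rw [siteDist_self]; exact zero_le⟩
    | succ n ih =>
      obtain ⟨j, hj⟩ := ih
      refine ⟨childLeft W (j, n), (siteDist_triangle _ _ _ (j, n) _).trans ?_⟩
      push_cast
      rw [add_mul, one_mul]
      exact add_le_add hj (siteDist_child_le W hW (j, n))
  obtain ⟨j, hj⟩ := this
  exact iInf_le_of_le j hj

/-! ### The environment seen from a lattice point -/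

/-- The first coordinates of the lattice points at the heights `-m, -(m + 1), …` that become the
origins of their lines when the map is seen from `(j, -m)`. -/
noncomputable def originAt (W : Env) (m : ℕ) (j : ℤ) : ℕ → ℤ
  | 0 => j
  | r + 1 => childLeft W (originAt W m j r, m + r)

/-- The environment below the height `-m`, seen from the lattice point `(j, -m)`. -/
noncomputable def shift (m : ℕ) (j : ℤ) (W : Env) : Env :=
  fun p => W (p.1 + originAt W m j p.2, m + p.2)

theorem childLeft_shift (m : ℕ) (j : ℤ) (W : Env) (p : Site) :
    childLeft (shift m j W) p =
      childLeft W (p.1 + originAt W m j p.2, m + p.2) - originAt W m j (p.2 + 1) :=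
  leftEnd_shift (fun i => (W (i, m + p.2)).1.1) (originAt W m j p.2) p.1

/-- The map below the height `-m`, seen from `(j, -m)`, is the map generated by the shifted
environment. -/
theorem siteDist_shift (m : ℕ) (j : ℤ) (W : Env) (q : Site) :
    siteDist (Set.Ici m) W (j, m) (q.1 + originAt W m j q.2, m + q.2) =
      siteDist Set.univ (shift m j W) (0, 0) q := by
  classical
  let g : Site → Site := fun p => (p.1 + originAt W m j p.2, m + p.2)
  have hg : Function.Injective g := by
    rintro ⟨i, r⟩ ⟨i', r'⟩ h
    simp only [g, Prod.mk.injEq] at h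
    obtain ⟨h1, h2⟩ := h
    have : r = r' := by omega
    subst this
    simpa using h1
  let f : EnvVertex → EnvVertex := Sum.map g (Prod.map g id)
  have hf : Function.Injective f :=
    Sum.map_injective.2 ⟨hg, Function.Injective.prodMap hg Function.injective_id⟩
  have hpos : ∀ p a, position (g p) (childLeft W (g p)) a =
      f (position p (childLeft (shift m j W) p) a) := by
    intro p a
    rw [childLeft_shift]
    rcases a with _ | i | d
    · rfl
    · simp only [position, f, Sum.map_inl, g, Sum.inl.injEq, Prod.mk.injEq]
      exact ⟨by ring, by ring⟩
    · rfl
  have h0 : f (Sum.inl (0, 0)) = Sum.inl (j, m) := by simp [f, g, originAt]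
  have := Multigraph.fpp_map (envGraph (shift m j W)) (envGraph W)
    (envWeight Set.univ (shift m j W)) (envWeight (Set.Ici m) W) f
    (fun e => (g e.1, e.2)) hf (fun e => hpos e.1 _) (fun e => hpos e.1 _) ?_ ?_
    (Sum.inl (0, 0)) (Sum.inl q)
  · rw [h0] at this
    exact this
  · rintro ⟨p, k⟩
    simp only [envWeight, shift, g, Set.mem_Ici, Set.mem_univ, true_and, le_add_iff_nonneg_right,
      zero_le]
  · rintro ⟨⟨i, r⟩, k⟩ h
    by_cases hr : m ≤ r
    · refine ⟨((i - originAt W m j (r - m), r - m), k), ?_⟩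
      simp [g, hr]
    · exact absurd (if_neg fun h' => hr h'.1) h

theorem siteDist_Ici_eq_lineDist_shift (m n : ℕ) (j : ℤ) (W : Env) :
    ⨅ i : ℤ, siteDist (Set.Ici m) W (j, m) (i, m + n) = lineDist n (shift m j W) := by
  rw [lineDist, ← (Equiv.addRight (originAt W m j n)).iInf_comp]
  exact iInf_congr fun i => siteDist_shift m j W (i, n)

/-- Subadditivity along any point `(j, -m)` of the intermediate line. -/
theorem lineDist_add_le (m n : ℕ) (j : ℤ) (W : Env) :
    lineDist (m + n) W ≤ siteDist (Set.Iio m) W (0, 0) (j, m) + lineDist n (shift m j W) := by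
  rw [← siteDist_Ici_eq_lineDist_shift, ENNReal.add_iInf]
  refine le_iInf fun i => iInf_le_of_le i ((siteDist_triangle _ _ _ (j, m) _).trans ?_)
  gcongr <;> exact siteDist_mono (Set.subset_univ _) _ _ _

end LHPQ

/-! ### Random relabellings of independent families -/

/-- The σ-algebra generated by the variables with index in `T`. -/
@[reducible] def sigmaOf {Ω I S : Type*} [MeasurableSpace S] (Z : I → Ω → S) (T : Set I) :
    MeasurableSpace Ω :=
  ⨆ i ∈ T, MeasurableSpace.comap (Z i) inferInstance

section Relabel

variable {Ω I J S : Type*} [MeasurableSpace S] {Z : I → Ω → S}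

theorem measurable_sigmaOf {T : Set I} {i : I} (hi : i ∈ T) : Measurable[sigmaOf Z T] (Z i) :=
  measurable_iff_comap_le.2 (le_iSup₂_of_le i hi le_rfl)

theorem sigmaOf_mono {T T' : Set I} (h : T ⊆ T') : sigmaOf Z T ≤ sigmaOf Z T' :=
  biSup_mono h

theorem sigmaOf_le [mΩ : MeasurableSpace Ω] (hZ : ∀ i, Measurable (Z i)) (T : Set I) :
    sigmaOf Z T ≤ mΩ :=
  iSup₂_le fun i _ => measurable_iff_comap_le.1 (hZ i)

theorem measurable_comp_countable {ι β : Type*} [MeasurableSpace Ω] [MeasurableSpace β]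
    [Countable ι] [MeasurableSpace ι] [MeasurableSingletonClass ι] {F : ι → Ω → β}
    (hF : ∀ i, Measurable (F i)) {o : Ω → ι} (ho : Measurable o) :
    Measurable fun ω => F (o ω) ω := by
  have h : Measurable (fun x : ι × Ω => F x.1 x.2) := measurable_from_prod_countable_right hF
  exact h.comp (ho.prodMk measurable_id)

variable [MeasurableSpace Ω] {P : Measure Ω}

theorem measure_eq_tsum_fibers [Countable I] {τ : Ω → I} (hτ : ∀ i, MeasurableSet {ω | τ ω = i})
    {E : Set Ω} (hE : MeasurableSet E) : P E = ∑' i, P (E ∩ {ω | τ ω = i}) := by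
  rw [← measure_iUnion]
  · congr 1
    ext ω
    simp
  · intro i j hij
    refine Set.disjoint_left.2 fun ω h h' => hij ?_
    exact h.2.symm.trans h'.2
  · exact fun i => hE.inter (hτ i)

/-- Let `Z` be an i.i.d. family, and let `τ` be a random relabelling: `τ q` is determined by the
variables `Z i` with `deg i < lev q`, it has degree `lev q`, and the `τ q` with the same level are
distinct. Then the relabelled family is i.i.d. as well, and independent of the variables with degree
less than all its levels. -/
theorem measure_inter_relabel [IsProbabilityMeasure P] [Countable I] (hZ : ∀ i, Measurable (Z i))
    (hind : iIndepFun Z P) {μ : Measure S} (hlaw : ∀ i, P.map (Z i) = μ) {deg : I → ℕ}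
    {lev : J → ℕ} {τ : J → Ω → I} {J₀ : Set J}
    (hτ : ∀ q ∈ J₀, ∀ i, MeasurableSet[sigmaOf Z {i | deg i < lev q}] {ω | τ q ω = i})
    (hdeg : ∀ q ∈ J₀, ∀ᵐ ω ∂P, deg (τ q ω) = lev q)
    (hinj : ∀ q ∈ J₀, ∀ q' ∈ J₀, q ≠ q' → lev q = lev q' → ∀ᵐ ω ∂P, τ q ω ≠ τ q' ω)
    {m : ℕ} (hm : ∀ q ∈ J₀, m ≤ lev q) {B : Set Ω}
    (hB : MeasurableSet[sigmaOf Z {i | deg i < m}] B) (s : Finset J) (hs : ∀ q ∈ s, q ∈ J₀)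
    {A : J → Set S} (hA : ∀ q, MeasurableSet (A q)) :
    P (B ∩ ⋂ q ∈ s, {ω | Z (τ q ω) ω ∈ A q}) = P B * ∏ q ∈ s, μ (A q) := by
  classical
  induction s using Finset.induction_on_max_value lev with
  | empty => simp
  | insert q s hq hmax ih =>
    specialize ih fun q' h => hs q' (Finset.mem_insert_of_mem h)
    have hq0 : q ∈ J₀ := hs q (Finset.mem_insert_self q s)
    have hτ' : ∀ q ∈ J₀, ∀ i, MeasurableSet {ω | τ q ω = i} :=
      fun q hq i => sigmaOf_le hZ _ _ (hτ q hq i)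
    have hE : ∀ q ∈ J₀, MeasurableSet {ω | Z (τ q ω) ω ∈ A q} := by
      intro q hq
      have : {ω | Z (τ q ω) ω ∈ A q} = ⋃ i, ({ω | τ q ω = i} ∩ Z i ⁻¹' A q) := by
        ext ω; simp
      rw [this]
      exact MeasurableSet.iUnion fun i => (hτ' q hq i).inter (hZ i (hA q))
    set C := B ∩ ⋂ q ∈ s, {ω | Z (τ q ω) ω ∈ A q} with hC
    have hCm : MeasurableSet C := (sigmaOf_le hZ _ _ hB).inter
      (Finset.measurableSet_biInter s fun q' h => hE q' (hs q' (Finset.mem_insert_of_mem h)))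
    have key : ∀ i, P ((C ∩ {ω | Z (τ q ω) ω ∈ A q}) ∩ {ω | τ q ω = i}) =
        P (C ∩ {ω | τ q ω = i}) * μ (A q) := by
      intro i
      by_cases hi : deg i = lev q
      swap
      · have h0 : P {ω | τ q ω = i} = 0 := by
          refine measure_mono_null (fun ω hω => ?_) (ae_iff.1 (hdeg q hq0))
          rw [← (show τ q ω = i from hω)] at hi
          exact hi
        rw [measure_mono_null Set.inter_subset_right h0,
          measure_mono_null Set.inter_subset_right h0, zero_mul]
      -- on the event `τ q = i`, the event `C` does not involve the variable `Z i`
      let C' : Set Ω := (B ∩ ⋂ q' ∈ s, ⋃ k ∈ ({i}ᶜ : Set I), ({ω | τ q' ω = k} ∩ Z k ⁻¹' A q')) ∩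
        {ω | τ q ω = i}
      have hsub : ∀ n ≤ lev q, sigmaOf Z {k | deg k < n} ≤ sigmaOf Z {i}ᶜ := by
        intro n hn
        refine sigmaOf_mono fun k hk => ?_
        rintro rfl
        rw [Set.mem_ofPred_eq, hi] at hk
        omega
      have hC' : MeasurableSet[sigmaOf Z {i}ᶜ] C' := by
        refine MeasurableSet.inter (MeasurableSet.inter (hsub m (hm q hq0) _ hB)
          (Finset.measurableSet_biInter s fun q' h => MeasurableSet.biUnion (Set.to_countable _)
            fun k hk => MeasurableSet.inter (hsub _ (hmax q' h) _
              (hτ q' (hs q' (Finset.mem_insert_of_mem h)) k)) ?_)) (hsub _ le_rfl _ (hτ q hq0 i))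
        exact measurable_sigmaOf hk (hA q')
      have hne : ∀ᵐ ω ∂P, ∀ q' ∈ s, τ q' ω = i → τ q ω ≠ i := by
        rw [Filter.eventually_all_finset]
        intro q' h
        have hq' := hs q' (Finset.mem_insert_of_mem h)
        by_cases hl : lev q' = lev q
        · filter_upwards [hinj q' hq' q hq0 (fun e => hq (e ▸ h)) hl] with ω h1 h2 h3
          exact h1 (h2.trans h3.symm)
        · filter_upwards [hdeg q' hq'] with ω h1 h2
          rw [h2, hi] at h1
          exact absurd h1.symm hl
      have hCC' : (C ∩ {ω | τ q ω = i} : Set Ω) =ᵐ[P] C' := by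
        filter_upwards [hne] with ω hω
        refine propext (and_congr_left fun h1 => and_congr_right fun _ => ?_)
        change ω ∈ (⋂ q ∈ s, {ω | Z (τ q ω) ω ∈ A q}) ↔
          ω ∈ ⋂ q' ∈ s, ⋃ k ∈ ({i}ᶜ : Set I), ({ω | τ q' ω = k} ∩ Z k ⁻¹' A q')
        simp only [Set.mem_iInter, Set.mem_iUnion, Set.mem_ofPred_eq, Set.mem_inter_iff,
          Set.mem_preimage, Set.mem_compl_iff, Set.mem_singleton_iff]
        refine forall₂_congr fun q' hq' => ⟨fun h => ⟨_, fun e => hω q' hq' e h1, rfl, h⟩, ?_⟩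
        rintro ⟨k, -, rfl, h⟩
        exact h
      have hindep : Indep (sigmaOf Z {i}ᶜ) (sigmaOf Z {i}) P :=
        indep_iSup_of_disjoint (fun i => measurable_iff_comap_le.1 (hZ i)) hind
          disjoint_compl_left
      have h1 : (C ∩ {ω | Z (τ q ω) ω ∈ A q}) ∩ {ω | τ q ω = i} =
          (C ∩ {ω | τ q ω = i}) ∩ Z i ⁻¹' A q := by
        ext ω
        simp only [Set.mem_inter_iff, Set.mem_ofPred_eq, Set.mem_preimage]
        constructor
        · rintro ⟨⟨h1, h2⟩, rfl⟩; exact ⟨⟨h1, rfl⟩, h2⟩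
        · rintro ⟨⟨h1, rfl⟩, h2⟩; exact ⟨⟨h1, h2⟩, rfl⟩
      rw [h1, measure_congr (hCC'.inter (ae_eq_refl (Z i ⁻¹' A q))), measure_congr hCC',
        Indep_iff _ _ _ |>.1 hindep _ _ hC' (measurable_sigmaOf (Set.mem_singleton i) (hA q)),
        ← hlaw i, Measure.map_apply (hZ i) (hA q)]
    have h2 : (B ∩ ⋂ q' ∈ insert q s, {ω | Z (τ q' ω) ω ∈ A q'}) =
        C ∩ {ω | Z (τ q ω) ω ∈ A q} := by
      rw [Finset.set_biInter_insert, hC, Set.inter_assoc, Set.inter_comm {ω | Z (τ q ω) ω ∈ A q}]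
    rw [h2, measure_eq_tsum_fibers (hτ' q hq0) (hCm.inter (hE q hq0)), tsum_congr key,
      ENNReal.tsum_mul_right, ← measure_eq_tsum_fibers (hτ' q hq0) hCm, ih,
      Finset.prod_insert hq, mul_assoc, mul_comm (μ (A q))]

/-- A family that is i.i.d. and independent of the event `B`: it suffices to look at cylinders. -/
theorem measure_inter_preimage_of_cylinders [IsProbabilityMeasure P] {μ : Measure S}
    [IsProbabilityMeasure μ] {V : Ω → J → S} (hV : Measurable V) {B : Set Ω}
    (h : ∀ (s : Finset J) (A : J → Set S), (∀ q, MeasurableSet (A q)) →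
      P (B ∩ ⋂ q ∈ s, {ω | V ω q ∈ A q}) = P B * ∏ q ∈ s, μ (A q))
    {A : Set (J → S)} (hA : MeasurableSet A) :
    P (B ∩ V ⁻¹' A) = P B * Measure.infinitePi (fun _ : J => μ) A := by
  by_cases hB0 : P B = 0
  · rw [measure_mono_null Set.inter_subset_left hB0, hB0, zero_mul]
  have hmap : ∀ {A : Set (J → S)}, MeasurableSet A →
      ((P B)⁻¹ • (P.restrict B).map V) A = (P B)⁻¹ * P (B ∩ V ⁻¹' A) := by
    intro A hA
    rw [Measure.smul_apply, Measure.map_apply hV hA, Measure.restrict_apply (hV hA), smul_eq_mul,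
      Set.inter_comm]
  have key : (P B)⁻¹ • (P.restrict B).map V = Measure.infinitePi (fun _ : J => μ) := by
    refine Measure.eq_infinitePi _ fun s t ht => ?_
    rw [hmap (MeasurableSet.pi s.countable_toSet fun i _ => ht i)]
    have : V ⁻¹' (s : Set J).pi t = ⋂ q ∈ s, {ω | V ω q ∈ t q} := by
      ext ω; simp [Set.mem_pi]
    rw [this, h s t ht, ← mul_assoc, ENNReal.inv_mul_cancel hB0 (measure_ne_top _ _), one_mul]
  rw [← key, hmap hA, ← mul_assoc, ENNReal.mul_inv_cancel hB0 (measure_ne_top _ _), one_mul]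

/-- A measurable choice of an approximate minimizer. -/
theorem exists_measurable_approx_min {f : ℤ → Ω → ℝ≥0∞} (hf : ∀ j, Measurable (f j)) {ε : ℝ≥0∞}
    (hε : ε ≠ 0) :
    ∃ x : Ω → ℤ, Measurable x ∧ ∀ ω, (⨅ j, f j ω) ≠ ⊤ → f (x ω) ω ≤ (⨅ j, f j ω) + ε := by
  classical
  obtain ⟨e⟩ : Nonempty (ℕ ≃ ℤ) := ⟨Equiv.intEquivNat.symm⟩
  let p : Ω → ℕ → Prop := fun ω n =>
    f (e n) ω ≤ (⨅ j, f j ω) + ε ∨ ∀ k, ¬ f (e k) ω ≤ (⨅ j, f j ω) + ε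
  have hp : ∀ ω, ∃ n, p ω n := by
    intro ω
    by_cases h : ∃ n, f (e n) ω ≤ (⨅ j, f j ω) + ε
    · exact h.imp fun n hn => Or.inl hn
    · push Not at h
      exact ⟨0, Or.inr fun k => not_le.2 (h k)⟩
  have hinf : Measurable fun ω => (⨅ j, f j ω) + ε := (Measurable.iInf hf).add_const ε
  have h1 : ∀ n, MeasurableSet {ω | f (e n) ω ≤ (⨅ j, f j ω) + ε} := fun n =>
    measurableSet_le (hf _) hinf
  have h2 : Measurable fun ω => Nat.find (hp ω) := by
    refine measurable_find hp fun n => ?_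
    have : {ω | p ω n} = {ω | f (e n) ω ≤ (⨅ j, f j ω) + ε} ∪
        ⋂ k, {ω | f (e k) ω ≤ (⨅ j, f j ω) + ε}ᶜ := by
      ext ω; simp [p]
    rw [this]
    exact (h1 n).union (MeasurableSet.iInter fun k => (h1 k).compl)
  refine ⟨fun ω => e (Nat.find (hp ω)), (measurable_of_countable e).comp h2, fun ω hω => ?_⟩
  rcases Nat.find_spec (hp ω) with h | h
  · exact h
  · exfalso
    obtain ⟨j, hj⟩ := exists_lt_of_ciInf_lt (ENNReal.lt_add_right hω hε)
    exact h (e.symm j) (by simpa using hj.le)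

end Relabel

/-! ### The law of the environment seen from a random lattice point -/

theorem measurable_leftEnd {Ω : Type*} [MeasurableSpace Ω] {c : Ω → ℤ → ℕ}
    (hc : ∀ i, Measurable fun ω => c ω i) (j : ℤ) : Measurable fun ω => leftEnd (c ω) j := by
  unfold leftEnd
  have h : ∀ i, Measurable fun ω => (c ω i : ℤ) := fun i =>
    (measurable_of_countable (fun n : ℕ => (n : ℤ))).comp (hc i)
  exact (Finset.measurable_fun_sum _ fun i _ => h i).sub (Finset.measurable_fun_sum _ fun i _ => h i)

namespace LHPQ

section Measurability

variable {Ω : Type*} [MeasurableSpace Ω] {W : Ω → Env}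

theorem measurable_childLeft {r : ℕ} (hW : ∀ i, Measurable fun ω => W ω (i, r)) (j : ℤ) :
    Measurable fun ω => childLeft (W ω) (j, r) :=
  measurable_leftEnd (fun i => (measurable_fst.comp measurable_fst).comp (hW i)) j

theorem measurable_siteDist {S : Set ℕ} (hW : ∀ p : Site, p.2 ∈ S → Measurable fun ω => W ω p)
    (p q : Site) : Measurable fun ω => siteDist S (W ω) p q := by
  classical
  refine Multigraph.measurable_fpp _ _ ?_ _ _
  rintro ⟨p, k⟩ a b
  by_cases hp : p.2 ∈ S
  swap
  · have : ∀ ω, envWeight S (W ω) (p, k) = ⊤ := fun ω => if_neg fun h => hp h.1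
    simp only [this, iInf_top]
    exact measurable_const
  have h1 : Measurable fun ω => (childLeft (W ω) p, (W ω p).1) :=
    (measurable_childLeft (fun i => hW (i, p.2) hp) p.1).prodMk (measurable_fst.comp (hW p hp))
  let A : Set (ℤ × Mark) := {y | IsEdge y.2 k ∧ position p y.1 (dartRole y.2 k false) = a ∧
    position p y.1 (dartRole y.2 k true) = b}
  have h2 : MeasurableSet {ω | (childLeft (W ω) p, (W ω p).1) ∈ A} :=
    h1 (MeasurableSet.of_discrete (s := A))
  have h3 : Measurable fun ω => ENNReal.ofReal ((W ω p).2 k) :=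
    ENNReal.measurable_ofReal.comp ((measurable_pi_apply k).comp (measurable_snd.comp (hW p hp)))
  have h4 : Measurable fun ω =>
      if (childLeft (W ω) p, (W ω p).1) ∈ A then ENNReal.ofReal ((W ω p).2 k) else ⊤ :=
    Measurable.ite h2 h3 measurable_const
  refine Eq.mpr (congrArg Measurable (funext fun ω => ?_)) h4
  by_cases hA : (childLeft (W ω) p, (W ω p).1) ∈ A
  · rw [if_pos hA, show (envGraph (W ω)).fst (p, k) = a from hA.2.1,
      show (envGraph (W ω)).snd (p, k) = b from hA.2.2]
    simp only [iInf_pos]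
    exact if_pos ⟨hp, hA.1⟩
  · rw [if_neg hA]
    refine iInf₂_eq_top.2 fun ha hb => ?_
    exact if_neg fun h => hA ⟨h.2, ha, hb⟩

theorem measurable_lineDist {n : ℕ} (hW : ∀ p : Site, p.2 < n → Measurable fun ω => W ω p) :
    Measurable fun ω => lineDist n (W ω) := by
  simp only [lineDist_eq]
  exact Measurable.iInf fun j => measurable_siteDist (S := Set.Iio n) hW _ _

theorem measurable_originAt {m r : ℕ} {j : Ω → ℤ} (hj : Measurable j)
    (hW : ∀ p : Site, m ≤ p.2 → p.2 < m + r → Measurable fun ω => W ω p) :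
    Measurable fun ω => originAt (W ω) m (j ω) r := by
  induction r with
  | zero => exact hj
  | succ r ih =>
    exact measurable_comp_countable (F := fun i ω => childLeft (W ω) (i, m + r))
      (fun i => measurable_childLeft (fun i => hW _ (by simp) (by simp)) i)
      (ih fun p h h' => hW p h (by omega))

theorem measurable_shift {m : ℕ} {j : Ω → ℤ} (hj : Measurable j) {p : Site}
    (hW : ∀ q : Site, m ≤ q.2 → q.2 ≤ m + p.2 → Measurable fun ω => W ω q) :
    Measurable fun ω => shift m (j ω) (W ω) p :=
  measurable_comp_countable (F := fun i ω => W ω (p.1 + i, m + p.2))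
    (fun i => hW _ (by simp) (by simp))
    (measurable_originAt hj fun q h h' => hW q h (by omega))

end Measurability

/-- The σ-algebra generated by the slots above the height `-m`. -/
@[reducible] def past (m : ℕ) : MeasurableSpace Env :=
  sigmaOf (fun (p : Site) (W : Env) => W p) {p | p.2 < m}

theorem past_le (m : ℕ) : past m ≤ inferInstanceAs (MeasurableSpace Env) :=
  sigmaOf_le (fun p => measurable_pi_apply p) _

theorem past_mono : Monotone past := fun _ _ h =>
  sigmaOf_mono fun _ hp => lt_of_lt_of_le hp h

theorem iSup_past : ⨆ m, past m = inferInstanceAs (MeasurableSpace Env) := by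
  apply le_antisymm (iSup_le past_le)
  refine iSup_le fun p => le_iSup_of_le (p.2 + 1) ?_
  exact le_iSup₂_of_le (f := fun (p : Site) (_ : p ∈ {q : Site | q.2 < _}) =>
    MeasurableSpace.comap (fun W : Env => W p) inferInstance) p (Nat.lt_succ_self _) le_rfl

theorem measurable_past_eval {m : ℕ} {p : Site} (hp : p.2 < m) :
    Measurable[past m] fun W : Env => W p :=
  measurable_sigmaOf (Z := fun (p : Site) (W : Env) => W p) (T := {p | p.2 < m}) hp

section Law

variable (μ : Measure (Mark × (ℕ → ℝ))) [IsProbabilityMeasure μ]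

/-- The law of an environment whose slots are independent with law `μ`. -/
noncomputable def envLaw : Measure Env := Measure.infinitePi fun _ : Site => μ

instance : IsProbabilityMeasure (envLaw μ) := by unfold envLaw; infer_instance

theorem map_eval_envLaw (p : Site) : (envLaw μ).map (fun W => W p) = μ :=
  Measure.infinitePi_map_eval (fun _ : Site => μ) p

theorem iIndepFun_eval_envLaw : iIndepFun (fun (p : Site) (W : Env) => W p) (envLaw μ) := by
  rw [iIndepFun_iff_map_fun_eq_infinitePi_map (fun p => measurable_pi_apply p)]
  simp only [map_eval_envLaw]
  exact Measure.map_id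

/-- The environment seen from a random lattice point that is determined by the slots above it is
independent of these slots, and its law is the law of the environment. -/
theorem envLaw_inter_shift {m : ℕ} {j : Env → ℤ} (hj : Measurable[past m] j) {B A : Set Env}
    (hB : MeasurableSet[past m] B) (hA : MeasurableSet A) :
    envLaw μ (B ∩ (fun W => shift m (j W) W) ⁻¹' A) = envLaw μ B * envLaw μ A := by
  have hj' : Measurable j := fun s hs => past_le m _ (hj hs)
  have hV : Measurable fun W : Env => shift m (j W) W :=
    measurable_pi_iff.2 fun p => measurable_shift hj' fun q _ _ => measurable_pi_apply q
  refine measure_inter_preimage_of_cylinders hV (fun s C hC => ?_) hA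
  refine measure_inter_relabel (Z := fun (p : Site) (W : Env) => W p) (J₀ := Set.univ)
    (deg := fun p => p.2) (lev := fun p : Site => m + p.2)
    (τ := fun p W => (p.1 + originAt W m (j W) p.2, m + p.2))
    (fun p => measurable_pi_apply p) (iIndepFun_eval_envLaw μ) (map_eval_envLaw μ)
    ?_ ?_ ?_ (fun q _ => Nat.le_add_right m q.2) hB s (fun q _ => Set.mem_univ q) hC
  · intro q _ p
    have h1 : Measurable[past (m + q.2)] fun W => originAt W m (j W) q.2 :=
      @measurable_originAt _ (past (m + q.2)) (fun W => W) m q.2 j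
        (fun s hs => past_mono (Nat.le_add_right m q.2) _ (hj hs))
        fun p _ h => measurable_past_eval h
    exact h1 (MeasurableSet.of_discrete (s := {i | (q.1 + i, m + q.2) = p}))
  · exact fun q _ => ae_of_all _ fun W => rfl
  · rintro ⟨i, r⟩ - ⟨i', r'⟩ - hne hlev
    refine ae_of_all _ fun W h => hne ?_
    have : r = r' := by simpa using hlev
    subst this
    simpa using h

end Law

end LHPQ

/-! ### An almost subadditive ergodic theorem -/

/-- A process `D` is almost subadditive and renewed by the past if, for every `ε > 0`, the
increments after time `m` are at most `ε` plus a copy of the process that is independent of the past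
at time `m`. -/
structure IsAlmostSubadditive {Ω : Type*} [MeasurableSpace Ω] (P : Measure Ω)
    (𝓕 : ℕ → MeasurableSpace Ω) (D : ℕ → Ω → ℝ) (κ : ℝ) : Prop where
  mono : Monotone 𝓕
  le : ∀ m, 𝓕 m ≤ ‹MeasurableSpace Ω›
  iSup_eq : ⨆ m, 𝓕 m = ‹MeasurableSpace Ω›
  measurable : ∀ n, Measurable (D n)
  bounds : ∀ᵐ ω ∂P, ∀ n : ℕ, n ≤ D n ω ∧ D n ω ≤ κ * n
  restart : ∀ ε > 0, ∃ Φ : ℕ → Ω → Ω, (∀ m, MeasurePreserving (Φ m) P P) ∧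
    (∀ m B A, MeasurableSet[𝓕 m] B → MeasurableSet A → P (B ∩ Φ m ⁻¹' A) = P B * P A) ∧
    (∀ m n, Measurable[𝓕 (m + n)] fun ω => D n (Φ m ω)) ∧
    ∀ᵐ ω ∂P, ∀ m n, D (m + n) ω ≤ D m ω + ε + D n (Φ m ω)

namespace IsAlmostSubadditive

variable {Ω : Type*} [mΩ : MeasurableSpace Ω] {P : Measure Ω}
  {𝓕 : ℕ → MeasurableSpace Ω} {D : ℕ → Ω → ℝ} {κ : ℝ}

theorem integral_comp (h : IsAlmostSubadditive P 𝓕 D κ) {φ : Ω → Ω} (hφ : MeasurePreserving φ P P)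
    (n : ℕ) : ∫ ω, D n (φ ω) ∂P = ∫ ω, D n ω ∂P := by
  rw [← integral_map hφ.measurable.aemeasurable
    (by rw [hφ.map_eq]; exact (h.measurable n).aestronglyMeasurable), hφ.map_eq]

/-- The event that `D n` is infinitely often smaller than `q n`, for some `q < c'`. -/
def lowSet (D : ℕ → Ω → ℝ) (c' : ℝ) : Set Ω :=
  {ω | ∃ q : ℚ, (q : ℝ) < c' ∧ ∃ᶠ n : ℕ in atTop, D n ω ≤ q * n}

theorem measurableSet_lowSet (h : IsAlmostSubadditive P 𝓕 D κ) (c' : ℝ) :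
    MeasurableSet (lowSet D c') := by
  have : lowSet D c' = ⋃ (q : ℚ) (_ : (q : ℝ) < c'), ⋂ N : ℕ, ⋃ (n : ℕ) (_ : N ≤ n),
      {ω | D n ω ≤ q * n} := by
    ext ω
    simp [lowSet, frequently_atTop]
  rw [this]
  exact MeasurableSet.iUnion fun q => MeasurableSet.iUnion fun _ => MeasurableSet.iInter fun N =>
    MeasurableSet.iUnion fun n => MeasurableSet.iUnion fun _ =>
      measurableSet_le (h.measurable n) measurable_const

variable [IsProbabilityMeasure P]

theorem one_le (h : IsAlmostSubadditive P 𝓕 D κ) : 1 ≤ κ := by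
  obtain ⟨ω, hω⟩ := h.bounds.exists
  have := hω 1
  push_cast at this
  linarith

theorem integrable (h : IsAlmostSubadditive P 𝓕 D κ) (n : ℕ) : Integrable (D n) P := by
  refine Integrable.of_bound (h.measurable n).aestronglyMeasurable (κ * n) ?_
  filter_upwards [h.bounds] with ω hω
  have := hω n
  rw [Real.norm_eq_abs, abs_of_nonneg (le_trans (Nat.cast_nonneg n) this.1)]
  exact this.2

theorem le_integral (h : IsAlmostSubadditive P 𝓕 D κ) (n : ℕ) : (n : ℝ) ≤ ∫ ω, D n ω ∂P := by
  have := integral_mono_ae (integrable_const (n : ℝ)) (h.integrable n)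
    (h.bounds.mono fun ω hω => (hω n).1)
  simpa using this

theorem integral_le (h : IsAlmostSubadditive P 𝓕 D κ) (n : ℕ) : ∫ ω, D n ω ∂P ≤ κ * n := by
  have := integral_mono_ae (h.integrable n) (integrable_const (κ * n))
    (h.bounds.mono fun ω hω => (hω n).2)
  simpa using this

theorem subadditive (h : IsAlmostSubadditive P 𝓕 D κ) : Subadditive fun n => ∫ ω, D n ω ∂P := by
  intro m n
  refine le_of_forall_pos_le_add fun ε hε => ?_
  obtain ⟨Φ, hΦ, -, -, hsub⟩ := h.restart ε hε
  have i1 := h.integrable m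
  have i2 : Integrable (fun ω => D n (Φ m ω)) P := (hΦ m).integrable_comp_of_integrable (h.integrable n)
  have := integral_mono_ae (h.integrable (m + n)) ((i1.add (integrable_const ε)).add i2)
    (hsub.mono fun ω hω => hω m n)
  rw [integral_add' (i1.add (integrable_const ε)) i2, integral_add' i1 (integrable_const ε),
    h.integral_comp (hΦ m)] at this
  simp only [integral_const, probReal_univ, one_smul] at this
  linarith

theorem bddBelow (h : IsAlmostSubadditive P 𝓕 D κ) :
    BddBelow (Set.range fun n : ℕ => (∫ ω, D n ω ∂P) / n) := by
  refine ⟨0, ?_⟩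
  rintro _ ⟨n, rfl⟩
  exact div_nonneg ((Nat.cast_nonneg n).trans (h.le_integral n)) (Nat.cast_nonneg n)

theorem lim_mem (h : IsAlmostSubadditive P 𝓕 D κ) : h.subadditive.lim ∈ Set.Icc 1 κ := by
  have ht := h.subadditive.tendsto_lim h.bddBelow
  constructor
  · refine ge_of_tendsto ht ((eventually_gt_atTop 0).mono fun n hn => ?_)
    rw [le_div_iff₀ (Nat.cast_pos.2 hn), one_mul]
    exact h.le_integral n
  · refine le_of_tendsto ht ((eventually_gt_atTop 0).mono fun n hn => ?_)
    rw [div_le_iff₀ (Nat.cast_pos.2 hn)]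
    exact h.integral_le n

/-- The upper bound: cut the time into blocks of length `k`, to which the law of large numbers
applies. -/
theorem eventually_lt_of_block (h : IsAlmostSubadditive P 𝓕 D κ) {k : ℕ} (hk : 0 < k) :
    ∀ᵐ ω ∂P, ∀ c' : ℝ, (∫ ω, D k ω ∂P + 1) / k < c' → ∀ᶠ N : ℕ in atTop, D N ω < c' * N := by
  obtain ⟨Φ, hΦ, hind, hmeas, hsub⟩ := h.restart 1 one_pos
  let Z : ℕ → Ω → ℝ := fun i ω => D k (Φ (i * k) ω)
  have hZm : ∀ i, Measurable (Z i) := fun i => (h.measurable k).comp (hΦ _).measurable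
  have hident : ∀ i, IdentDistrib (Z i) (D k) P P := fun i =>
    ⟨(hZm i).aemeasurable, (h.measurable k).aemeasurable, by
      change P.map (D k ∘ Φ (i * k)) = _
      rw [← Measure.map_map (h.measurable k) (hΦ _).measurable, (hΦ _).map_eq]⟩
  have hlt : ∀ i j, i < j → IndepFun (Z i) (Z j) P := by
    intro i j hij
    rw [indepFun_iff_measure_inter_preimage_eq_mul]
    intro s t hs ht
    have h1 : MeasurableSet[𝓕 (j * k)] (Z i ⁻¹' s) := by
      refine h.mono ?_ _ (hmeas (i * k) k hs)
      calc i * k + k = (i + 1) * k := by ring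
        _ ≤ j * k := Nat.mul_le_mul_right k hij
    have h2 := hind (j * k) _ _ h1 (h.measurable k ht)
    rw [← (hΦ (j * k)).measure_preimage (h.measurable k ht).nullMeasurableSet] at h2
    exact h2
  have hpair : Pairwise fun i j => IndepFun (Z i) (Z j) P := by
    intro i j hij
    rcases lt_or_gt_of_ne hij with h | h
    · exact hlt i j h
    · exact (hlt j i h).symm
  have hlln := strong_law_ae_real Z ((hident 0).integrable_iff.2 (h.integrable k)) hpair
    fun i => (hident i).trans (hident 0).symm
  rw [(hident 0).integral_eq] at hlln
  have hbd : ∀ᵐ ω ∂P, ∀ m n : ℕ, D n (Φ m ω) ≤ κ * n := by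
    rw [ae_all_iff]
    intro m
    filter_upwards [(hΦ m).quasiMeasurePreserving.ae h.bounds] with ω hω n
    exact (hω n).2
  set a := ∫ ω, D k ω ∂P with ha
  have ha0 : 0 ≤ a := (Nat.cast_nonneg k).trans (h.le_integral k)
  have hk' : (0 : ℝ) < k := Nat.cast_pos.2 hk
  filter_upwards [hlln, hsub, hbd, h.bounds] with ω h1 h2 h3 h4 c' hc'
  have hsum : ∀ n : ℕ, D (n * k) ω ≤ ∑ i ∈ Finset.range n, Z i ω + n := by
    intro n
    induction n with
    | zero => simpa using (h4 0).2
    | succ n ih =>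
      have := h2 (n * k) k
      rw [show n * k + k = (n + 1) * k by ring] at this
      rw [Finset.sum_range_succ]
      push_cast
      change _ ≤ _ + Z n ω at this
      linarith
  obtain ⟨δ, hδ, hδc⟩ : ∃ δ > 0, (a + 1 + δ) / k < c' := by
    rw [div_lt_iff₀ hk'] at hc'
    refine ⟨(c' * k - (a + 1)) / 2, by linarith, ?_⟩
    rw [div_lt_iff₀ hk']
    linarith
  have h5 : ∀ᶠ N : ℕ in atTop, (∑ i ∈ Finset.range (N / k), Z i ω) / (N / k : ℕ) < a + δ :=
    (Nat.tendsto_div_const_atTop hk.ne').eventually (h1.eventually (gt_mem_nhds (by linarith)))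
  have h6 : ∀ᶠ N : ℕ in atTop, (1 + κ * k) / (c' - (a + 1 + δ) / k) < N :=
    tendsto_natCast_atTop_atTop.eventually (eventually_gt_atTop _)
  filter_upwards [h5, h6, eventually_ge_atTop k] with N h5 h6 h7
  have hq : 0 < N / k := Nat.div_pos h7 hk
  have hq' : (0 : ℝ) < (N / k : ℕ) := Nat.cast_pos.2 hq
  rw [div_lt_iff₀ hq'] at h5
  rw [div_lt_iff₀ (by linarith)] at h6
  have h8 : ((N / k : ℕ) : ℝ) ≤ N / k := Nat.cast_div_le
  have h9 : (a + 1 + δ) * (N / k : ℕ) ≤ (a + 1 + δ) / k * N := by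
    rw [div_mul_eq_mul_div, mul_div_assoc]
    exact mul_le_mul_of_nonneg_left h8 (by linarith)
  have h10 := h2 (N / k * k) (N % k)
  rw [Nat.div_add_mod'] at h10
  have h11 := h3 (N / k * k) (N % k)
  have h12 : κ * (N % k : ℕ) ≤ κ * k :=
    mul_le_mul_of_nonneg_left (Nat.cast_le.2 (Nat.mod_lt N hk).le) (by linarith [h.one_le])
  have h13 := hsum (N / k)
  linarith

/-- A zero-one law. By almost subadditivity, the event `lowSet` contains its preimages under the
restart maps `Φ m`; as these preserve the measure, it is almost surely equal to them. So it is
independent of the past at every time `m`, hence of itself. -/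
theorem measure_lowSet (h : IsAlmostSubadditive P 𝓕 D κ) (c' : ℝ) :
    P (lowSet D c') = 0 ∨ P (lowSet D c') = 1 := by
  obtain ⟨Φ, hΦ, hind, -, hsub⟩ := h.restart 1 one_pos
  have hA := h.measurableSet_lowSet c'
  have hsubset : ∀ m, (Φ m ⁻¹' lowSet D c' : Set Ω) ≤ᵐ[P] lowSet D c' := by
    intro m
    filter_upwards [hsub] with ω hω
    rintro ⟨q, hq, hfreq⟩
    obtain ⟨q', hqq', hq'⟩ := exists_rat_btwn hq
    refine ⟨q', hq', ?_⟩
    have hev : ∀ᶠ n : ℕ in atTop, (D m ω + 1 - q' * m) / (q' - q) < n :=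
      tendsto_natCast_atTop_atTop.eventually (eventually_gt_atTop _)
    refine (tendsto_add_atTop_nat m).frequently ((hfreq.and_eventually hev).mono ?_)
    rintro n ⟨h1, h2⟩
    rw [div_lt_iff₀ (by linarith)] at h2
    have := hω m n
    rw [add_comm n m]
    push_cast
    linarith
  have heq : ∀ m, (Φ m ⁻¹' lowSet D c' : Set Ω) =ᵐ[P] lowSet D c' := fun m =>
    ae_eq_of_ae_subset_of_measure_ge (hsubset m)
      ((hΦ m).measure_preimage hA.nullMeasurableSet).ge
      ((hΦ m).measurable hA).nullMeasurableSet (measure_ne_top _ _)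
  have hindep : Indep (⨆ m, 𝓕 m) (MeasurableSpace.generateFrom {lowSet D c'}) P := by
    refine indep_iSup_of_monotone (fun m => ?_) h.le
      (MeasurableSpace.generateFrom_le (by simpa using hA)) h.mono
    refine IndepSets.indep (h.le m) (MeasurableSpace.generateFrom_le (by simpa using hA))
      (@MeasurableSpace.isPiSystem_measurableSet _ (𝓕 m)) (IsPiSystem.singleton _)
      (@MeasurableSpace.generateFrom_measurableSet _ (𝓕 m)).symm rfl ?_
    rw [IndepSets_iff]
    rintro B _ hB rfl
    rw [← hind m B _ hB hA]
    exact measure_congr ((ae_eq_refl B).inter (heq m).symm)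
  have := (Indep_iff _ _ _).1 hindep _ _ (by rw [h.iSup_eq]; exact hA)
    (MeasurableSpace.measurableSet_generateFrom (Set.mem_singleton _))
  rw [Set.inter_self] at this
  by_cases h0 : P (lowSet D c') = 0
  · exact Or.inl h0
  · refine Or.inr ?_
    have h1 := (ENNReal.mul_eq_left h0 (measure_ne_top P _)).1 this.symm
    exact h1

/-- If the process is infinitely often below `c' n`, then it can be cut into blocks along which it
grows at most at rate `c'`, except for short blocks that start at few bad times; so the expectation
grows at most at a rate close to `c'`. -/
theorem lim_le_of_lowSet (h : IsAlmostSubadditive P 𝓕 D κ) {c' : ℝ} (hc0 : 0 ≤ c')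
    (hP : P (lowSet D c') = 1) : h.subadditive.lim ≤ c' := by
  by_contra! hc
  set c := h.subadditive.lim with hcdef
  have hκ := h.one_le
  obtain ⟨ε, hε, η, hη, hεη⟩ : ∃ ε > 0, ∃ η > 0, c' + ε + (κ + ε) * η < c := by
    refine ⟨(c - c') / 4, by linarith, (c - c') / 4 / (κ + (c - c') / 4),
      div_pos (by linarith) (by linarith), ?_⟩
    rw [mul_div_cancel₀ _ (by linarith)]
    linarith
  let E : ℕ → Set Ω := fun L => {ω | ∀ l : ℕ, 1 ≤ l → l ≤ L → ¬ D l ω ≤ c' * l}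
  have hE : ∀ L, MeasurableSet (E L) := by
    intro L
    have : E L = ⋂ (l : ℕ) (_ : 1 ≤ l) (_ : l ≤ L), {ω | D l ω ≤ c' * l}ᶜ := by
      ext ω; simp [E]
    rw [this]
    exact MeasurableSet.iInter fun l => MeasurableSet.iInter fun _ => MeasurableSet.iInter fun _ =>
      (measurableSet_le (h.measurable l) measurable_const).compl
  have hEanti : Antitone E := fun L L' hLL' ω hω l h1 h2 => hω l h1 (h2.trans hLL')
  have hEinter : P (⋂ L, E L) = 0 := by
    refine measure_mono_null (t := (lowSet D c')ᶜ) (fun ω hω => ?_) ?_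
    · rintro ⟨q, hq, hfreq⟩
      obtain ⟨n, hn, hn'⟩ := (hfreq.and_eventually (eventually_ge_atTop 1)).exists
      refine Set.mem_iInter.1 hω n n hn' le_rfl (hn.trans ?_)
      exact mul_le_mul_of_nonneg_right hq.le (Nat.cast_nonneg n)
    · rw [prob_compl_eq_zero_iff (h.measurableSet_lowSet c')]
      exact hP
  obtain ⟨L, hL⟩ : ∃ L, P (E L) < ENNReal.ofReal η := by
    have ht := tendsto_measure_iInter_atTop (μ := P) (fun L => (hE L).nullMeasurableSet) hEanti
      ⟨0, measure_ne_top _ _⟩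
    rw [hEinter] at ht
    exact (ht.eventually (gt_mem_nhds (ENNReal.ofReal_pos.2 hη))).exists
  have hL' : P.real (E L) < η := by
    rw [measureReal_def]
    exact (ENNReal.toReal_lt_of_lt_ofReal hL)
  obtain ⟨Φ, hΦ, -, -, hsub⟩ := h.restart ε hε
  classical
  let bad : ℕ → Ω → ℝ := fun i ω => (E L).indicator (fun _ => (1 : ℝ)) (Φ i ω)
  have hbad0 : ∀ i ω, 0 ≤ bad i ω := fun i ω => Set.indicator_nonneg (fun _ _ => zero_le_one) _
  have hbd : ∀ᵐ ω ∂P, ∀ m n : ℕ, D n (Φ m ω) ≤ κ * n := by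
    rw [ae_all_iff]
    intro m
    filter_upwards [(hΦ m).quasiMeasurePreserving.ae h.bounds] with ω hω n
    exact (hω n).2
  have hdet : ∀ᵐ ω ∂P, ∀ n : ℕ, D n ω ≤ (c' + ε) * n +
      (κ + ε) * ∑ i ∈ Finset.range n, bad i ω + (κ * L + ε) := by
    filter_upwards [hsub, hbd, h.bounds] with ω h1 h2 h3 n
    -- Cut `[m, m + d)` from the left: from a time outside `bad` there is a block of length at most
    -- `L` on which the growth rate is at most `c'`, and a time in `bad` is a block of length one,
    -- which costs at most `κ + ε`. A last piece of length at most `L` remains.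
    have key : ∀ d m : ℕ, D (m + d) ω ≤ D m ω + (c' + ε) * d +
        (κ + ε) * ∑ i ∈ Finset.Ico m (m + d), bad i ω + (κ * L + ε) := by
      intro d
      induction d using Nat.strong_induction_on with
      | _ d ih =>
        intro m
        have hsum0 : 0 ≤ (κ + ε) * ∑ i ∈ Finset.Ico m (m + d), bad i ω :=
          mul_nonneg (by linarith) (Finset.sum_nonneg fun i _ => hbad0 i ω)
        by_cases hd : d ≤ L
        · have h4 := h1 m d
          have h5 := h2 m d
          have h6 : κ * (d : ℝ) ≤ κ * L :=
            mul_le_mul_of_nonneg_left (Nat.cast_le.2 hd) (by linarith)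
          have h7 : 0 ≤ (c' + ε) * d := mul_nonneg (by linarith) (Nat.cast_nonneg d)
          linarith
        by_cases hb : Φ m ω ∈ E L
        · obtain ⟨d, rfl⟩ : ∃ d', d = d' + 1 := ⟨d - 1, by omega⟩
          have h4 := h1 m 1
          have h5 := h2 m 1
          have h6 := ih d (by omega) (m + 1)
          have h7 : bad m ω = 1 := Set.indicator_of_mem hb _
          rw [show m + (d + 1) = m + 1 + d by ring] at *
          rw [Finset.sum_eq_sum_Ico_succ_bot (by omega), h7]
          push_cast at *
          nlinarith
        · simp only [E, Set.mem_ofPred_eq, not_forall, not_not] at hb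
          obtain ⟨l, hl1, hlL, hl⟩ := hb
          obtain ⟨d, rfl⟩ : ∃ d', d = l + d' := ⟨d - l, by omega⟩
          have h4 := h1 m l
          have h6 := ih d (by omega) (m + l)
          rw [← add_assoc]
          have h7 : ∑ i ∈ Finset.Ico (m + l) (m + l + d), bad i ω ≤
              ∑ i ∈ Finset.Ico m (m + l + d), bad i ω :=
            Finset.sum_le_sum_of_subset_of_nonneg
              (Finset.Ico_subset_Ico_left (by omega)) fun i _ _ => hbad0 i ω
          have h8 := mul_le_mul_of_nonneg_left h7 (show 0 ≤ κ + ε by linarith)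
          have h9 : ε * 1 ≤ ε * l := mul_le_mul_of_nonneg_left (by exact_mod_cast hl1) hε.le
          push_cast
          linarith
    have := key n 0
    have h0 := (h3 0).2
    simp only [Nat.cast_zero, mul_zero] at h0
    simp only [zero_add, ← Finset.range_eq_Ico] at this
    linarith
  have hint : ∀ i, Integrable (bad i) P ∧ ∫ ω, bad i ω ∂P = P.real (E L) := by
    intro i
    have e : bad i = (Φ i ⁻¹' E L).indicator fun _ => 1 := rfl
    have hm := (hΦ i).measurable (hE L)
    rw [e]
    refine ⟨(integrable_const 1).indicator hm, ?_⟩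
    rw [integral_indicator_const _ hm, measureReal_def, measureReal_def,
      (hΦ i).measure_preimage (hE L).nullMeasurableSet]
    simp
  have hmain : ∀ n : ℕ, 0 < n → c * n ≤ (c' + ε + (κ + ε) * P.real (E L)) * n + (κ * L + ε) := by
    intro n hn
    have h1 : c * n ≤ ∫ ω, D n ω ∂P := by
      have := h.subadditive.lim_le_div h.bddBelow hn.ne'
      rwa [le_div_iff₀ (Nat.cast_pos.2 hn)] at this
    have hs : Integrable (fun ω => ∑ i ∈ Finset.range n, bad i ω) P :=
      integrable_finsetSum _ fun i _ => (hint i).1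
    have h2 := integral_mono_ae (h.integrable n)
      (((integrable_const ((c' + ε) * n)).add (hs.const_mul (κ + ε))).add
        (integrable_const (κ * L + ε))) (hdet.mono fun ω hω => hω n)
    rw [integral_add' ((integrable_const _).add (hs.const_mul _)) (integrable_const _),
      integral_add' (integrable_const _) (hs.const_mul _),
      integral_const_mul (κ + ε) fun ω => ∑ i ∈ Finset.range n, bad i ω,
      show (∫ ω, ∑ i ∈ Finset.range n, bad i ω ∂P) = n * P.real (E L) by
        rw [integral_finsetSum _ fun i _ => (hint i).1]
        simp [(hint _).2]] at h2
    simp only [integral_const, probReal_univ, one_smul] at h2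
    calc c * n ≤ _ := h1
      _ ≤ _ := h2
      _ = _ := by ring
  have hgap : 0 < c - (c' + ε + (κ + ε) * P.real (E L)) := by
    have : (κ + ε) * P.real (E L) ≤ (κ + ε) * η :=
      mul_le_mul_of_nonneg_left hL'.le (by linarith)
    linarith
  obtain ⟨n, hn⟩ := exists_nat_gt ((κ * L + ε) / (c - (c' + ε + (κ + ε) * P.real (E L))))
  rw [div_lt_iff₀ hgap] at hn
  have := hmain (n + 1) (Nat.succ_pos n)
  push_cast at this
  nlinarith

/-- The almost subadditive ergodic theorem: the upper bound comes from the law of large numbers on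
long blocks, and the lower bound from the zero-one law for `lowSet`. -/
theorem tendsto_div (h : IsAlmostSubadditive P 𝓕 D κ) :
    ∀ᵐ ω ∂P, Tendsto (fun n : ℕ => D n ω / n) atTop (𝓝 h.subadditive.lim) := by
  set c := h.subadditive.lim with hc
  have hlow : ∀ᵐ ω ∂P, ∀ q : ℚ, (0 : ℝ) ≤ q → (q : ℝ) < c → ω ∉ lowSet D q := by
    rw [ae_all_iff]
    intro q
    by_cases hq : (0 : ℝ) ≤ q ∧ (q : ℝ) < c
    · have h0 : P (lowSet D q) = 0 := by
        rcases h.measure_lowSet q with h1 | h1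
        · exact h1
        · exact absurd (h.lim_le_of_lowSet hq.1 h1) (not_le.2 hq.2)
      filter_upwards [measure_eq_zero_iff_ae_notMem.1 h0] with ω hω _ _
      exact hω
    · exact ae_of_all _ fun ω h1 h2 => absurd ⟨h1, h2⟩ hq
  have hup : ∀ᵐ ω ∂P, ∀ k : ℕ, 0 < k → ∀ c' : ℝ, (∫ ω, D k ω ∂P + 1) / k < c' →
      ∀ᶠ N : ℕ in atTop, D N ω < c' * N := by
    rw [ae_all_iff]
    intro k
    by_cases hk : 0 < k
    · filter_upwards [h.eventually_lt_of_block hk] with ω hω _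
      exact hω
    · exact ae_of_all _ fun ω h1 => absurd h1 hk
  have hlim : Tendsto (fun k : ℕ => (∫ ω, D k ω ∂P + 1) / k) atTop (𝓝 c) := by
    have := (h.subadditive.tendsto_lim h.bddBelow).add
      (tendsto_const_div_atTop_nhds_zero_nat (1 : ℝ))
    simpa only [add_zero, ← add_div] using this
  filter_upwards [hlow, hup] with ω h1 h2
  refine tendsto_order.2 ⟨fun b hb => ?_, fun b hb => ?_⟩
  · have hc1 := h.lim_mem.1
    obtain ⟨q, hq1, hq2⟩ := exists_rat_btwn (show max b 0 < c from max_lt hb (by linarith))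
    obtain ⟨q', hq1', hq2'⟩ := exists_rat_btwn hq2
    have h3 := h1 q' (by linarith [le_max_right b 0]) hq2'
    have h4 : ¬ ∃ᶠ n : ℕ in atTop, D n ω ≤ q * n := fun h => h3 ⟨q, hq1', h⟩
    rw [not_frequently] at h4
    filter_upwards [h4, eventually_gt_atTop 0] with n hn hn0
    rw [lt_div_iff₀ (Nat.cast_pos.2 hn0)]
    have : b * n ≤ q * n :=
      mul_le_mul_of_nonneg_right ((le_max_left b 0).trans hq1.le) (Nat.cast_nonneg n)
    linarith
  · obtain ⟨k, hk, hk0⟩ := ((hlim.eventually (gt_mem_nhds hb)).and (eventually_gt_atTop 0)).exists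
    filter_upwards [h2 k hk0 b hk, eventually_gt_atTop 0] with n hn hn0
    rwa [div_lt_iff₀ (Nat.cast_pos.2 hn0)]

end IsAlmostSubadditive

/-! ### Convergence in an environment of independent slots -/

namespace LHPQ

section Canonical

variable {μ : Measure (Mark × (ℕ → ℝ))} [IsProbabilityMeasure μ] {κ : ℝ}

theorem ae_weights_mem (hμ : ∀ k, μ {y | y.2 k ∉ Set.Icc 1 κ} = 0) :
    ∀ᵐ W ∂envLaw μ, ∀ p k, (W p).2 k ∈ Set.Icc 1 κ := by
  simp only [ae_all_iff]
  intro p k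
  have h : ∀ᵐ y ∂(envLaw μ).map (fun W => W p), y.2 k ∈ Set.Icc 1 κ := by
    rw [map_eval_envLaw]
    exact hμ k
  exact ae_of_ae_map (measurable_pi_apply p).aemeasurable h

theorem lineDist_bounds {W : Env} (hW : ∀ p k, (W p).2 k ∈ Set.Icc 1 κ) (n : ℕ) :
    lineDist n W ≠ ⊤ ∧ n ≤ (lineDist n W).toReal ∧ (lineDist n W).toReal ≤ κ * n := by
  have hκ : 0 ≤ κ := by
    have := hW (0, 0) 0
    linarith [this.1, this.2]
  have h1 := le_lineDist n W fun p k => (hW p k).1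
  have h2 := lineDist_le n W fun p k => (hW p k).2
  have h3 : (n : ℝ≥0∞) * ENNReal.ofReal κ ≠ ⊤ :=
    ENNReal.mul_ne_top (ENNReal.natCast_ne_top n) ENNReal.ofReal_ne_top
  have h4 := ne_top_of_le_ne_top h3 h2
  refine ⟨h4, by simpa using ENNReal.toReal_mono h4 h1, ?_⟩
  have := ENNReal.toReal_mono h3 h2
  rwa [ENNReal.toReal_mul, ENNReal.toReal_natCast, ENNReal.toReal_ofReal hκ, mul_comm] at this

/-- The distances to the lines form an almost subadditive process: from an almost closest point of
the line at height `-m`, the map below this line looks like a fresh copy of the whole map. -/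
theorem isAlmostSubadditive_lineDist (hμ : ∀ k, μ {y | y.2 k ∉ Set.Icc 1 κ} = 0) :
    IsAlmostSubadditive (envLaw μ) past (fun n W => (lineDist n W).toReal) κ where
  mono := past_mono
  le := past_le
  iSup_eq := iSup_past
  measurable n := (measurable_lineDist fun p _ => measurable_pi_apply p).ennreal_toReal
  bounds := (ae_weights_mem hμ).mono fun W hW n => (lineDist_bounds hW n).2
  restart ε hε := by
    have hε' : ENNReal.ofReal ε ≠ 0 := (ENNReal.ofReal_pos.2 hε).ne'
    have hx : ∀ m : ℕ, ∃ x : Env → ℤ, Measurable[past m] x ∧ ∀ W,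
        (⨅ j, siteDist (Set.Iio m) W (0, 0) (j, m)) ≠ ⊤ →
        siteDist (Set.Iio m) W (0, 0) (x W, m) ≤
          (⨅ j, siteDist (Set.Iio m) W (0, 0) (j, m)) + ENNReal.ofReal ε := fun m =>
      @exists_measurable_approx_min _ (past m) (fun j W => siteDist (Set.Iio m) W (0, 0) (j, m))
        (fun j => @measurable_siteDist _ (past m) (fun W => W) (Set.Iio m)
          (fun p hp => measurable_past_eval hp) _ _) _ hε'
    choose x hxm hx using hx
    have hxm' : ∀ m, Measurable (x m) := fun m s hs => past_le m _ (hxm m hs)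
    have hΦm : ∀ m, Measurable fun W : Env => shift m (x m W) W := fun m =>
      measurable_pi_iff.2 fun p => measurable_shift (hxm' m) fun q _ _ => measurable_pi_apply q
    have hind : ∀ m B A, MeasurableSet[past m] B → MeasurableSet A →
        envLaw μ (B ∩ (fun W => shift m (x m W) W) ⁻¹' A) = envLaw μ B * envLaw μ A :=
      fun m B A hB hA => envLaw_inter_shift μ (hxm m) hB hA
    have hpres : ∀ m, MeasurePreserving (fun W : Env => shift m (x m W) W)
        (envLaw μ) (envLaw μ) := by
      refine fun m => ⟨hΦm m, Measure.ext fun A hA => ?_⟩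
      have := hind m Set.univ A MeasurableSet.univ hA
      rwa [Set.univ_inter, measure_univ, one_mul, ← Measure.map_apply (hΦm m) hA] at this
    refine ⟨fun m W => shift m (x m W) W, hpres, hind, fun m n => ?_, ?_⟩
    · have h1 : Measurable[past (m + n)] fun W => lineDist n (shift m (x m W) W) :=
        @measurable_lineDist _ (past (m + n)) (fun W => shift m (x m W) W) n fun p hp =>
          @measurable_shift _ (past (m + n)) (fun W => W) m (x m)
            (fun s hs => past_mono (Nat.le_add_right m n) _ (hxm m hs)) p
            fun q _ hq => measurable_past_eval (by omega)
      exact ENNReal.measurable_toReal.comp h1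
    · have hfin : ∀ᵐ W ∂envLaw μ, ∀ m n : ℕ, lineDist n (shift m (x m W) W) ≠ ⊤ := by
        rw [ae_all_iff]
        intro m
        filter_upwards [(hpres m).quasiMeasurePreserving.ae (ae_weights_mem hμ)] with W hW n
        exact (lineDist_bounds hW n).1
      filter_upwards [hfin, ae_weights_mem hμ] with W h1 h2 m n
      have h3 := (lineDist_bounds h2 m).1
      have h4 := hx m W (by rwa [← lineDist_eq])
      rw [← lineDist_eq] at h4
      have h5 : lineDist (m + n) W ≤
          lineDist m W + ENNReal.ofReal ε + lineDist n (shift m (x m W) W) :=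
        (lineDist_add_le m n (x m W) W).trans (by gcongr)
      have h6 := ENNReal.toReal_mono (by simp [h3, h1 m n]) h5
      rwa [ENNReal.toReal_add (by simp [h3]) (h1 m n), ENNReal.toReal_add h3 (by simp),
        ENNReal.toReal_ofReal hε.le] at h6

/-- The limit theorem for an environment of independent slots. -/
theorem exists_tendsto_lineDist (hμ : ∀ k, μ {y | y.2 k ∉ Set.Icc 1 κ} = 0) :
    ∃ c ∈ Set.Icc 1 κ, ∀ᵐ W ∂envLaw μ,
      Tendsto (fun n : ℕ => lineDist n W / (n : ℝ≥0∞)) atTop (𝓝 (ENNReal.ofReal c)) := by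
  have h := isAlmostSubadditive_lineDist hμ
  refine ⟨_, h.lim_mem, ?_⟩
  filter_upwards [h.tendsto_div, ae_weights_mem hμ] with W h1 h2
  refine ((ENNReal.continuous_ofReal.tendsto _).comp h1).congr' ?_
  filter_upwards [eventually_gt_atTop 0] with n hn
  simp only [Function.comp_apply]
  rw [ENNReal.ofReal_div_of_pos (Nat.cast_pos.2 hn), ENNReal.ofReal_toReal (lineDist_bounds h2 n).1,
    ENNReal.ofReal_natCast]

end Canonical

end LHPQ

/-! ### The skeleton -/

/-- If infinitely many individuals on both sides have children, every child has a parent. -/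
theorem exists_leftEnd_le_lt {c : ℤ → ℕ} (hr : ∀ k, ∃ i ≥ k, c i ≠ 0)
    (hl : ∀ k, ∃ i < k, c i ≠ 0) (j : ℤ) : ∃ i, leftEnd c i ≤ j ∧ j < leftEnd c (i + 1) := by
  have hup : ∀ n : ℕ, ∃ i, (n : ℤ) ≤ leftEnd c i := by
    intro n
    induction n with
    | zero => exact ⟨0, by simp [leftEnd_zero]⟩
    | succ n ih =>
      obtain ⟨i, hi⟩ := ih
      obtain ⟨i', hi', h⟩ := hr i
      refine ⟨i' + 1, ?_⟩
      have := leftEnd_mono c hi'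
      rw [leftEnd_add_one]
      omega
  have hdown : ∀ n : ℕ, ∃ i, leftEnd c i ≤ -(n : ℤ) := by
    intro n
    induction n with
    | zero => exact ⟨0, by simp [leftEnd_zero]⟩
    | succ n ih =>
      obtain ⟨i, hi⟩ := ih
      obtain ⟨i', hi', h⟩ := hl i
      refine ⟨i', ?_⟩
      have := leftEnd_mono c (show i' + 1 ≤ i by omega)
      rw [leftEnd_add_one] at this
      omega
  obtain ⟨b, hb⟩ := hup (j.toNat + 1)
  obtain ⟨a, ha⟩ := hdown (-j).toNat
  obtain ⟨i, hi, hmax⟩ := Int.exists_greatest_of_bdd (P := fun i => leftEnd c i ≤ j)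
    ⟨b, fun z hz => by
      by_contra h
      have := leftEnd_mono c (not_le.1 h).le
      omega⟩ ⟨a, by omega⟩
  refine ⟨i, hi, ?_⟩
  by_contra h
  have := hmax (i + 1) (not_lt.1 h)
  omega

theorem leftEnd_unique {c : ℤ → ℕ} {i i' j : ℤ} (h : leftEnd c i ≤ j ∧ j < leftEnd c (i + 1))
    (h' : leftEnd c i' ≤ j ∧ j < leftEnd c (i' + 1)) : i = i' := by
  by_contra hne
  rcases lt_or_gt_of_ne hne with hlt | hlt
  · have := leftEnd_mono c (show i + 1 ≤ i' by omega)
    omega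
  · have := leftEnd_mono c (show i' + 1 ≤ i by omega)
    omega

theorem individual_zero (N : Individual → ℕ) (j : ℤ) : individual N 0 j = (j, []) := by
  simp [individual]

theorem individual_succ {N : Individual → ℕ} {r : ℕ} {i j : ℤ}
    (h : leftEnd (fun i => N (individual N r i)) i ≤ j ∧
      j < leftEnd (fun i => N (individual N r i)) (i + 1)) :
    individual N (r + 1) j = ((individual N r i).1, (individual N r i).2 ++
      [(j - leftEnd (fun i => N (individual N r i)) i).toNat]) := by
  have hex : ∃ i, leftEnd (fun i => N (individual N r i)) i ≤ j ∧
      j < leftEnd (fun i => N (individual N r i)) (i + 1) := ⟨i, h⟩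
  rw [individual]
  exact (dif_pos hex).trans (by rw [leftEnd_unique hex.choose_spec h])

theorem individual_succ_of_not {N : Individual → ℕ} {r : ℕ} {j : ℤ}
    (h : ¬ ∃ i, leftEnd (fun i => N (individual N r i)) i ≤ j ∧
      j < leftEnd (fun i => N (individual N r i)) (i + 1)) :
    individual N (r + 1) j = (j, []) := by
  rw [individual]
  exact dif_neg h

theorem length_individual_le (N : Individual → ℕ) (r : ℕ) (j : ℤ) :
    (individual N r j).2.length ≤ r := by
  induction r generalizing j with
  | zero => simp [individual_zero]
  | succ r ih =>
    by_cases h : ∃ i, leftEnd (fun i => N (individual N r i)) i ≤ j ∧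
      j < leftEnd (fun i => N (individual N r i)) (i + 1)
    · obtain ⟨i, hi⟩ := h
      rw [individual_succ hi]
      simpa using ih i
    · rw [individual_succ_of_not h]
      simp

/-- The embedding at the height `-r` is faithful: the individuals found there are of generation `r`,
so that the default case of `individual` does not occur, and they are distinct. -/
def GoodLevel (N : Individual → ℕ) (r : ℕ) : Prop :=
  (∀ j, (individual N r j).2.length = r) ∧ Function.Injective (individual N r)

theorem goodLevel_zero (N : Individual → ℕ) : GoodLevel N 0 := by
  refine ⟨fun j => by simp [individual_zero], fun i j h => ?_⟩
  simpa [individual_zero] using h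

theorem GoodLevel.succ {N : Individual → ℕ} {r : ℕ} (h : GoodLevel N r)
    (hr : ∀ k, ∃ i ≥ k, N (individual N r i) ≠ 0) (hl : ∀ k, ∃ i < k, N (individual N r i) ≠ 0) :
    GoodLevel N (r + 1) := by
  have hex := exists_leftEnd_le_lt (c := fun i => N (individual N r i)) hr hl
  refine ⟨fun j => ?_, fun j j' hjj' => ?_⟩
  · obtain ⟨i, hi⟩ := hex j
    rw [individual_succ hi]
    simp [h.1 i]
  · obtain ⟨i, hi⟩ := hex j
    obtain ⟨i', hi'⟩ := hex j'
    rw [individual_succ hi, individual_succ hi', Prod.mk.injEq] at hjj'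
    obtain ⟨h1, h2⟩ := hjj'
    obtain ⟨h2, h3⟩ := List.append_inj' h2 rfl
    have : i = i' := h.2 (Prod.ext h1 h2)
    subst this
    simp only [List.cons.injEq, and_true] at h3
    omega

namespace LHPQ

/-- The σ-algebra generated by the marks of the individuals of the generations before `r`. -/
@[reducible] def generations (r : ℕ) : MeasurableSpace Marks :=
  sigmaOf (fun (v : Individual) (x : Marks) => x v) {v | v.2.length < r}

/-- Which individual is embedded at a given place at the height `-r` only depends on the marks of the
generations before `r`. -/
theorem measurableSet_individual (r : ℕ) (j : ℤ) (v : Individual) :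
    MeasurableSet[generations r] {x : Marks | individual (fun v => (x v).1) r j = v} := by
  induction r generalizing j v with
  | zero =>
    simp only [individual_zero]
    exact MeasurableSet.const _
  | succ r ih =>
    have hmono : generations r ≤ generations (r + 1) :=
      sigmaOf_mono fun v hv => Nat.lt_succ_of_lt hv
    have hc : ∀ i, Measurable[generations (r + 1)]
        fun x : Marks => (x (individual (fun v => (x v).1) r i)).1 := by
      intro i
      refine @measurable_to_countable' _ _ _ _ (generations (r + 1)) _ fun n => ?_
      have : (fun x : Marks => (x (individual (fun v => (x v).1) r i)).1) ⁻¹' {n} =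
          ⋃ v ∈ {v : Individual | v.2.length < r + 1},
            ({x : Marks | individual (fun v => (x v).1) r i = v} ∩ {x | (x v).1 = n}) := by
        ext x
        simp only [Set.mem_preimage, Set.mem_singleton_iff, Set.mem_iUnion, Set.mem_inter_iff,
          Set.mem_ofPred_eq, exists_prop]
        constructor
        · exact fun h => ⟨_, Nat.lt_succ_of_le (length_individual_le _ r i), rfl, h⟩
        · rintro ⟨v, -, rfl, h⟩
          exact h
      rw [this]
      refine MeasurableSet.biUnion (Set.to_countable _) fun v hv =>
        MeasurableSet.inter (hmono _ (ih i v)) ?_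
      have h1 := measurable_sigmaOf (Z := fun (v : Individual) (x : Marks) => x v) hv
      exact (measurable_fst.comp h1) (measurableSet_singleton n)
    have hL : ∀ i l, MeasurableSet[generations (r + 1)] {x : Marks |
        leftEnd (fun i => (x (individual (fun v => (x v).1) r i)).1) i = l} := fun i l =>
      @measurable_leftEnd _ (generations (r + 1)) _ hc i _ (measurableSet_singleton l)
    have hA : ∀ i, MeasurableSet[generations (r + 1)] {x : Marks |
        leftEnd (fun i => (x (individual (fun v => (x v).1) r i)).1) i ≤ j ∧
        j < leftEnd (fun i => (x (individual (fun v => (x v).1) r i)).1) (i + 1)} := fun i =>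
      MeasurableSet.inter
        (@measurable_leftEnd _ (generations (r + 1)) _ hc i _ (measurableSet_Iic (a := j)))
        (@measurable_leftEnd _ (generations (r + 1)) _ hc (i + 1) _ (measurableSet_Ioi (a := j)))
    have hB : MeasurableSet[generations (r + 1)] {x : Marks | (j, []) = v ∧ ¬ ∃ i,
        leftEnd (fun i => (x (individual (fun v => (x v).1) r i)).1) i ≤ j ∧
        j < leftEnd (fun i => (x (individual (fun v => (x v).1) r i)).1) (i + 1)} := by
      refine MeasurableSet.inter (MeasurableSet.const _) (MeasurableSet.compl ?_)
      have := MeasurableSet.iUnion hA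
      rwa [← Set.ofPred_exists] at this
    have hU : {x : Marks | individual (fun v => (x v).1) (r + 1) j = v} =
        (⋃ (i : ℤ) (w : Individual) (l : ℤ), {x | (w.1, w.2 ++ [(j - l).toNat]) = v} ∩
          ({x | leftEnd (fun i => (x (individual (fun v => (x v).1) r i)).1) i ≤ j ∧
          j < leftEnd (fun i => (x (individual (fun v => (x v).1) r i)).1) (i + 1)} ∩
          ({x : Marks | individual (fun v => (x v).1) r i = w} ∩
          {x | leftEnd (fun i => (x (individual (fun v => (x v).1) r i)).1) i = l}))) ∪
        {x : Marks | (j, []) = v ∧ ¬ ∃ i,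
        leftEnd (fun i => (x (individual (fun v => (x v).1) r i)).1) i ≤ j ∧
        j < leftEnd (fun i => (x (individual (fun v => (x v).1) r i)).1) (i + 1)} := by
      ext x
      simp only [Set.mem_union, Set.mem_iUnion, Set.mem_inter_iff, Set.mem_ofPred_eq]
      by_cases h : ∃ i, leftEnd (fun i => (x (individual (fun v => (x v).1) r i)).1) i ≤ j ∧
          j < leftEnd (fun i => (x (individual (fun v => (x v).1) r i)).1) (i + 1)
      · obtain ⟨i, hi⟩ := h
        rw [individual_succ (N := fun v => (x v).1) hi]
        constructor
        · exact fun h => Or.inl ⟨i, _, _, h, hi, rfl, rfl⟩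
        · rintro (⟨i', w, l, h1, h2, rfl, rfl⟩ | ⟨-, h⟩)
          · rw [← h1, leftEnd_unique h2 hi]
          · exact absurd ⟨i, hi⟩ h
      · rw [individual_succ_of_not (N := fun v => (x v).1) h]
        constructor
        · exact fun h' => Or.inr ⟨h', h⟩
        · rintro (⟨i', w, l, h1, h2, -⟩ | ⟨h', -⟩)
          · exact absurd ⟨i', h2⟩ h
          · exact h'
    rw [hU]
    refine MeasurableSet.union (MeasurableSet.iUnion fun i => MeasurableSet.iUnion fun w =>
      MeasurableSet.iUnion fun l => ?_) hB
    exact MeasurableSet.inter (MeasurableSet.const _) ((hA i).inter ((hmono _ (ih i w)).inter (hL i l)))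

/-- The marks of the horizontal edges. -/
noncomputable def siteMarks (x : Marks) (p : Site) : Mark := x (ind x p)

theorem measurable_siteMarks : Measurable siteMarks := by
  refine measurable_pi_iff.2 fun p => ?_
  intro s hs
  have : (fun x => siteMarks x p) ⁻¹' s =
      ⋃ v, ({x : Marks | individual (fun v => (x v).1) p.2 p.1 = v} ∩ {x | x v ∈ s}) := by
    ext x
    simp [siteMarks, ind]
  rw [this]
  exact MeasurableSet.iUnion fun v => MeasurableSet.inter
    (sigmaOf_le (fun v => measurable_pi_apply v) _ _ (measurableSet_individual p.2 p.1 v))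
    (measurable_pi_apply v hs)

/-- The law of the marks of all individuals of the forest. -/
noncomputable def forestLaw [IsProbabilityMeasure markLaw] : Measure Marks :=
  Measure.infinitePi fun _ : Individual => markLaw

section Forest

variable [IsProbabilityMeasure markLaw]

instance : IsProbabilityMeasure forestLaw := by unfold forestLaw; infer_instance

theorem map_eval_forestLaw (v : Individual) : forestLaw.map (fun x => x v) = markLaw :=
  Measure.infinitePi_map_eval (fun _ : Individual => markLaw) v

theorem iIndepFun_eval_forestLaw :
    iIndepFun (fun (v : Individual) (x : Marks) => x v) forestLaw := by
  rw [iIndepFun_iff_map_fun_eq_infinitePi_map (fun p => measurable_pi_apply p)]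
  simp only [map_eval_forestLaw]
  exact Measure.map_id

/-- At faithful heights, the marks of the horizontal edges are independent with law `markLaw`,
since the place where an individual is embedded is determined by the previous generations. -/
theorem forestLaw_siteMarks {J₀ : Set Site}
    (h : ∀ p ∈ J₀, ∀ᵐ x ∂forestLaw, GoodLevel (fun v => (x v).1) p.2) (s : Finset Site)
    (hs : ∀ p ∈ s, p ∈ J₀) {A : Site → Set Mark} (hA : ∀ p, MeasurableSet (A p)) :
    forestLaw (⋂ p ∈ s, {x | siteMarks x p ∈ A p}) = ∏ p ∈ s, markLaw (A p) := by
  have := measure_inter_relabel (P := forestLaw) (Z := fun (v : Individual) (x : Marks) => x v)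
    (J₀ := J₀) (deg := fun v => v.2.length) (lev := fun p : Site => p.2)
    (τ := fun p x => ind x p) (fun p => measurable_pi_apply p) iIndepFun_eval_forestLaw
    map_eval_forestLaw (fun p _ v => measurableSet_individual p.2 p.1 v)
    (fun p hp => (h p hp).mono fun x hx => hx.1 p.1) ?_ (m := 0) (fun _ _ => Nat.zero_le _)
    MeasurableSet.univ s hs hA
  · rwa [Set.univ_inter, measure_univ, one_mul] at this
  · rintro ⟨i, r⟩ hp ⟨i', r'⟩ - hne hlev
    filter_upwards [h _ hp] with x hx heq
    obtain rfl : r = r' := hlev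
    exact hne (congrArg (·, r) (hx.2 heq))

/-- Along any sequence of distinct individuals of a generation, some individual has children: the
probability that the first `n` have none is `q ^ n` with `q < 1`. -/
theorem ae_exists_offspring {r : ℕ} (h : ∀ᵐ x ∂forestLaw, GoodLevel (fun v => (x v).1) r)
    {f : ℕ → ℤ} (hf : Function.Injective f) :
    ∀ᵐ x ∂forestLaw, ∃ n, (siteMarks x (f n, r)).1 ≠ 0 := by
  set q := markLaw {y | y.1 = 0} with hq
  have hq1 : q < 1 := by
    refine lt_of_le_of_ne prob_le_one fun hq1 => markLaw_fst_ne_zero ?_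
    have := (prob_compl_eq_zero_iff (μ := markLaw) (s := {y | y.1 = 0})
      (MeasurableSet.of_discrete)).2 hq1
    exact this
  have hle : ∀ n : ℕ, forestLaw {x | ∀ n, (siteMarks x (f n, r)).1 = 0} ≤ q ^ n := by
    intro n
    let g : ℕ ↪ Site := ⟨fun n => (f n, r), fun a b h => hf (congrArg Prod.fst h)⟩
    have := forestLaw_siteMarks (J₀ := {p | p.2 = r}) (fun p hp => by
      rw [Set.mem_ofPred_eq] at hp; rwa [hp]) ((Finset.range n).map g)
      (fun p hp => by
        obtain ⟨k, -, rfl⟩ := Finset.mem_map.1 hp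
        exact rfl)
      (A := fun _ => {y | y.1 = 0}) fun _ => MeasurableSet.of_discrete
    rw [Finset.prod_const, Finset.card_map, Finset.card_range] at this
    rw [← this]
    refine measure_mono fun x hx => ?_
    simp only [Set.mem_iInter, Finset.mem_map]
    rintro _ ⟨k, -, rfl⟩
    exact hx k
  rw [ae_iff]
  push Not
  exact le_antisymm (ge_of_tendsto' (ENNReal.tendsto_pow_atTop_nhds_zero_of_lt_one hq1) hle)
    zero_le

/-- Almost surely, all heights are faithful: if the height `-r` is, then the marks on it are
independent, so infinitely many individuals on both sides have children and every child has a
parent. -/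
theorem ae_goodLevel (r : ℕ) : ∀ᵐ x ∂forestLaw, GoodLevel (fun v => (x v).1) r := by
  induction r with
  | zero => exact ae_of_all _ fun x => goodLevel_zero _
  | succ r ih =>
    have h1 : ∀ᵐ x ∂forestLaw, ∀ k : ℤ, ∃ n : ℕ, (siteMarks x (k + n, r)).1 ≠ 0 :=
      ae_all_iff.2 fun k => ae_exists_offspring ih fun a b h => by simpa using h
    have h2 : ∀ᵐ x ∂forestLaw, ∀ k : ℤ, ∃ n : ℕ, (siteMarks x (k - 1 - n, r)).1 ≠ 0 :=
      ae_all_iff.2 fun k => ae_exists_offspring ih fun a b h => by simpa using h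
    filter_upwards [ih, h1, h2] with x h0 h1 h2
    refine h0.succ (fun k => ?_) fun k => ?_
    · obtain ⟨n, hn⟩ := h1 k
      exact ⟨k + n, by simp, hn⟩
    · obtain ⟨n, hn⟩ := h2 k
      exact ⟨k - 1 - n, by omega, hn⟩

/-- The marks of the horizontal edges are independent. -/
theorem map_siteMarks :
    forestLaw.map siteMarks = Measure.infinitePi fun _ : Site => markLaw := by
  refine Measure.eq_infinitePi _ fun s A hA => ?_
  rw [Measure.map_apply measurable_siteMarks (MeasurableSet.pi s.countable_toSet fun i _ => hA i),
    ← forestLaw_siteMarks (J₀ := Set.univ) (fun p _ => ae_goodLevel p.2) s (by simp) hA]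
  congr 1
  ext x
  simp [Set.mem_pi]

end Forest

end LHPQ

/-! ### The law of the environment of a model -/

/-- Pairing two independent families of independent variables. -/
theorem iIndepFun_prodMk {Ω ι A B : Type*} [MeasurableSpace Ω] [MeasurableSpace A]
    [MeasurableSpace B] {P : Measure Ω} {Y : ι → Ω → A} {U : ι → Ω → B}
    (hY : ∀ i, Measurable (Y i)) (hU : ∀ i, Measurable (U i)) (hYi : iIndepFun Y P)
    (hUi : iIndepFun U P) (h : IndepFun (fun ω i => Y i ω) (fun ω i => U i ω) P) :
    iIndepFun (fun i ω => (Y i ω, U i ω)) P := by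
  classical
  let π : ι → Set (Set Ω) := fun i => {S | ∃ a b, MeasurableSet a ∧ MeasurableSet b ∧
    S = Y i ⁻¹' a ∩ U i ⁻¹' b}
  refine iIndepSets.iIndep (π := π) (fun i => ((hY i).prodMk (hU i)).comap_le) (fun i => ?_)
    (fun i => ?_) ?_
  · rintro _ ⟨a, b, ha, hb, rfl⟩ _ ⟨a', b', ha', hb', rfl⟩ -
    refine ⟨a ∩ a', b ∩ b', ha.inter ha', hb.inter hb', ?_⟩
    ext ω
    simp only [Set.mem_inter_iff, Set.mem_preimage]
    tauto
  · rw [← generateFrom_prod, MeasurableSpace.comap_generateFrom]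
    congr 1
    ext S
    constructor
    · rintro ⟨_, ⟨a, ha, b, hb, rfl⟩, rfl⟩
      exact ⟨a, b, ha, hb, rfl⟩
    · rintro ⟨a, b, ha, hb, rfl⟩
      exact ⟨_, ⟨a, ha, b, hb, rfl⟩, rfl⟩
  · rw [iIndepSets_iff]
    intro s f hf
    choose! a b ha hb hab using hf
    have h1 : (⋂ i ∈ s, f i) = (⋂ i ∈ s, Y i ⁻¹' a i) ∩ ⋂ i ∈ s, U i ⁻¹' b i := by
      simp_rw [← Set.iInter_inter_distrib]
      exact Set.iInter₂_congr hab
    have h2 := h.measure_inter_preimage_eq_mul _ _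
      (MeasurableSet.pi s.countable_toSet fun i hi => ha i hi)
      (MeasurableSet.pi s.countable_toSet fun i hi => hb i hi)
    have e1 : (fun ω i => Y i ω) ⁻¹' (s : Set ι).pi a = ⋂ i ∈ s, Y i ⁻¹' a i := by
      ext ω; simp [Set.mem_pi]
    have e2 : (fun ω i => U i ω) ⁻¹' (s : Set ι).pi b = ⋂ i ∈ s, U i ⁻¹' b i := by
      ext ω; simp [Set.mem_pi]
    rw [e1, e2, hYi.measure_inter_preimage_eq_mul s ha, hUi.measure_inter_preimage_eq_mul s hb,
      ← Finset.prod_mul_distrib] at h2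
    rw [h1, h2]
    refine Finset.prod_congr rfl fun i hi => ?_
    rw [hab i hi]
    have hi' : IndepFun (Y i) (U i) P :=
      h.comp (φ := fun y : ι → A => y i) (ψ := fun y : ι → B => y i) (measurable_pi_apply i)
        (measurable_pi_apply i)
    exact (hi'.measure_inter_preimage_eq_mul _ _ (ha i hi) (hb i hi)).symm

namespace LHPQ

variable {Ω : Type u} [MeasurableSpace Ω] {P : Measure Ω} {ν : Measure ℝ}
  {X : Ω → Marks} {T : Ω → Site → ℕ → ℝ}

theorem IsModel.isProbabilityMeasure_markLaw [IsProbabilityMeasure P] (h : IsModel P ν X T) :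
    IsProbabilityMeasure markLaw := by
  rw [← h.law_marks (0, [])]
  exact Measure.isProbabilityMeasure_map (h.measurable_marks _).aemeasurable

theorem IsModel.map_marks [IsProbabilityMeasure markLaw] (h : IsModel P ν X T) :
    P.map X = forestLaw := by
  have := h.indep_marks.map_fun_eq_infinitePi_map h.measurable_marks
  simp only [h.law_marks] at this
  exact this

theorem IsModel.map_weights [IsProbabilityMeasure ν] (h : IsModel P ν X T) :
    P.map T = Measure.infinitePi fun _ : Site => Measure.infinitePi fun _ : ℕ => ν := by
  have h1 := h.indep_weights.map_fun_eq_infinitePi_map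
    fun e : Site × ℕ => h.measurable_weights e.1 e.2
  simp only [h.law_weights] at h1
  have h2 : Measurable fun ω (e : Site × ℕ) => T ω e.1 e.2 :=
    measurable_pi_iff.2 fun e => h.measurable_weights e.1 e.2
  rw [← Measure.infinitePi_map_curry (fun (_ : Site) (_ : ℕ) => ν), ← h1,
    Measure.map_map (MeasurableEquiv.measurable _) h2]
  rfl

theorem IsModel.measurable_X (h : IsModel P ν X T) : Measurable X :=
  measurable_pi_iff.2 h.measurable_marks

theorem IsModel.measurable_T (h : IsModel P ν X T) : Measurable T :=
  measurable_pi_iff.2 fun p => measurable_pi_iff.2 fun k => h.measurable_weights p k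

theorem IsModel.measurable_toEnv (h : IsModel P ν X T) : Measurable fun ω => toEnv (X ω) (T ω) :=
  measurable_pi_iff.2 fun p => Measurable.prodMk
    ((measurable_pi_apply p).comp (measurable_siteMarks.comp h.measurable_X))
    ((measurable_pi_apply p).comp h.measurable_T)

/-- In every model, the slots of the environment are independent with the same law, which only
depends on `ν`. -/
theorem IsModel.map_toEnv [IsProbabilityMeasure P] [IsProbabilityMeasure markLaw]
    [IsProbabilityMeasure ν] (h : IsModel P ν X T) : P.map (fun ω => toEnv (X ω) (T ω)) =
      envLaw (markLaw.prod (Measure.infinitePi fun _ : ℕ => ν)) := by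
  have hY : Measurable fun ω => siteMarks (X ω) := measurable_siteMarks.comp h.measurable_X
  have hT := h.measurable_T
  have hYp : ∀ p, Measurable fun ω => siteMarks (X ω) p := fun p => (measurable_pi_apply p).comp hY
  have hTp : ∀ p, Measurable fun ω => T ω p := fun p => (measurable_pi_apply p).comp hT
  have lawY : P.map (fun ω => siteMarks (X ω)) = Measure.infinitePi fun _ : Site => markLaw := by
    rw [← map_siteMarks, ← h.map_marks, Measure.map_map measurable_siteMarks h.measurable_X]
    rfl
  have lawYp : ∀ p, P.map (fun ω => siteMarks (X ω) p) = markLaw := by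
    intro p
    rw [← Measure.infinitePi_map_eval (fun _ : Site => markLaw) p, ← lawY,
      Measure.map_map (measurable_pi_apply p) hY]
    rfl
  have lawTp : ∀ p, P.map (fun ω => T ω p) = Measure.infinitePi fun _ : ℕ => ν := by
    intro p
    rw [← Measure.infinitePi_map_eval (fun _ : Site => Measure.infinitePi fun _ : ℕ => ν) p,
      ← h.map_weights, Measure.map_map (measurable_pi_apply p) hT]
    rfl
  have indY : iIndepFun (fun (p : Site) ω => siteMarks (X ω) p) P := by
    rw [iIndepFun_iff_map_fun_eq_infinitePi_map hYp]
    simp only [lawYp]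
    exact lawY
  have indT : iIndepFun (fun (p : Site) ω => T ω p) P := by
    rw [iIndepFun_iff_map_fun_eq_infinitePi_map hTp]
    simp only [lawTp]
    exact h.map_weights
  have hind : IndepFun (fun ω => siteMarks (X ω)) T P :=
    h.indep_marks_weights.comp (ψ := id) measurable_siteMarks measurable_id
  have := (iIndepFun_prodMk hYp hTp indY indT hind).map_fun_eq_infinitePi_map
    fun p => (hYp p).prodMk (hTp p)
  refine this.trans ?_
  unfold envLaw
  congr 1
  funext p
  have hp : IndepFun (fun ω => siteMarks (X ω) p) (fun ω => T ω p) P :=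
    hind.comp (φ := fun y : Site → Mark => y p) (ψ := fun y : Site → ℕ → ℝ => y p)
      (measurable_pi_apply p) (measurable_pi_apply p)
  rw [(indepFun_iff_map_prod_eq_prod_map_map (hYp p).aemeasurable (hTp p).aemeasurable).1 hp,
    lawTp]
  congr 1
  exact lawYp p

theorem prod_infinitePi_weight_not_mem {κ : ℝ} [IsProbabilityMeasure ν] (m : Measure Mark)
    [IsProbabilityMeasure m] (hν : ν (Set.Icc 1 κ)ᶜ = 0) (k : ℕ) :
    m.prod (Measure.infinitePi fun _ : ℕ => ν) {y | y.2 k ∉ Set.Icc 1 κ} = 0 := by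
  have hs : MeasurableSet (Set.Icc 1 κ)ᶜ := measurableSet_Icc.compl
  have h1 : (m.prod (Measure.infinitePi fun _ : ℕ => ν)).map (fun y => y.2 k) = ν := by
    change (m.prod (Measure.infinitePi fun _ : ℕ => ν)).map
      ((fun y : ℕ → ℝ => y k) ∘ Prod.snd) = ν
    rw [← Measure.map_map (measurable_pi_apply k) measurable_snd, ← Measure.snd, Measure.snd_prod,
      Measure.infinitePi_map_eval (fun _ : ℕ => ν) k]
  have h2 : Measurable fun y : Mark × (ℕ → ℝ) => y.2 k :=
    (measurable_pi_apply k).comp measurable_snd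
  rw [← h1, Measure.map_apply h2 hs] at hν
  exact hν

end LHPQ

theorem proposition13 (κ : ℝ) (ν : Measure ℝ) [IsProbabilityMeasure ν]
    (hν : ν (Set.Icc 1 κ)ᶜ = 0) :
    ∃ c ∈ Set.Icc 1 κ, ∀ (Ω : Type u) [MeasurableSpace Ω] (P : Measure Ω) [IsProbabilityMeasure P]
      (X : Ω → LHPQ.Marks) (T : Ω → LHPQ.Site → ℕ → ℝ), LHPQ.IsModel P ν X T →
      ∀ᵐ ω ∂P, Tendsto (fun r : ℕ => LHPQ.fppToLine (X ω) (T ω) r / (r : ℝ≥0∞)) atTop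
        (𝓝 (ENNReal.ofReal c)) := by
  by_cases hm : IsProbabilityMeasure markLaw
  · obtain ⟨c, hc, h⟩ := LHPQ.exists_tendsto_lineDist
      (LHPQ.prod_infinitePi_weight_not_mem markLaw hν)
    refine ⟨c, hc, fun Ω _ P _ X T hmod => ?_⟩
    rw [← hmod.map_toEnv] at h
    simp only [LHPQ.fppToLine_eq]
    exact ae_of_ae_map hmod.measurable_toEnv.aemeasurable h
  -- In a model, `markLaw` is the law of a random variable, hence a probability measure; otherwise
  -- any element of `[1, κ]` will do, and this interval is not empty because it carries `ν`.
  · have hκ : (Set.Icc 1 κ).Nonempty := by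
      rw [Set.nonempty_iff_ne_empty]
      intro h
      rw [h, Set.compl_empty, measure_univ] at hν
      exact one_ne_zero hν
    exact ⟨_, hκ.some_mem, fun Ω _ P _ X T hmod => absurd hmod.isProbabilityMeasure_markLaw hm⟩
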